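/- \textbf{Conventions.} Let $\mathbb K=\mathbb R$ or $\mathbb C$, let $(X,\mu)$ be a standard Borel probability space and $\mathcal G$ a Borel groupoid with unit space $X$, target map $t$ and source map $s$, whose set of arrows is standard Borel. $\mathcal G$ is a \emph{measured groupoid} if it carries a Borel Haar system $\rho=(\rho^x)_{x\in X}$ ($\sigma$-finite measures on $\mathcal G^x=t^{-1}(x)$, depending measurably on $x$, with $g_*\rho^{s(g)}=\rho^{t(g)}$) such that the class of $\int\rho^x\,d\mu(x)$ is invariant under $g\mapsto g^{-1}$; we fix probability measures $\nu^x\sim\rho^x$ depending measurably on $x$ and put $\nu=\int\nu^x\,d\mu(x)$. It is \emph{$t$-discrete} if all $\mathcal G^x$ are countable and the $\rho^x$ are the counting measures. A \emph{$\mathcal G$-space} $(S,\tau)$ is a standard Borel space with a Borel map $t_S:S\to X$, a Borel left action of $\mathcal G$, and probability measures $\tau^x$ on the fibres $S^x=t_S^{-1}(x)$, depending measurably on $x$, with $g_*\tau^{s(g)}\sim\tau^{t(g)}$ for all $g$; $\tau=\int\tau^x\,d\mu(x)$. The semidirect groupoid $S\rtimes\mathcal G$ over $S$ consists of the pairs $(s,g)$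 with $t_S(s)=t(g)$, with target $s$ and source $g^{-1}s$, and with the measures $\nu^{t_S(s)}$ on its target fibres. $S$ is \emph{amenable} if there are means $\mathfrak m^s$ on $\mathrm L^\infty(\mathcal G^{t_S(s)},\nu^{t_S(s)})$ (linear functionals of norm one with $\mathfrak m^s(1)=1$), $s\in S$, such that $s\mapsto\mathfrak m^s(\varphi(s,\cdot))$ is $\tau$-measurable for every bounded Borel function $\varphi$ on $S\rtimes\mathcal G$, and $g\,\mathfrak m^{g^{-1}s}=\mathfrak m^s$ for almost every $(s,g)$. A \emph{separable measurable $\mathcal G$-bundle} is a family $\mathcal F=(F_x)_{x\in X}$ of Banach spaces over $\mathbb K$ with a linear space of vector fields, called measurable sections, which is closed under multiplication by $\mu$-measurable functions and under $\mu$-a.e. limits of sequences, whose members have $\mu$-measurable norm functions, and which contains a sequence $(\sigma_n)$ such that $\{\sigma_n(x)\}_n$ is dense in $F_x$ for a.e. $x$; together with a linear isometric action $L(g):F_{s(g)}\to F_{t(g)}$ such that $g\mapsto L(g)\sigma(s(g))$ is a measurable section of the pullback $t^*\mathcal F$ for every measurable section $\sigma$. (The measurable sections of a pullback bundle are those obtained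 from the pullbacks of measurable sections by sums, products with measurable functions and a.e. limits.) Its \emph{dual} $\mathcal E=(F_x^*)_{x}$ carries the dual action, and $\eta$ is a measurable section of $\mathcal E$ if $x\mapsto\langle\eta(x),\sigma(x)\rangle$ is $\mu$-measurable for every measurable section $\sigma$ of $\mathcal F$. For a $\mathcal G$-space $S$ and $n\ge 0$ let $\mathcal L(S^{(n+1)},\mathcal E)$ be the $\mathcal G$-bundle with fibres $\mathrm L^\infty_{\mathrm w^*}((S^x)^{n+1},(\tau^x)^{\otimes n+1};E_x)$ (classes of weak-$*$ measurable essentially bounded functions), action $(g\lambda)(s_0,\dots,s_n)=L(g)\,\lambda(g^{-1}s_0,\dots,g^{-1}s_n)$, and measurable structure dual to that of the bundle $x\mapsto\mathrm L^1((S^x)^{n+1},F_x)$, which is generated by the measurable sections of the pullback of $\mathcal F$ to the fibred power $S^{(n+1)}$ that are integrable on almost every fibre. Let $\delta$ be the homogeneous coboundary $\delta f(s_0,\dots,s_{n+1})=\sum_i(-1)^if(s_0,\dots,\widehat{s_i},\dots,s_{n+1})$ and let $\epsilon:\mathcal E\to\mathcal L(S,\mathcal E)$ be the inclusion of the constant functions.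 For a $\mathcal G$-bundle $\mathcal B$ write $\mathrm L^\infty(X,\mathcal B)^{\mathcal G}$ for the space of $\mu$-a.e. classes of measurable, essentially bounded sections $\sigma$ with $g\,\sigma(s(g))=\sigma(t(g))$ for $\nu$-a.e. $g$. The action of $\mathcal G$ on itself by left multiplication, with the measures $\nu^x$, is a $\mathcal G$-space, and $\mathrm H^k_{\mathrm{mb}}(\mathcal G,\mathcal E)$ is the $k$-th cohomology of the complex $\mathrm L^\infty(X,\mathcal L(\mathcal G^{(\bullet+1)},\mathcal E))^{\mathcal G}$. A \emph{$\mathcal G$-morphism} of bundles is a family of bounded operators between the fibres, essentially bounded in norm, which maps measurable sections to measurable sections and is equivariant for a.e. $g$. \textbf{Theorem A.} Let $\mathcal G$ be a $t$-discrete measured groupoid over $(X,\mu)$ and let $(S,\tau)$ be an amenable $\mathcal G$-space. For every measurable $\mathcal G$-bundle $\mathcal E$ that is the dual of a separable measurable $\mathcal G$-bundle $\mathcal F$, and every $k\ge 0$, there is a linear isomorphism $$\Phi^k_{\mathcal E}:\ \mathrm H^k\bigl(\mathrm L^\infty(X,\mathcal L(S^{(\bullet+1)},\mathcal E))^{\mathcal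 G}\bigr)\ \xrightarrow{\ \cong\ }\ \mathrm H^k_{\mathrm{mb}}(\mathcal G,\mathcal E)$$ which is natural in the following sense. (i) There is a $\mathcal G$-morphism of complexes $\mathcal L(S^{(\bullet+1)},\mathcal E)\to\mathcal L(\mathcal G^{(\bullet+1)},\mathcal E)$ that extends the identity of $\mathcal E$ (that is, it is compatible with the inclusions $\epsilon$), and every such morphism induces the maps $\Phi^k_{\mathcal E}$ in cohomology. (ii) If $\psi:\mathcal F\to\mathcal F'$ is a $\mathcal G$-morphism of separable measurable $\mathcal G$-bundles, with duals $\mathcal E$ and $\mathcal E'$, and $\psi^*:\mathcal E'\to\mathcal E$ is its adjoint, then $\psi^*\circ\Phi^k_{\mathcal E'}=\Phi^k_{\mathcal E}\circ\psi^*$, where $\psi^*$ also denotes the maps induced in cohomology by $f\mapsto\psi^*\circ f$. -/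

import Mathlib

open CategoryTheory MeasureTheory Filter Topology
open scoped ENNReal

universe u

noncomputable section

namespace MBC

/-! ### Weak-* measurable essentially bounded functions with values in a dual Banach space -/

section WeakStar

variable {𝕜 : Type} [RCLike 𝕜]
variable {Y Z : Type u} [MeasurableSpace Y] [MeasurableSpace Z]
variable {V W U : Type u} [NormedAddCommGroup V] [NormedSpace 𝕜 V]
  [NormedAddCommGroup W] [NormedSpace 𝕜 W] [NormedAddCommGroup U] [NormedSpace 𝕜 U]

variable (𝕜) in
/-- The functions `f : Y → V*` which are weak-* measurable (all `y ↦ ⟨f y, v⟩` are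
`m`-measurable) and essentially bounded in norm. -/
def weakStarBounded (m : Measure Y) (V : Type u) [NormedAddCommGroup V] [NormedSpace 𝕜 V] :
    Submodule 𝕜 (Y → StrongDual 𝕜 V) where
  carrier := {f | (∀ v, AEStronglyMeasurable (fun y => f y v) m) ∧
    ∃ C : ℝ, ∀ᵐ y ∂m, ‖f y‖ ≤ C}
  zero_mem' := by
    refine ⟨fun v => ?_, 0, ae_of_all _ fun y => ?_⟩
    · simpa using aestronglyMeasurable_const
    · simp
  add_mem' := by
    rintro f g ⟨hf, C, hC⟩ ⟨hg, D, hD⟩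
    refine ⟨fun v => (hf v).add (hg v), C + D, ?_⟩
    filter_upwards [hC, hD] with y h1 h2
    exact (norm_add_le (f y) (g y)).trans (add_le_add h1 h2)
  smul_mem' := by
    rintro c f ⟨hf, C, hC⟩
    refine ⟨fun v => (hf v).const_smul c, ‖c‖ * C, ?_⟩
    filter_upwards [hC] with y h1
    exact (norm_smul_le c (f y)).trans (mul_le_mul_of_nonneg_left h1 (norm_nonneg c))

variable (𝕜) in
/-- The space of functions `weakStarBounded`, as a seminormed space for the essential supremum. -/
def WLinfPre (m : Measure Y) (V : Type u) [NormedAddCommGroup V] [NormedSpace 𝕜 V] : Type u :=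
  weakStarBounded 𝕜 m V

instance (m : Measure Y) : AddCommGroup (WLinfPre 𝕜 m V) :=
  inferInstanceAs (AddCommGroup (weakStarBounded 𝕜 m V))

instance (m : Measure Y) : Module 𝕜 (WLinfPre 𝕜 m V) :=
  inferInstanceAs (Module 𝕜 (weakStarBounded 𝕜 m V))

/-- The underlying function. -/
def WLinfPre.fn {m : Measure Y} (f : WLinfPre 𝕜 m V) : Y → StrongDual 𝕜 V := f.1

theorem WLinfPre.meas {m : Measure Y} (f : WLinfPre 𝕜 m V) (v : V) :
    AEStronglyMeasurable (fun y => f.fn y v) m := f.2.1 v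

/-- The essential supremum of `‖f‖`. -/
instance (m : Measure Y) : Norm (WLinfPre 𝕜 m V) :=
  ⟨fun f => sInf {C : ℝ | 0 ≤ C ∧ ∀ᵐ y ∂m, ‖f.fn y‖ ≤ C}⟩

theorem WLinfPre.norm_nonneg' {m : Measure Y} (f : WLinfPre 𝕜 m V) : 0 ≤ ‖f‖ :=
  Real.sInf_nonneg fun _ h => h.1

theorem WLinfPre.norm_le {m : Measure Y} (f : WLinfPre 𝕜 m V) {C : ℝ} (hC : 0 ≤ C)
    (h : ∀ᵐ y ∂m, ‖f.fn y‖ ≤ C) : ‖f‖ ≤ C :=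
  csInf_le ⟨0, fun _ h => h.1⟩ ⟨hC, h⟩

theorem WLinfPre.ae_norm_le {m : Measure Y} (f : WLinfPre 𝕜 m V) :
    ∀ᵐ y ∂m, ‖f.fn y‖ ≤ ‖f‖ := by
  have hne : {C : ℝ | 0 ≤ C ∧ ∀ᵐ y ∂m, ‖f.fn y‖ ≤ C}.Nonempty := by
    obtain ⟨C, hC⟩ := f.2.2
    exact ⟨max C 0, le_max_right _ _, hC.mono fun y hy => hy.trans (le_max_left _ _)⟩
  have h : ∀ n : ℕ, ∀ᵐ y ∂m, ‖f.fn y‖ ≤ ‖f‖ + 1 / ((n : ℝ) + 1) := by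
    intro n
    obtain ⟨C, hC, hlt⟩ := exists_lt_of_csInf_lt hne
      (lt_add_of_pos_right ‖f‖ (Nat.one_div_pos_of_nat (α := ℝ) (n := n)))
    exact hC.2.mono fun y hy => hy.trans hlt.le
  filter_upwards [ae_all_iff.2 h] with y hy
  refine ge_of_tendsto' (x := atTop) (f := fun n : ℕ => ‖f‖ + 1 / ((n : ℝ) + 1)) ?_ hy
  simpa using tendsto_const_nhds.add (tendsto_one_div_add_atTop_nhds_zero_nat (𝕜 := ℝ))

theorem WLinfPre.core (m : Measure Y) : SeminormedSpace.Core 𝕜 (WLinfPre 𝕜 m V) where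
  norm_nonneg f := f.norm_nonneg'
  norm_smul c f := by
    have key : ∀ (c : 𝕜) (f : WLinfPre 𝕜 m V), ‖c • f‖ ≤ ‖c‖ * ‖f‖ := by
      intro c f
      refine WLinfPre.norm_le _ (mul_nonneg (norm_nonneg c) f.norm_nonneg') ?_
      filter_upwards [f.ae_norm_le] with y hy
      exact (norm_smul_le c (f.fn y)).trans (mul_le_mul_of_nonneg_left hy (norm_nonneg c))
    refine le_antisymm (key c f) ?_
    by_cases hc : c = 0
    · rw [hc, norm_zero, zero_mul]; exact WLinfPre.norm_nonneg' _
    · have h := key c⁻¹ (c • f)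
      rw [inv_smul_smul₀ hc, norm_inv] at h
      have hc' : 0 < ‖c‖ := norm_pos_iff.2 hc
      calc ‖c‖ * ‖f‖ ≤ ‖c‖ * (‖c‖⁻¹ * ‖c • f‖) := mul_le_mul_of_nonneg_left h hc'.le
        _ = ‖c • f‖ := by field_simp
  norm_triangle f g := by
    refine WLinfPre.norm_le _ (add_nonneg f.norm_nonneg' g.norm_nonneg') ?_
    filter_upwards [f.ae_norm_le, g.ae_norm_le] with y h1 h2
    exact (norm_add_le (f.fn y) (g.fn y)).trans (add_le_add h1 h2)

instance (m : Measure Y) : SeminormedAddCommGroup (WLinfPre 𝕜 m V) :=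
  SeminormedAddCommGroup.ofCore (WLinfPre.core (𝕜 := 𝕜) m)

instance (m : Measure Y) : NormedSpace 𝕜 (WLinfPre 𝕜 m V) where
  norm_smul_le c f := ((WLinfPre.core (𝕜 := 𝕜) m).norm_smul c f).le

variable (𝕜) in
/-- `L^∞_{w*}((Y, m), V*)`: weak-* measurable essentially bounded functions `Y → V*`, two of them
being identified when they agree almost everywhere (see `WLinf.mk_eq_mk`), with the essential
supremum norm. -/
def WLinf (m : Measure Y) (V : Type u) [NormedAddCommGroup V] [NormedSpace 𝕜 V] : Type u :=
  SeparationQuotient (WLinfPre 𝕜 m V)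

instance (m : Measure Y) : NormedAddCommGroup (WLinf 𝕜 m V) :=
  inferInstanceAs (NormedAddCommGroup (SeparationQuotient (WLinfPre 𝕜 m V)))

instance (m : Measure Y) : NormedSpace 𝕜 (WLinf 𝕜 m V) :=
  inferInstanceAs (NormedSpace 𝕜 (SeparationQuotient (WLinfPre 𝕜 m V)))

/-- The class of a function. -/
def WLinf.mk (m : Measure Y) : WLinfPre 𝕜 m V →L[𝕜] WLinf 𝕜 m V :=
  SeparationQuotient.mkCLM 𝕜 (WLinfPre 𝕜 m V)

theorem WLinf.mk_surjective (m : Measure Y) :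
    Function.Surjective (WLinf.mk (𝕜 := 𝕜) (V := V) m) :=
  SeparationQuotient.surjective_mk

theorem WLinf.norm_mk (m : Measure Y) (f : WLinfPre 𝕜 m V) : ‖WLinf.mk m f‖ = ‖f‖ :=
  SeparationQuotient.norm_mk f

theorem WLinf.mk_eq_mk (m : Measure Y) (f g : WLinfPre 𝕜 m V) :
    WLinf.mk m f = WLinf.mk m g ↔ f.fn =ᵐ[m] g.fn := by
  rw [← sub_eq_zero, ← map_sub, ← norm_eq_zero, WLinf.norm_mk]
  constructor
  · intro h
    filter_upwards [(f - g).ae_norm_le] with y hy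
    rw [h] at hy
    exact sub_eq_zero.1 (norm_le_zero_iff.1 hy)
  · intro h
    refine le_antisymm (WLinfPre.norm_le _ le_rfl ?_) (norm_nonneg _)
    filter_upwards [h] with y hy
    exact norm_le_zero_iff.2 (sub_eq_zero.2 hy)

/-- A representative of a class. -/
def WLinf.rep {m : Measure Y} (q : WLinf 𝕜 m V) : WLinfPre 𝕜 m V :=
  Function.surjInv (WLinf.mk_surjective m) q

theorem WLinf.mk_rep {m : Measure Y} (q : WLinf 𝕜 m V) : WLinf.mk m q.rep = q :=
  Function.surjInv_eq (WLinf.mk_surjective m) q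

/-- The operator `f ↦ θ* ∘ f ∘ T` on functions, for `T` quasi-measure-preserving and `θ : W → V`
bounded linear, where `θ* : V* → W*` is the adjoint of `θ`. -/
def WLinfPre.pull {m : Measure Y} {m' : Measure Z} (T : Y → Z)
    (hT : Measure.QuasiMeasurePreserving T m m') (θ : W →L[𝕜] V) :
    WLinfPre 𝕜 m' V →ₗ[𝕜] WLinfPre 𝕜 m W where
  toFun f := ⟨fun y => (f.fn (T y)).comp θ,
    fun w => (f.meas (θ w)).comp_quasiMeasurePreserving hT, ‖f‖ * ‖θ‖,
      (hT.ae f.ae_norm_le).mono fun y hy =>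
        (ContinuousLinearMap.opNorm_comp_le _ _).trans
          (mul_le_mul_of_nonneg_right hy (norm_nonneg θ))⟩
  map_add' f g := by apply Subtype.ext; funext y; exact ContinuousLinearMap.add_comp _ _ _
  map_smul' c f := by apply Subtype.ext; funext y; exact ContinuousLinearMap.smul_comp _ _ _

theorem WLinfPre.norm_pull_le {m : Measure Y} {m' : Measure Z} (T : Y → Z)
    (hT : Measure.QuasiMeasurePreserving T m m') (θ : W →L[𝕜] V) (f : WLinfPre 𝕜 m' V) :
    ‖WLinfPre.pull T hT θ f‖ ≤ ‖θ‖ * ‖f‖ := by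
  refine WLinfPre.norm_le _ (mul_nonneg (norm_nonneg θ) (norm_nonneg f)) ?_
  filter_upwards [hT.ae f.ae_norm_le] with y hy
  refine (ContinuousLinearMap.opNorm_comp_le (f.fn (T y)) θ).trans ?_
  rw [mul_comm]
  exact mul_le_mul_of_nonneg_left hy (norm_nonneg θ)

/-- The operator `f ↦ θ* ∘ f ∘ T` from `L^∞_{w*}((Z, m'), V*)` to `L^∞_{w*}((Y, m), W*)`. -/
def WLinf.pull {m : Measure Y} {m' : Measure Z} (T : Y → Z)
    (hT : Measure.QuasiMeasurePreserving T m m') (θ : W →L[𝕜] V) :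
    WLinf 𝕜 m' V →L[𝕜] WLinf 𝕜 m W :=
  SeparationQuotient.liftCLM
    ((WLinf.mk m).comp
      ((WLinfPre.pull T hT θ).mkContinuous ‖θ‖ (WLinfPre.norm_pull_le T hT θ)))
    (fun _ _ h => (h.map (ContinuousLinearMap.continuous _)).eq)

theorem WLinf.pull_mk {m : Measure Y} {m' : Measure Z} (T : Y → Z)
    (hT : Measure.QuasiMeasurePreserving T m m') (θ : W →L[𝕜] V) (f : WLinfPre 𝕜 m' V) :
    WLinf.pull T hT θ (WLinf.mk m' f) = WLinf.mk m (WLinfPre.pull T hT θ f) := rfl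

theorem WLinf.norm_pull_le {m : Measure Y} {m' : Measure Z} (T : Y → Z)
    (hT : Measure.QuasiMeasurePreserving T m m') (θ : W →L[𝕜] V) (q : WLinf 𝕜 m' V) :
    ‖WLinf.pull T hT θ q‖ ≤ ‖θ‖ * ‖q‖ := by
  obtain ⟨f, rfl⟩ := WLinf.mk_surjective m' q
  rw [WLinf.pull_mk, WLinf.norm_mk, WLinf.norm_mk]
  exact WLinfPre.norm_pull_le T hT θ f

theorem WLinf.pull_congr {m : Measure Y} {m' : Measure Z} {T T' : Y → Z}
    (hT : Measure.QuasiMeasurePreserving T m m') (hT' : Measure.QuasiMeasurePreserving T' m m')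
    {θ θ' : W →L[𝕜] V} (h : T = T') (h' : θ = θ') (q : WLinf 𝕜 m' V) :
    WLinf.pull T hT θ q = WLinf.pull T' hT' θ' q := by
  subst h; subst h'; rfl

theorem WLinf.pull_id {m : Measure Y} (q : WLinf 𝕜 m V) :
    WLinf.pull id (Measure.QuasiMeasurePreserving.id m) (ContinuousLinearMap.id 𝕜 V) q = q := by
  obtain ⟨f, rfl⟩ := WLinf.mk_surjective m q
  rfl

theorem WLinf.pull_pull {X : Type u} [MeasurableSpace X] {m : Measure Y} {m' : Measure Z}
    {m'' : Measure X} (T : Y → Z) (hT : Measure.QuasiMeasurePreserving T m m') (θ : W →L[𝕜] V)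
    (R : Z → X) (hR : Measure.QuasiMeasurePreserving R m' m'') (η : V →L[𝕜] U)
    (q : WLinf 𝕜 m'' U) :
    WLinf.pull T hT θ (WLinf.pull R hR η q) = WLinf.pull (R ∘ T) (hR.comp hT) (η.comp θ) q := by
  obtain ⟨f, rfl⟩ := WLinf.mk_surjective m'' q
  rfl

/-- The constant function with a given value. -/
def WLinf.const (m : Measure Y) : StrongDual 𝕜 V →L[𝕜] WLinf 𝕜 m V :=
  (WLinf.mk m).comp
    (LinearMap.mkContinuous
      { toFun := fun e => (⟨fun _ => e, fun _ => aestronglyMeasurable_const, ‖e‖,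
          ae_of_all _ fun _ => le_rfl⟩ :
          WLinfPre 𝕜 m V)
        map_add' := fun _ _ => rfl
        map_smul' := fun _ _ => rfl : StrongDual 𝕜 V →ₗ[𝕜] WLinfPre 𝕜 m V } 1
      (fun e => by
        rw [one_mul]
        exact WLinfPre.norm_le _ (norm_nonneg e) (ae_of_all _ fun _ => le_rfl)))

/-- The duality pairing `⟨q, η⟩ = ∫ ⟨q(y), η(y)⟩ dm(y)` between `L^∞_{w*}((Y, m), V*)` and
`L^1((Y, m), V)`. -/
def WLinf.pair {m : Measure Y} (q : WLinf 𝕜 m V) (η : Lp V 1 m) : 𝕜 :=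
  ∫ y, q.rep.fn y (η y) ∂m

theorem WLinfPre.integrable_pair {m : Measure Y} (f : WLinfPre 𝕜 m V) (η : Lp V 1 m) :
    Integrable (fun y => f.fn y (η y)) m := by
  have hη : Integrable η m := L1.integrable_coeFn η
  have hmeas : AEStronglyMeasurable (fun y => f.fn y (η y)) m := by
    obtain ⟨η', hη', he⟩ := hη.1
    have hs : ∀ s : SimpleFunc Y V, AEStronglyMeasurable (fun y => f.fn y (s y)) m := by
      intro s
      induction s using SimpleFunc.induction with
      | const c hs =>
        rename_i A
        refine ((f.meas c).indicator hs).congr (ae_of_all _ fun y => ?_)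
        by_cases hy : y ∈ A <;> simp [hy]
      | add _ h1 h2 =>
        refine (h1.add h2).congr (ae_of_all _ fun y => ?_)
        simp
    have h' : AEStronglyMeasurable (fun y => f.fn y (η' y)) m :=
      aestronglyMeasurable_of_tendsto_ae atTop (fun n => hs (hη'.approx n))
        (ae_of_all _ fun y => ((f.fn y).continuous.tendsto _).comp (hη'.tendsto_approx y))
    exact h'.congr (by filter_upwards [he] with y hy; rw [hy])
  refine (hη.norm.const_mul ‖f‖).mono' hmeas ?_
  filter_upwards [f.ae_norm_le] with y hy
  exact (ContinuousLinearMap.le_opNorm _ _).trans (by gcongr)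

theorem WLinf.pair_mk {m : Measure Y} (f : WLinfPre 𝕜 m V) (η : Lp V 1 m) :
    (WLinf.mk m f).pair η = ∫ y, f.fn y (η y) ∂m := by
  refine integral_congr_ae ?_
  filter_upwards [(WLinf.mk_eq_mk m _ _).1 (WLinf.mk_rep (WLinf.mk m f))] with y hy
  rw [hy]

theorem WLinf.pair_zero {m : Measure Y} (η : Lp V 1 m) : (0 : WLinf 𝕜 m V).pair η = 0 := by
  rw [← map_zero (WLinf.mk m), WLinf.pair_mk]
  exact integral_zero _ _

theorem WLinf.pair_add {m : Measure Y} (q q' : WLinf 𝕜 m V) (η : Lp V 1 m) :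
    (q + q').pair η = q.pair η + q'.pair η := by
  obtain ⟨f, rfl⟩ := WLinf.mk_surjective m q
  obtain ⟨f', rfl⟩ := WLinf.mk_surjective m q'
  rw [← map_add, WLinf.pair_mk, WLinf.pair_mk, WLinf.pair_mk]
  exact integral_add (f.integrable_pair η) (f'.integrable_pair η)

theorem WLinf.pair_smul {m : Measure Y} (c : 𝕜) (q : WLinf 𝕜 m V) (η : Lp V 1 m) :
    (c • q).pair η = c * q.pair η := by
  obtain ⟨f, rfl⟩ := WLinf.mk_surjective m q
  rw [← map_smul, WLinf.pair_mk, WLinf.pair_mk]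
  exact integral_const_mul c _

end WeakStar

/-! ### Borel groupoids and measured groupoids -/

/-- The total space of a family of sets `S x`, `x ∈ X`: a space fibred over `X`. -/
def Total {X : Type u} (S : X → Type u) : Type u := Σ x, S x

/-- The inclusion of a fibre in the total space. -/
def Total.mk {X : Type u} {S : X → Type u} (x : X) (s : S x) : Total S := ⟨x, s⟩

/-- The measure `∫ τ^x dμ(x)` on the total space. -/
def integrate {X : Type u} [MeasurableSpace X] {S : X → Type u} [∀ x, MeasurableSpace (S x)]
    [MeasurableSpace (Total S)] (μ : Measure X) (τ : ∀ x, Measure (S x)) : Measure (Total S) :=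
  μ.bind fun x => (τ x).map (Total.mk x)

/-- The family of measures `τ^x` on the fibres depends measurably on `x`. -/
def IsMeasurableFamily {X : Type u} [MeasurableSpace X] {S : X → Type u}
    [∀ x, MeasurableSpace (S x)] [MeasurableSpace (Total S)] (τ : ∀ x, Measure (S x)) : Prop :=
  ∀ A : Set (Total S), MeasurableSet A → Measurable fun x => τ x (Total.mk x ⁻¹' A)

section Groupoid

variable {X : Type u}

/-- The fibre `G^y` of the target map: the arrows with target `y`. -/
def ArrowsTo (X : Type u) [Groupoid.{u} X] (y : X) : Type u := Σ x : X, (x ⟶ y)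

/-- The set `G` of all arrows; for `a : Arrows X` the target is `a.1`, the source is `a.2.1` and
the arrow is `a.2.2 : a.2.1 ⟶ a.1`. -/
abbrev Arrows (X : Type u) [Groupoid.{u} X] : Type u := Total (ArrowsTo X)

/-- An arrow as a point of `G`. -/
def arrow [Groupoid.{u} X] {x y : X} (g : x ⟶ y) : Arrows X := ⟨y, x, g⟩

/-- The product `h ↦ g h` from `G^{s(g)}` to `G^{t(g)}`. (In Mathlib's order of composition `g h` is
`h ≫ g`.) -/
def leftMul [Groupoid.{u} X] {x y : X} (g : x ⟶ y) (h : ArrowsTo X x) : ArrowsTo X y :=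
  ⟨h.1, h.2 ≫ g⟩

/-- The map `(g, s) ↦ g s`, defined on the fibred product `G * S = {(g, s) | s(g) = t_S(s)}` with the
`σ`-algebra induced by `G × S`, is measurable. -/
def IsMeasurableAction [Groupoid.{u} X] {S : X → Type u} [MeasurableSpace (Arrows X)]
    [MeasurableSpace (Total S)] (act : ∀ {x y : X}, (x ⟶ y) → S x → S y) : Prop :=
  @Measurable (Σ x y : X, (x ⟶ y) × S x) (Total S)
    (MeasurableSpace.comap
      (fun p => ((arrow p.2.2.1, Total.mk p.1 p.2.2.2) : Arrows X × Total S)) inferInstance) _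
    (fun p => Total.mk p.2.1 (act p.2.2.1 p.2.2.2))

/-- A Borel groupoid with unit space `X`: the set of arrows is a standard Borel space, and the
structure maps are Borel. The fibres `G^y` carry the induced `σ`-algebras. -/
class BorelGroupoid (X : Type u) [MeasurableSpace X] extends Groupoid.{u} X where
  [measTo : ∀ y, MeasurableSpace (ArrowsTo X y)]
  [measArrows : MeasurableSpace (Arrows X)]
  [standardBorel : StandardBorelSpace (Arrows X)]
  measurableEmbedding_mk : ∀ y, MeasurableEmbedding (Total.mk y : ArrowsTo X y → Arrows X)
  measurable_target : Measurable fun a : Arrows X => a.1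
  measurable_source : Measurable fun a : Arrows X => a.2.1
  measurable_unit : Measurable fun x : X => arrow (𝟙 x)
  measurable_inv : Measurable fun a : Arrows X => arrow (Groupoid.inv a.2.2)
  measurable_mul : IsMeasurableAction (X := X) (S := ArrowsTo X) (fun g h => leftMul g h)

attribute [reducible, instance] BorelGroupoid.measTo BorelGroupoid.measArrows
attribute [instance] BorelGroupoid.standardBorel

variable [MeasurableSpace X] [BorelGroupoid X]

/-- A Borel Haar system. -/
structure HaarSystem (X : Type u) [MeasurableSpace X] [BorelGroupoid X] where
  /-- The measure `ρ^x` on `G^x`. -/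
  ρ : ∀ x : X, Measure (ArrowsTo X x)
  sigmaFinite : ∀ x, SigmaFinite (ρ x)
  measurable : IsMeasurableFamily ρ
  invariant : ∀ {x y : X} (g : x ⟶ y), (ρ x).map (leftMul g) = ρ y

/-- A measured groupoid over `(X, μ)`: a Borel groupoid with a Haar system `ρ` such that `ρ ∘ μ` is
quasi-invariant, together with an equivalent normalization, that is, a family of probability
measures `ν^x ∼ ρ^x`; the probability measure on `G` is `ν = ∫ ν^x dμ(x)`. -/
structure MeasuredGroupoid (X : Type u) [MeasurableSpace X] [BorelGroupoid X]
    (μ : Measure X) where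
  haar : HaarSystem X
  quasiInvariant :
    (integrate μ haar.ρ).map (fun a => arrow (Groupoid.inv a.2.2)) ≪ integrate μ haar.ρ ∧
    integrate μ haar.ρ ≪ (integrate μ haar.ρ).map (fun a => arrow (Groupoid.inv a.2.2))
  /-- The normalized measure `ν^x` on `G^x`. -/
  ν : ∀ x : X, Measure (ArrowsTo X x)
  [probability : ∀ x, IsProbabilityMeasure (ν x)]
  measurable_ν : IsMeasurableFamily ν
  equiv : ∀ x, ν x ≪ haar.ρ x ∧ haar.ρ x ≪ ν x

attribute [instance] MeasuredGroupoid.probability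

variable {μ : Measure X}

/-- The probability measure `ν = ∫ ν^x dμ(x)` on `G`. -/
def MeasuredGroupoid.arrowMeasure (M : MeasuredGroupoid X μ) : Measure (Arrows X) :=
  integrate μ M.ν

/-- A measured groupoid is `t`-discrete if the fibres of the target map are countable and the Haar
system consists of the counting measures. -/
def MeasuredGroupoid.IsTDiscrete (M : MeasuredGroupoid X μ) : Prop :=
  ∀ x, Countable (ArrowsTo X x) ∧ M.haar.ρ x = Measure.count

/-- A left `G`-space `(S, τ)`, presented through the fibres of `t_S : S → X`: a standard Borel
space with a Borel action of `G`, and with probability measures `τ^x` on the fibres such that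
`g_* τ^{s(g)} ∼ τ^{t(g)}`; the measure on `S` is `τ = ∫ τ^x dμ(x)`. -/
structure GSpace (X : Type u) [MeasurableSpace X] [BorelGroupoid X] where
  fiber : X → Type u
  [measFiber : ∀ x, MeasurableSpace (fiber x)]
  [measTotal : MeasurableSpace (Total fiber)]
  [standardBorel : StandardBorelSpace (Total fiber)]
  measurableEmbedding_mk : ∀ x, MeasurableEmbedding (Total.mk x : fiber x → Total fiber)
  measurable_proj : Measurable fun s : Total fiber => s.1
  act : ∀ {x y : X}, (x ⟶ y) → fiber x → fiber y
  act_id : ∀ (x : X) (s : fiber x), act (𝟙 x) s = s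
  act_comp : ∀ {x y z : X} (h : x ⟶ y) (g : y ⟶ z) (s : fiber x), act (h ≫ g) s = act g (act h s)
  measurable_act : IsMeasurableAction act
  τ : ∀ x : X, Measure (fiber x)
  [probability : ∀ x, IsProbabilityMeasure (τ x)]
  measurable_τ : IsMeasurableFamily τ
  quasiInvariant : ∀ {x y : X} (g : x ⟶ y),
    (τ x).map (act g) ≪ τ y ∧ τ y ≪ (τ x).map (act g)

attribute [instance] GSpace.measFiber GSpace.measTotal GSpace.standardBorel GSpace.probability

theorem measurable_act_fiber {S : X → Type u} [∀ x, MeasurableSpace (S x)]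
    [MeasurableSpace (Total S)]
    (hS : ∀ x, MeasurableEmbedding (Total.mk x : S x → Total S))
    {act : ∀ {x y : X}, (x ⟶ y) → S x → S y} (h : IsMeasurableAction act) {x y : X} (g : x ⟶ y) :
    Measurable (act g : S x → S y) := by
  refine (hS y).measurable_comp_iff.1 ?_
  have h1 : @Measurable (S x) (Σ x y : X, (x ⟶ y) × S x) _
      (MeasurableSpace.comap
        (fun p => ((arrow p.2.2.1, Total.mk p.1 p.2.2.2) : Arrows X × Total S)) inferInstance)
      (fun s => ⟨x, y, g, s⟩) :=
    measurable_comap_iff.2 <| by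
      change Measurable fun s => ((arrow g, Total.mk x s) : Arrows X × Total S)
      exact measurable_const.prodMk (hS x).measurable
  exact @Measurable.comp (S x) (Σ x y : X, (x ⟶ y) × S x) (Total S) _ (MeasurableSpace.comap
    (fun p => ((arrow p.2.2.1, Total.mk p.1 p.2.2.2) : Arrows X × Total S)) inferInstance) _
    (fun p => Total.mk p.2.1 (act p.2.2.1 p.2.2.2)) _ h h1

theorem GSpace.quasiMeasurePreserving_act (S : GSpace X) {x y : X} (g : x ⟶ y) :
    Measure.QuasiMeasurePreserving (S.act g) (S.τ x) (S.τ y) :=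
  ⟨measurable_act_fiber S.measurableEmbedding_mk S.measurable_act g, (S.quasiInvariant g).1⟩

/-- A measured groupoid acting on itself by left multiplication, with the measures `ν^x`. -/
def MeasuredGroupoid.regular (M : MeasuredGroupoid X μ) : GSpace X where
  fiber := ArrowsTo X
  measurableEmbedding_mk := BorelGroupoid.measurableEmbedding_mk
  measurable_proj := BorelGroupoid.measurable_target
  act g h := leftMul g h
  act_id x s := by
    obtain ⟨z, k⟩ := s
    exact congrArg (Sigma.mk z) (Category.comp_id k)
  act_comp h g s := by
    obtain ⟨z, k⟩ := s
    exact congrArg (Sigma.mk z) (Category.assoc k h g).symm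
  measurable_act := BorelGroupoid.measurable_mul
  τ := M.ν
  measurable_τ := M.measurable_ν
  quasiInvariant {x y} g := by
    have hm : Measurable (leftMul g : ArrowsTo X x → ArrowsTo X y) :=
      measurable_act_fiber (S := ArrowsTo X) BorelGroupoid.measurableEmbedding_mk
        BorelGroupoid.measurable_mul g
    have h1 := (M.equiv x).1.map hm
    have h2 := (M.equiv x).2.map hm
    rw [M.haar.invariant g] at h1 h2
    exact ⟨h1.trans (M.equiv y).2, (M.equiv y).1.trans h2⟩

/-! ### Amenability -/

/-- The class in `L^∞` of an essentially bounded measurable function. -/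
def linfClass {Y : Type u} [MeasurableSpace Y] (m : Measure Y) (f : Y → ℝ) : Lp ℝ ∞ m :=
  open Classical in if h : MemLp f ∞ m then h.toLp f else 0

/-- Existence of an invariant measurable system of means on a groupoid with unit space `(Y, μ)` and
measures `ν^y` on the fibres of the target map: means `m^y : L^∞(G^y, ν^y) → ℝ` such that
`y ↦ m^y(φ^y)` is `μ`-measurable for every `φ ∈ L^∞(G)`, where `φ^y` is the restriction of `φ` to
`G^y`, and such that `m^{t(g)} = g m^{s(g)}` for almost every `g`. -/
def HasInvariantMeans {Y : Type u} [MeasurableSpace Y] [Groupoid.{u} Y]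
    [∀ y, MeasurableSpace (ArrowsTo Y y)] [MeasurableSpace (Arrows Y)]
    (μ : Measure Y) (ν : ∀ y : Y, Measure (ArrowsTo Y y)) : Prop :=
  ∃ m : ∀ y : Y, Lp ℝ ∞ (ν y) →L[ℝ] ℝ,
    (∀ y, ‖m y‖ = 1 ∧ m y (linfClass (ν y) fun _ => 1) = 1) ∧
    (∀ φ : Arrows Y → ℝ, Measurable φ → (∃ C, ∀ a, |φ a| ≤ C) →
      AEMeasurable (fun y => m y (linfClass (ν y) fun h => φ (Total.mk y h))) μ) ∧
    ∀ᵐ a ∂(integrate μ ν), ∀ f : ArrowsTo Y a.1 → ℝ, Measurable f → (∃ C, ∀ h, |f h| ≤ C) →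
      m a.1 (linfClass (ν a.1) f) =
        m a.2.1 (linfClass (ν a.2.1) fun h => f (leftMul a.2.2 h))

/-- The unit space of the semidirect groupoid `S ⋊ G`. -/
def GSpace.Semidirect (S : GSpace X) : Type u := Total S.fiber

namespace GSpace

variable (S : GSpace X)

instance : MeasurableSpace S.Semidirect := inferInstanceAs (MeasurableSpace (Total S.fiber))

/-- The semidirect groupoid `S ⋊ G` over `S`: an arrow from `s'` to `s` is an arrow `g` of `G` with
`g s' = s`, that is, a pair `(s, g) ∈ S * G` with target `s` and source `g⁻¹ s`. -/
instance : Groupoid.{u} S.Semidirect where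
  Hom a b := {g : a.1 ⟶ b.1 // S.act g a.2 = b.2}
  id a := ⟨𝟙 a.1, S.act_id _ _⟩
  comp f g := ⟨f.1 ≫ g.1, by rw [S.act_comp, f.2, g.2]⟩
  inv {a b} f := ⟨Groupoid.inv f.1, by
    refine (congrArg (S.act (Groupoid.inv f.1)) f.2).symm.trans ?_
    rw [← S.act_comp, Groupoid.comp_inv, S.act_id]⟩
  id_comp f := Subtype.ext (Category.id_comp _)
  comp_id f := Subtype.ext (Category.comp_id _)
  assoc f g h := Subtype.ext (Category.assoc _ _ _)
  inv_comp f := Subtype.ext (Groupoid.inv_comp _)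
  comp_inv f := Subtype.ext (Groupoid.comp_inv _)

/-- The fibre of `S ⋊ G` over `s` is identified with `G^{t_S(s)}` by `(s, g) ↦ g`. -/
instance (e : S.Semidirect) : MeasurableSpace (ArrowsTo S.Semidirect e) :=
  MeasurableSpace.comap (fun h => (⟨h.1.1, h.2.1⟩ : ArrowsTo X e.1)) (BorelGroupoid.measTo e.1)

/-- The set of arrows of `S ⋊ G` is the subset `S * G` of `S × G`. -/
instance : MeasurableSpace (Arrows S.Semidirect) :=
  MeasurableSpace.comap
    (fun a => ((a.1, arrow a.2.2.1) : S.Semidirect × Arrows X)) inferInstance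

/-- The measure `ν^s := ν^{t_S(s)}` on the fibre `{(s, g) | t(g) = t_S(s)}` of `S ⋊ G` over `s`. -/
def semidirectMeasure (M : MeasuredGroupoid X μ) (e : S.Semidirect) :
    Measure (ArrowsTo S.Semidirect e) :=
  (M.ν e.1).map fun h =>
    (⟨⟨h.1, S.act (Groupoid.inv h.2) e.2⟩, ⟨h.2, by
      rw [← S.act_comp, Groupoid.inv_comp, S.act_id]⟩⟩ : ArrowsTo S.Semidirect e)

/-- A `G`-space `(S, τ)` is amenable if the groupoid `S ⋊ G` is amenable. -/
def IsAmenable (M : MeasuredGroupoid X μ) : Prop :=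
  HasInvariantMeans (Y := S.Semidirect) (integrate (S := S.fiber) μ S.τ) (S.semidirectMeasure M)

/-- The measure `(τ^x)^{n+1}` on the fibre `(S^x)^{n+1}` of `S^{(n+1)}`. -/
abbrev powMeasure (n : ℕ) (x : X) : Measure (Fin (n + 1) → S.fiber x) :=
  Measure.pi fun _ => S.τ x

/-- The fibred power `S^{(n+1)}`. -/
def Pow (n : ℕ) : Type u := Total fun x => (Fin (n + 1) → S.fiber x)

/-- The `σ`-algebra induced by the product of `n + 1` copies of `S`. -/
instance (n : ℕ) : MeasurableSpace (S.Pow n) :=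
  MeasurableSpace.comap (fun p i => (Total.mk p.1 (p.2 i) : Total S.fiber)) inferInstance

/-- The measure `∫ (τ^x)^{n+1} dμ(x)` on `S^{(n+1)}`. -/
def totalPowMeasure (μ : Measure X) (n : ℕ) : Measure (S.Pow n) :=
  μ.bind fun x => (S.powMeasure n x).map (Total.mk x)

/-- The diagonal action on the fibres of `S^{(n+1)}`. -/
def actPow (n : ℕ) {x y : X} (g : x ⟶ y) (s : Fin (n + 1) → S.fiber x) (i : Fin (n + 1)) :
    S.fiber y :=
  S.act g (s i)

end GSpace

theorem quasiMeasurePreserving_pi {Y Z : Type u} [MeasurableSpace Y] [MeasurableSpace Z]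
    (m : Measure Y) (m' : Measure Z) [IsProbabilityMeasure m] [IsProbabilityMeasure m']
    {T : Y → Z} (hT : Measure.QuasiMeasurePreserving T m m') (n : ℕ) :
    Measure.QuasiMeasurePreserving (fun (s : Fin n → Y) i => T (s i))
      (Measure.pi fun _ => m) (Measure.pi fun _ => m') := by
  induction n with
  | zero =>
    refine ⟨measurable_pi_lambda _ fun i => i.elim0, ?_⟩
    intro A hA
    rw [Measure.map_apply (measurable_pi_lambda _ fun i => i.elim0)
      (Subsingleton.measurableSet)]
    have : A = ∅ := by
      rw [Measure.pi_of_empty] at hA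
      by_contra hne
      obtain ⟨a, ha⟩ := Set.nonempty_iff_ne_empty.2 hne
      rw [Measure.dirac_apply' _ Subsingleton.measurableSet,
        Set.indicator_of_mem (by convert ha)] at hA
      exact one_ne_zero hA
    simp [this]
  | succ n ih =>
    have e1 := (measurePreserving_piFinSuccAbove (fun _ : Fin (n + 1) => m) 0)
    have e2 := (measurePreserving_piFinSuccAbove (fun _ : Fin (n + 1) => m') 0).symm
    have h := e2.quasiMeasurePreserving.comp ((QuasiMeasurePreserving.prodMap hT ih).comp e1.quasiMeasurePreserving)
    convert h using 1
    funext s i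
    refine Fin.cases ?_ (fun j => ?_) i <;> simp [MeasurableEquiv.piFinSuccAbove, Fin.tail]

theorem GSpace.quasiMeasurePreserving_actPow (S : GSpace X) (n : ℕ) {x y : X} (g : x ⟶ y) :
    Measure.QuasiMeasurePreserving (S.actPow n g) (S.powMeasure n x) (S.powMeasure n y) :=
  quasiMeasurePreserving_pi _ _ (S.quasiMeasurePreserving_act g) (n + 1)

/-- Omitting the `i`-th of `n + 2` points. -/
def GSpace.face (S : GSpace X) (n : ℕ) (i : Fin (n + 2)) {x : X}
    (s : Fin (n + 2) → S.fiber x) (j : Fin (n + 1)) : S.fiber x :=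
  s (i.succAbove j)

theorem GSpace.quasiMeasurePreserving_face (S : GSpace X) (n : ℕ) (i : Fin (n + 2)) (x : X) :
    Measure.QuasiMeasurePreserving (S.face n i) (S.powMeasure (n + 1) x) (S.powMeasure n x) :=
  Measure.quasiMeasurePreserving_snd.comp
    (measurePreserving_piFinSuccAbove (fun _ : Fin (n + 2) => S.τ x) i).quasiMeasurePreserving

end Groupoid

/-! ### Measurable bundles of Banach spaces -/

/-- The vector fields obtained from a set `Q` of vector fields by sums, products with `m`-measurable
functions and `m`-almost everywhere limits of sequences: the measurable structure generated by `Q`.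
-/
inductive Generated (𝕜 : Type) [RCLike 𝕜] {Y : Type u} [MeasurableSpace Y] (m : Measure Y)
    {E : Y → Type u} [∀ y, NormedAddCommGroup (E y)] [∀ y, NormedSpace 𝕜 (E y)]
    (Q : Set (∀ y, E y)) : (∀ y, E y) → Prop
  | of (ξ : ∀ y, E y) (h : ξ ∈ Q) : Generated 𝕜 m Q ξ
  | add (ξ ζ : ∀ y, E y) (hξ : Generated 𝕜 m Q ξ) (hζ : Generated 𝕜 m Q ζ) :
      Generated 𝕜 m Q (fun y => ξ y + ζ y)
  | smul (φ : Y → 𝕜) (hφ : AEStronglyMeasurable φ m) (ξ : ∀ y, E y) (hξ : Generated 𝕜 m Q ξ) :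
      Generated 𝕜 m Q (fun y => φ y • ξ y)
  | lim (ξ : ℕ → ∀ y, E y) (ζ : ∀ y, E y) (hξ : ∀ n, Generated 𝕜 m Q (ξ n))
      (h : ∀ᵐ y ∂m, Tendsto (fun n => ξ n y) atTop (𝓝 (ζ y))) : Generated 𝕜 m Q ζ

/-- A linear space `M` of vector fields is a measurable structure for the family `E` of Banach
spaces over `(X, μ)`. -/
structure IsMeasurableStructure {𝕜 : Type} [RCLike 𝕜] {X : Type u} [MeasurableSpace X]
    (μ : Measure X) {E : X → Type u} [∀ x, NormedAddCommGroup (E x)] [∀ x, NormedSpace 𝕜 (E x)]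
    (M : Submodule 𝕜 (∀ x, E x)) : Prop where
  smul_mem : ∀ φ : X → 𝕜, AEStronglyMeasurable φ μ → ∀ σ ∈ M, (fun x => φ x • σ x) ∈ M
  norm_measurable : ∀ σ ∈ M, AEMeasurable (fun x => ‖σ x‖) μ
  lim_mem : ∀ (σ : ℕ → ∀ x, E x) (ζ : ∀ x, E x), (∀ n, σ n ∈ M) →
    (∀ᵐ x ∂μ, Tendsto (fun n => σ n x) atTop (𝓝 (ζ x))) → ζ ∈ M

/-- The data of a `G`-bundle over `X`: normed spaces `E_x`, a linear space of vector fields (those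
called measurable), and an isometric left action of the groupoid. -/
structure GField (𝕜 : Type) [RCLike 𝕜] (X : Type u) [Groupoid.{u} X] where
  fiber : X → Type u
  [normedGroup : ∀ x, NormedAddCommGroup (fiber x)]
  [normedSpace : ∀ x, NormedSpace 𝕜 (fiber x)]
  sections : Submodule 𝕜 (∀ x, fiber x)
  act : ∀ {x y : X}, (x ⟶ y) → fiber x →ₗᵢ[𝕜] fiber y
  act_id : ∀ (x : X) (v : fiber x), act (𝟙 x) v = v
  act_comp : ∀ {x y z : X} (h : x ⟶ y) (g : y ⟶ z) (v : fiber x), act (h ≫ g) v = act g (act h v)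

attribute [instance] GField.normedGroup GField.normedSpace

section Cohomology

variable {𝕜 : Type} [RCLike 𝕜] {X : Type u} [MeasurableSpace X] [BorelGroupoid X] {μ : Measure X}

variable (𝕜) in
/-- A separable measurable `G`-bundle of Banach spaces over `(X, μ)`. -/
structure SeparableGBundle (M : MeasuredGroupoid X μ) extends GField 𝕜 X where
  complete : ∀ x, CompleteSpace (fiber x)
  isMeasurableStructure : IsMeasurableStructure μ sections
  /-- For a measurable section `σ`, `g ↦ g σ(s(g))` is a measurable section of the pullback of the
  bundle by the target map. -/
  act_measurable : ∀ σ ∈ sections,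
    Generated 𝕜 M.arrowMeasure (E := fun a : Arrows X => fiber a.1)
      {ξ | ∃ σ' ∈ sections, ξ = fun a : Arrows X => σ' a.1} (fun a => act a.2.2 (σ a.2.1))
  separable : ∃ σ : ℕ → ∀ x, fiber x, (∀ n, σ n ∈ sections) ∧
    ∀ᵐ x ∂μ, DenseRange fun n => σ n x

theorem GField.act_inv_act (E : GField 𝕜 X) {x y : X} (g : x ⟶ y) (v : E.fiber x) :
    E.act (Groupoid.inv g) (E.act g v) = v := by
  rw [← E.act_comp, Groupoid.comp_inv, E.act_id]

theorem GField.act_act_inv (E : GField 𝕜 X) {x y : X} (g : x ⟶ y) (v : E.fiber y) :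
    E.act g (E.act (Groupoid.inv g) v) = v := by
  rw [← E.act_comp, Groupoid.inv_comp, E.act_id]

theorem inv_comp_rev {Y : Type u} [Groupoid.{u} Y] {x y z : Y} (h : x ⟶ y) (g : y ⟶ z) :
    Groupoid.inv (h ≫ g) = Groupoid.inv g ≫ Groupoid.inv h := by
  simp

theorem inv_unit {Y : Type u} [Groupoid.{u} Y] (x : Y) : Groupoid.inv (𝟙 x) = 𝟙 x := by
  simp

/-- The action of an arrow, as a bounded operator. -/
def GField.actL (E : GField 𝕜 X) {x y : X} (g : x ⟶ y) : E.fiber x →L[𝕜] E.fiber y :=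
  (E.act g).toContinuousLinearMap

theorem GField.norm_actL_le (E : GField 𝕜 X) {x y : X} (g : x ⟶ y) : ‖E.actL g‖ ≤ 1 :=
  (E.act g).norm_toContinuousLinearMap_le

/-- The dual bundle `x ↦ F_x*`, with the action `⟨g θ, v⟩ = ⟨θ, g⁻¹ v⟩`; its measurable sections are
the vector fields `η` such that `x ↦ ⟨η(x), σ(x)⟩` is `μ`-measurable for all measurable sections
`σ` of the bundle `F`. -/
def GField.dual (μ : Measure X) (F : GField 𝕜 X) : GField 𝕜 X where
  fiber x := StrongDual 𝕜 (F.fiber x)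
  sections :=
    { carrier := {η | ∀ σ ∈ F.sections, AEStronglyMeasurable (fun x => η x (σ x)) μ}
      zero_mem' := fun σ _ => by simpa using aestronglyMeasurable_const
      add_mem' := fun h1 h2 σ hσ => (h1 σ hσ).add (h2 σ hσ)
      smul_mem' := fun c _ h σ hσ => (h σ hσ).const_smul c }
  act {x y} g :=
    { toFun := fun θ => θ.comp (F.actL (Groupoid.inv g))
      map_add' := fun _ _ => ContinuousLinearMap.add_comp _ _ _
      map_smul' := fun _ _ => ContinuousLinearMap.smul_comp _ _ _
      norm_map' := by
        have key : ∀ {x y : X} (g : x ⟶ y) (θ : StrongDual 𝕜 (F.fiber x)),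
            ‖θ.comp (F.actL (Groupoid.inv g))‖ ≤ ‖θ‖ := fun g θ =>
          (ContinuousLinearMap.opNorm_comp_le _ _).trans
            (mul_le_of_le_one_right (norm_nonneg θ) (F.norm_actL_le _))
        intro θ
        refine le_antisymm (key g θ) ?_
        have h := key (Groupoid.inv g) (θ.comp (F.actL (Groupoid.inv g)))
        refine le_trans (le_of_eq (congrArg norm ?_)) h
        ext v
        refine congrArg θ ?_
        change v = F.act (Groupoid.inv g) (F.act (Groupoid.inv (Groupoid.inv g)) v)
        rw [F.act_act_inv] }
  act_id x θ := by
    ext v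
    change θ (F.act (Groupoid.inv (𝟙 x)) v) = θ v
    rw [inv_unit, F.act_id]
  act_comp h g θ := by
    ext v
    change θ (F.act (Groupoid.inv (h ≫ g)) v) =
      θ (F.act (Groupoid.inv h) (F.act (Groupoid.inv g) v))
    rw [inv_comp_rev, F.act_comp]

/-! ### The bundles `L(S^{(n+1)}, E)`, where `E` is the dual of `F` -/

/-- The measurable sections of the pullback of `F` to `S^{(n+1)}`. -/
def IsPullbackSection (μ : Measure X) (S : GSpace X) (F : GField 𝕜 X) (n : ℕ)
    (η : ∀ p : S.Pow n, F.fiber p.1) : Prop :=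
  Generated 𝕜 (S.totalPowMeasure μ n) (E := fun p : S.Pow n => F.fiber p.1)
    {ξ | ∃ σ ∈ F.sections, ξ = fun p : S.Pow n => σ p.1} η

/-- The vector field `x ↦ η^x ∈ L^1((S^x)^{n+1}, F_x)`, where `η^x` is the restriction of `η` to the
fibre over `x` (with value `0` at the points `x` for which `η^x` is not integrable). -/
def lpField (S : GSpace X) (F : GField 𝕜 X) (n : ℕ) (η : ∀ p : S.Pow n, F.fiber p.1) (x : X) :
    Lp (F.fiber x) 1 (S.powMeasure n x) :=
  open Classical in
  if h : MemLp (fun s => η ⟨x, s⟩ : (Fin (n + 1) → S.fiber x) → F.fiber x) 1 (S.powMeasure n x)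
  then h.toLp _ else 0

/-- The measurable sections of the bundle `x ↦ L^1((S^x)^{n+1}, F_x)`: the measurable structure
generated by the measurable sections `η` over `S^{(n+1)}` with `η^x` integrable for almost every
`x`. -/
def IsL1Section (μ : Measure X) (S : GSpace X) (F : GField 𝕜 X) (n : ℕ)
    (ζ : ∀ x, Lp (F.fiber x) 1 (S.powMeasure n x)) : Prop :=
  Generated 𝕜 μ
    {ξ | ∃ η : ∀ p : S.Pow n, F.fiber p.1, IsPullbackSection μ S F n η ∧
      (∀ᵐ x ∂μ, MemLp (fun s => η ⟨x, s⟩ : (Fin (n + 1) → S.fiber x) → F.fiber x) 1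
        (S.powMeasure n x)) ∧
      ξ = lpField S F n η} ζ

/-- The operator `λ ↦ L(g) ∘ λ ∘ g⁻¹` from `L^∞_{w*}((S^{s(g)})^{n+1}, F_{s(g)}*)` to
`L^∞_{w*}((S^{t(g)})^{n+1}, F_{t(g)}*)`, where `L` is the dual action. -/
def actWLinf (S : GSpace X) (F : GField 𝕜 X) (n : ℕ) {x y : X} (g : x ⟶ y) :
    WLinf 𝕜 (S.powMeasure n x) (F.fiber x) →L[𝕜] WLinf 𝕜 (S.powMeasure n y) (F.fiber y) :=
  WLinf.pull (S.actPow n (Groupoid.inv g)) (S.quasiMeasurePreserving_actPow n (Groupoid.inv g))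
    (F.actL (Groupoid.inv g))

theorem actWLinf_id (S : GSpace X) (F : GField 𝕜 X) (n : ℕ) (x : X)
    (q : WLinf 𝕜 (S.powMeasure n x) (F.fiber x)) : actWLinf S F n (𝟙 x) q = q := by
  refine (WLinf.pull_congr _ (Measure.QuasiMeasurePreserving.id _) ?_ ?_ q).trans
    (WLinf.pull_id q)
  · funext s i
    change S.act (Groupoid.inv (𝟙 x)) (s i) = s i
    rw [inv_unit, S.act_id]
  · ext v
    change F.act (Groupoid.inv (𝟙 x)) v = v
    rw [inv_unit, F.act_id]

theorem actWLinf_comp (S : GSpace X) (F : GField 𝕜 X) (n : ℕ) {x y z : X} (h : x ⟶ y)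
    (g : y ⟶ z) (q : WLinf 𝕜 (S.powMeasure n x) (F.fiber x)) :
    actWLinf S F n (h ≫ g) q = actWLinf S F n g (actWLinf S F n h q) := by
  refine Eq.trans ?_ (WLinf.pull_pull _ _ _ _ _ _ q).symm
  refine WLinf.pull_congr _ _ ?_ ?_ q
  · funext s i
    change S.act (Groupoid.inv (h ≫ g)) (s i) =
      S.act (Groupoid.inv h) (S.act (Groupoid.inv g) (s i))
    rw [inv_comp_rev, S.act_comp]
  · ext v
    change F.act (Groupoid.inv (h ≫ g)) v = F.act (Groupoid.inv h) (F.act (Groupoid.inv g) v)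
    rw [inv_comp_rev, F.act_comp]

theorem norm_actWLinf_le (S : GSpace X) (F : GField 𝕜 X) (n : ℕ) {x y : X} (g : x ⟶ y)
    (q : WLinf 𝕜 (S.powMeasure n x) (F.fiber x)) : ‖actWLinf S F n g q‖ ≤ ‖q‖ :=
  (WLinf.norm_pull_le _ _ _ q).trans
    (mul_le_of_le_one_left (norm_nonneg q) (F.norm_actL_le _))

/-- The `G`-bundle `L(S^{(n+1)}, E)`, for `E` the dual of `F`: its fibres are the spaces
`L^∞_{w*}((S^x)^{n+1}, E_x)`, its measurable structure is dual to that of the bundle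
`x ↦ L^1((S^x)^{n+1}, F_x)`, and `(g λ)(s_0, …, s_n) = L(g) λ(g⁻¹ s_0, …, g⁻¹ s_n)`. -/
def LField (μ : Measure X) (S : GSpace X) (F : GField 𝕜 X) (n : ℕ) : GField 𝕜 X where
  fiber x := WLinf 𝕜 (S.powMeasure n x) (F.fiber x)
  sections :=
    { carrier := {ξ | ∀ ζ, IsL1Section μ S F n ζ →
        AEStronglyMeasurable (fun x => (ξ x).pair (ζ x)) μ}
      zero_mem' := fun ζ _ => by
        simpa [WLinf.pair_zero] using aestronglyMeasurable_const
      add_mem' := fun {a b} h1 h2 ζ hζ =>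
        ((h1 ζ hζ).add (h2 ζ hζ)).congr
          (ae_of_all _ fun x => (WLinf.pair_add (a x) (b x) (ζ x)).symm)
      smul_mem' := fun c a h ζ hζ =>
        ((h ζ hζ).const_smul c).congr
          (ae_of_all _ fun x => (WLinf.pair_smul c (a x) (ζ x)).symm) }
  act {x y} g :=
    { toLinearMap := (actWLinf S F n g).toLinearMap
      norm_map' := fun q => by
        refine le_antisymm (norm_actWLinf_le S F n g q) ?_
        have h := norm_actWLinf_le S F n (Groupoid.inv g) (actWLinf S F n g q)
        rwa [← actWLinf_comp, Groupoid.comp_inv, actWLinf_id] at h }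
  act_id x q := actWLinf_id S F n x q
  act_comp h g q := actWLinf_comp S F n h g q

/-- The coboundary operator `d = ∑ᵢ (-1)ⁱ δᵢ` on the fibres over `x`, where
`(δᵢ f)(s_0, …, s_{n+1}) = f(s_0, …, ŝᵢ, …, s_{n+1})`. -/
def coboundary (S : GSpace X) (F : GField 𝕜 X) (n : ℕ) (x : X) :
    WLinf 𝕜 (S.powMeasure n x) (F.fiber x) →L[𝕜] WLinf 𝕜 (S.powMeasure (n + 1) x) (F.fiber x) :=
  ∑ i : Fin (n + 2), (-1 : 𝕜) ^ (i : ℕ) •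
    WLinf.pull (S.face n i) (S.quasiMeasurePreserving_face n i x)
      (ContinuousLinearMap.id 𝕜 (F.fiber x))

/-! ### Invariant essentially bounded sections, cohomology -/

/-- The vector fields that vanish almost everywhere. -/
def nullFields (μ : Measure X) (E : GField 𝕜 X) : Submodule 𝕜 (∀ x, E.fiber x) where
  carrier := {σ | ∀ᵐ x ∂μ, σ x = 0}
  zero_mem' := ae_of_all _ fun _ => rfl
  add_mem' := fun {a b} h1 h2 => by
    change ∀ᵐ x ∂μ, a x = 0 at h1
    change ∀ᵐ x ∂μ, b x = 0 at h2
    change ∀ᵐ x ∂μ, (a + b) x = 0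
    filter_upwards [h1, h2] with x ha hb
    rw [Pi.add_apply, ha, hb, add_zero]
  smul_mem' := fun c a h => by
    change ∀ᵐ x ∂μ, a x = 0 at h
    change ∀ᵐ x ∂μ, (c • a) x = 0
    filter_upwards [h] with x ha
    rw [Pi.smul_apply, ha, smul_zero]

/-- Vector fields modulo almost everywhere equality. -/
abbrev Fields (μ : Measure X) (E : GField 𝕜 X) : Type u := (∀ x, E.fiber x) ⧸ nullFields μ E

/-- The measurable, essentially bounded, almost `G`-invariant vector fields. -/
def invariantSections (M : MeasuredGroupoid X μ) (E : GField 𝕜 X) :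
    Submodule 𝕜 (∀ x, E.fiber x) where
  carrier := {σ | σ ∈ E.sections ∧ (∃ C : ℝ, ∀ᵐ x ∂μ, ‖σ x‖ ≤ C) ∧
    ∀ᵐ a ∂M.arrowMeasure, E.act a.2.2 (σ a.2.1) = σ a.1}
  zero_mem' := ⟨E.sections.zero_mem, ⟨0, ae_of_all _ fun _ => by simp⟩,
    ae_of_all _ fun _ => by simp⟩
  add_mem' := by
    rintro a b ⟨ha, ⟨C, hC⟩, ia⟩ ⟨hb, ⟨D, hD⟩, ib⟩
    refine ⟨E.sections.add_mem ha hb, ⟨C + D, ?_⟩, ?_⟩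
    · filter_upwards [hC, hD] with x h1 h2
      exact (norm_add_le _ _).trans (add_le_add h1 h2)
    · filter_upwards [ia, ib] with g h1 h2
      rw [Pi.add_apply, Pi.add_apply, map_add, h1, h2]
  smul_mem' := by
    rintro c a ⟨ha, ⟨C, hC⟩, ia⟩
    refine ⟨E.sections.smul_mem c ha, ⟨‖c‖ * C, ?_⟩, ?_⟩
    · filter_upwards [hC] with x h1
      exact (norm_smul_le _ _).trans (mul_le_mul_of_nonneg_left h1 (norm_nonneg c))
    · filter_upwards [ia] with g h1
      rw [Pi.smul_apply, Pi.smul_apply, map_smul, h1]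

/-- The space `L^∞(X, E)^G`. -/
def LinfInv (M : MeasuredGroupoid X μ) (E : GField 𝕜 X) : Submodule 𝕜 (Fields μ E) :=
  (invariantSections M E).map (nullFields μ E).mkQ

/-- The map induced on classes of vector fields by a family of operators. -/
def mapFields (μ : Measure X) {E E' : GField 𝕜 X} (φ : ∀ x, E.fiber x →L[𝕜] E'.fiber x) :
    Fields μ E →ₗ[𝕜] Fields μ E' :=
  Submodule.mapQ _ _
    { toFun := fun σ x => φ x (σ x)
      map_add' := fun _ _ => funext fun _ => map_add _ _ _
      map_smul' := fun _ _ => funext fun _ => map_smul _ _ _ }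
    (fun σ hσ => by
      refine Filter.Eventually.mono (f := ae μ) hσ fun x hx => ?_
      change φ x (σ x) = 0
      rw [hx, map_zero])

theorem mapFields_mk {E E' : GField 𝕜 X} (φ : ∀ x, E.fiber x →L[𝕜] E'.fiber x)
    (σ : ∀ x, E.fiber x) :
    mapFields μ φ ((nullFields μ E).mkQ σ) = (nullFields μ E').mkQ (fun x => φ x (σ x)) := rfl

theorem mk_eq_mk_iff {E : GField 𝕜 X} (σ σ' : ∀ x, E.fiber x) :
    (nullFields μ E).mkQ σ = (nullFields μ E).mkQ σ' ↔ ∀ᵐ x ∂μ, σ x = σ' x := by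
  rw [Submodule.mkQ_apply, Submodule.mkQ_apply, Submodule.Quotient.eq]
  constructor
  · intro h; exact Filter.Eventually.mono (f := ae μ) h fun x hx => sub_eq_zero.1 hx
  · intro h; exact Filter.Eventually.mono (f := ae μ) h fun x hx => sub_eq_zero.2 hx

variable (𝕜 X) in
/-- A sequence of `G`-bundles `E^0, E^1, …` with operators `d^k_x : E^k_x → E^{k+1}_x`. -/
structure GComplex where
  obj : ℕ → GField 𝕜 X
  d : ∀ (k : ℕ) (x : X), (obj k).fiber x →L[𝕜] (obj (k + 1)).fiber x

namespace GComplex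

variable (M : MeasuredGroupoid X μ) (A : GComplex 𝕜 X)

/-- The cocycles of the complex `L^∞(X, E^•)^G`. -/
def cocycles (k : ℕ) : Submodule 𝕜 (Fields μ (A.obj k)) :=
  LinfInv M (A.obj k) ⊓ LinearMap.ker (mapFields μ (A.d k))

/-- The coboundaries of the complex `L^∞(X, E^•)^G`: the elements of `L^∞(X, E^k)^G` which are
images under `d` of elements of `L^∞(X, E^{k-1})^G`. -/
def coboundaries : ∀ k : ℕ, Submodule 𝕜 (Fields μ (A.obj k))
  | 0 => ⊥
  | k + 1 => LinfInv M (A.obj (k + 1)) ⊓ (LinfInv M (A.obj k)).map (mapFields μ (A.d k))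

/-- The `k`-th cohomology of the complex `L^∞(X, E^•)^G`. -/
abbrev Cohomology (k : ℕ) : Type u :=
  A.cocycles M k ⧸ (A.coboundaries M k).submoduleOf (A.cocycles M k)

end GComplex

/-- A `G`-morphism of `G`-bundles. -/
structure GMorphism (M : MeasuredGroupoid X μ) (E E' : GField 𝕜 X) where
  toFun : ∀ x, E.fiber x →L[𝕜] E'.fiber x
  measurable : ∀ σ ∈ E.sections, (fun x => toFun x (σ x)) ∈ E'.sections
  bounded : ∃ C : ℝ, ∀ᵐ x ∂μ, ‖toFun x‖ ≤ C
  equivariant : ∀ᵐ a ∂M.arrowMeasure, ∀ v : E.fiber a.2.1,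
    toFun a.1 (E.act a.2.2 v) = E'.act a.2.2 (toFun a.2.1 v)

theorem GMorphism.map_LinfInv_le {M : MeasuredGroupoid X μ} {E E' : GField 𝕜 X}
    (φ : GMorphism M E E') : (LinfInv M E).map (mapFields μ φ.toFun) ≤ LinfInv M E' := by
  rintro _ ⟨_, ⟨σ, ⟨hσ, ⟨C, hC⟩, hi⟩, rfl⟩, rfl⟩
  obtain ⟨D, hD⟩ := φ.bounded
  refine ⟨fun x => φ.toFun x (σ x), ⟨φ.measurable σ hσ, ⟨D * C, ?_⟩, ?_⟩, rfl⟩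
  · filter_upwards [hC, hD] with x h1 h2
    exact ((φ.toFun x).le_opNorm _).trans
      (mul_le_mul h2 h1 (norm_nonneg _) ((norm_nonneg _).trans h2))
  · filter_upwards [hi, φ.equivariant] with a h1 h2
    rw [← h2, h1]

/-- A morphism of complexes of `G`-bundles. -/
structure GComplexHom (M : MeasuredGroupoid X μ) (A B : GComplex 𝕜 X) where
  hom : ∀ k, GMorphism M (A.obj k) (B.obj k)
  comm : ∀ k, ∀ᵐ x ∂μ, ∀ v : (A.obj k).fiber x,
    (hom (k + 1)).toFun x (A.d k x v) = B.d k x ((hom k).toFun x v)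

namespace GComplexHom

variable {M : MeasuredGroupoid X μ} {A B : GComplex 𝕜 X} (φ : GComplexHom M A B)

theorem mapFields_comm (k : ℕ) (c : Fields μ (A.obj k)) :
    mapFields μ ((φ.hom (k + 1)).toFun) (mapFields μ (A.d k) c) =
      mapFields μ (B.d k) (mapFields μ ((φ.hom k).toFun) c) := by
  obtain ⟨σ, rfl⟩ := (nullFields μ (A.obj k)).mkQ_surjective c
  rw [mapFields_mk, mapFields_mk, mapFields_mk, mapFields_mk, mk_eq_mk_iff]
  filter_upwards [φ.comm k] with x hx
  exact hx _

theorem map_cocycles (k : ℕ) (c : Fields μ (A.obj k)) (hc : c ∈ A.cocycles M k) :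
    mapFields μ ((φ.hom k).toFun) c ∈ B.cocycles M k := by
  refine ⟨(φ.hom k).map_LinfInv_le ⟨c, hc.1, rfl⟩, ?_⟩
  refine LinearMap.mem_ker.2 ?_
  rw [← φ.mapFields_comm, LinearMap.mem_ker.1 hc.2, map_zero]

theorem map_coboundaries (k : ℕ) (c : Fields μ (A.obj k)) (hc : c ∈ A.coboundaries M k) :
    mapFields μ ((φ.hom k).toFun) c ∈ B.coboundaries M k := by
  cases k with
  | zero =>
    have h0 : c = 0 := hc
    rw [h0, map_zero]
    exact Submodule.zero_mem _
  | succ k =>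
    obtain ⟨h1, b, hb, rfl⟩ := hc
    refine ⟨(φ.hom (k + 1)).map_LinfInv_le ⟨_, h1, rfl⟩, ?_⟩
    rw [φ.mapFields_comm]
    exact ⟨_, (φ.hom k).map_LinfInv_le ⟨b, hb, rfl⟩, rfl⟩

/-- The map induced in cohomology by a morphism of complexes of `G`-bundles. -/
def mapCohomology (k : ℕ) : A.Cohomology M k →ₗ[𝕜] B.Cohomology M k :=
  Submodule.mapQ _ _ ((mapFields μ ((φ.hom k).toFun)).restrict (φ.map_cocycles k))
    (fun c hc => φ.map_coboundaries k c.1 hc)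

end GComplexHom

/-- The complex of `G`-bundles `L(S^{(•+1)}, E)`, for `E` the dual of `F`. -/
def LComplex (μ : Measure X) (S : GSpace X) (F : GField 𝕜 X) : GComplex 𝕜 X where
  obj n := LField μ S F n
  d n x := coboundary S F n x

/-- `H^k(L^∞(X, L(S^{(•+1)}, E))^G)`, for `E` the dual of `F`. -/
abbrev CohomologyOf (M : MeasuredGroupoid X μ) (S : GSpace X) (F : GField 𝕜 X) (k : ℕ) : Type u :=
  (LComplex μ S F).Cohomology M k

/-- The bounded cohomology `H^k_mb(G, E)`, for `E` the dual of `F`. -/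
abbrev BoundedCohomology (M : MeasuredGroupoid X μ) (F : GField 𝕜 X) (k : ℕ) : Type u :=
  CohomologyOf M M.regular F k

/-- The augmentation `E → L(S, E)`, the inclusion of the constant functions. -/
def augmentation (μ : Measure X) (S : GSpace X) (F : GField 𝕜 X) (x : X) :
    (F.dual μ).fiber x →L[𝕜] ((LComplex μ S F).obj 0).fiber x :=
  WLinf.const (S.powMeasure 0 x)

/-- A morphism of complexes `L(S^{(•+1)}, E) → L(T^{(•+1)}, E)` extends the identity of `E`. -/
def ExtendsId {M : MeasuredGroupoid X μ} {S T : GSpace X} {F : GField 𝕜 X}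
    (φ : GComplexHom M (LComplex μ S F) (LComplex μ T F)) : Prop :=
  ∀ᵐ x ∂μ, ∀ v : (F.dual μ).fiber x,
    (φ.hom 0).toFun x (augmentation μ S F x v) = augmentation μ T F x v

/-! ### Functoriality in the coefficients -/

section Coefficients

variable {M : MeasuredGroupoid X μ} {F F' : GField 𝕜 X} (ψ : GMorphism M F F')

theorem isPullbackSection_map (S : GSpace X) (n : ℕ) (η : ∀ p : S.Pow n, F.fiber p.1)
    (h : IsPullbackSection μ S F n η) :
    IsPullbackSection μ S F' n (fun p => ψ.toFun p.1 (η p)) := by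
  induction h with
  | of ξ h =>
    obtain ⟨σ, hσ, rfl⟩ := h
    exact Generated.of _ ⟨_, ψ.measurable σ hσ, rfl⟩
  | add ξ ζ _ _ h1 h2 =>
    have h := Generated.add _ _ h1 h2
    simp only [← map_add] at h
    exact h
  | smul φ hφ ξ _ h1 =>
    have h := Generated.smul φ hφ _ h1
    simp only [← map_smul] at h
    exact h
  | lim ξ ζ _ hl h1 =>
    refine Generated.lim _ _ h1 ?_
    filter_upwards [hl] with p hp
    exact ((ψ.toFun p.1).continuous.tendsto _).comp hp

theorem isL1Section_map (S : GSpace X) (n : ℕ) (ζ : ∀ x, Lp (F.fiber x) 1 (S.powMeasure n x))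
    (h : IsL1Section μ S F n ζ) :
    IsL1Section μ S F' n (fun x => (ψ.toFun x).compLp (ζ x)) := by
  induction h with
  | of ξ h =>
    obtain ⟨η, hη, hm, rfl⟩ := h
    have hm' : ∀ᵐ x ∂μ, MemLp (fun s => ψ.toFun x (η ⟨x, s⟩) :
        (Fin (n + 1) → S.fiber x) → F'.fiber x) 1 (S.powMeasure n x) :=
      hm.mono fun x hx => (ψ.toFun x).comp_memLp' hx
    refine Generated.lim (fun _ => lpField S F' n (fun p => ψ.toFun p.1 (η p))) _
      (fun _ => Generated.of _ ⟨_, isPullbackSection_map ψ S n η hη, hm', rfl⟩) ?_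
    filter_upwards [hm, hm'] with x hx hx'
    have : lpField S F' n (fun p => ψ.toFun p.1 (η p)) x =
        (ψ.toFun x).compLp (lpField S F n η x) := by
      rw [lpField, dif_pos hx', lpField, dif_pos hx]
      apply Lp.ext
      filter_upwards [hx'.coeFn_toLp, hx.coeFn_toLp,
        (ψ.toFun x).coeFn_compLp (hx.toLp _)] with s h1 h2 h3
      rw [h1, h3, h2]
    rw [this]
    exact tendsto_const_nhds
  | add ξ ζ _ _ h1 h2 =>
    have h := Generated.add _ _ h1 h2
    have e : (fun x => (ψ.toFun x).compLp (ξ x) + (ψ.toFun x).compLp (ζ x)) =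
        fun x => (ψ.toFun x).compLp (ξ x + ζ x) := funext fun x =>
      (map_add ((ψ.toFun x).compLpL 1 (S.powMeasure n x)) (ξ x) (ζ x)).symm
    rwa [e] at h
  | smul φ hφ ξ _ h1 =>
    have h := Generated.smul φ hφ _ h1
    have e : (fun x => φ x • (ψ.toFun x).compLp (ξ x)) =
        fun x => (ψ.toFun x).compLp (φ x • ξ x) := funext fun x =>
      (map_smul ((ψ.toFun x).compLpL 1 (S.powMeasure n x)) (φ x) (ξ x)).symm
    rwa [e] at h
  | lim ξ ζ _ hl h1 =>
    refine Generated.lim _ _ h1 ?_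
    filter_upwards [hl] with x hx
    exact (((ψ.toFun x).compLpL 1 (S.powMeasure n x)).continuous.tendsto _).comp hx

theorem pair_pull_id {Y V W : Type u} [MeasurableSpace Y] {m : Measure Y}
    [NormedAddCommGroup V] [NormedSpace 𝕜 V] [NormedAddCommGroup W] [NormedSpace 𝕜 W]
    (θ : W →L[𝕜] V) (q : WLinf 𝕜 m V) (ζ : Lp W 1 m) :
    (WLinf.pull id (Measure.QuasiMeasurePreserving.id m) θ q).pair ζ = q.pair (θ.compLp ζ) := by
  obtain ⟨f, rfl⟩ := WLinf.mk_surjective m q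
  rw [WLinf.pull_mk, WLinf.pair_mk, WLinf.pair_mk]
  refine integral_congr_ae ?_
  filter_upwards [θ.coeFn_compLp ζ] with y hy
  rw [hy]
  rfl

/-- The operator `f ↦ ψ* ∘ f` from `L^∞_{w*}((S^x)^{n+1}, F'_x*)` to `L^∞_{w*}((S^x)^{n+1}, F_x*)`,
where `ψ* : F'_x* → F_x*` is the adjoint of `ψ`. -/
def coefficientOperator (S : GSpace X) (n : ℕ) (x : X) :
    WLinf 𝕜 (S.powMeasure n x) (F'.fiber x) →L[𝕜] WLinf 𝕜 (S.powMeasure n x) (F.fiber x) :=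
  WLinf.pull id (Measure.QuasiMeasurePreserving.id _) (ψ.toFun x)

theorem coefficientOperator_coboundary (S : GSpace X) (n : ℕ) (x : X)
    (q : WLinf 𝕜 (S.powMeasure n x) (F'.fiber x)) :
    coefficientOperator ψ S (n + 1) x (coboundary S F' n x q) =
      coboundary S F n x (coefficientOperator ψ S n x q) := by
  simp only [coboundary, sum_apply, smul_apply, map_sum,
    map_smul]
  refine Finset.sum_congr rfl fun i _ => congrArg _ ?_
  refine (WLinf.pull_pull _ _ _ _ _ _ q).trans (Eq.trans ?_ (WLinf.pull_pull _ _ _ _ _ _ q).symm)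
  exact WLinf.pull_congr _ _ rfl rfl q

theorem coefficientOperator_act (S : GSpace X) (n : ℕ) {x y : X} (g : x ⟶ y)
    (h : ∀ v : F.fiber y, ψ.toFun x (F.act (Groupoid.inv g) v) =
      F'.act (Groupoid.inv g) (ψ.toFun y v))
    (q : WLinf 𝕜 (S.powMeasure n x) (F'.fiber x)) :
    coefficientOperator ψ S n y (actWLinf S F' n g q) =
      actWLinf S F n g (coefficientOperator ψ S n x q) := by
  refine (WLinf.pull_pull _ _ _ _ _ _ q).trans (Eq.trans ?_ (WLinf.pull_pull _ _ _ _ _ _ q).symm)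
  refine WLinf.pull_congr _ _ rfl ?_ q
  ext v
  exact (h v).symm

/-- The morphism of complexes `L(S^{(•+1)}, E') → L(S^{(•+1)}, E)`, `f ↦ ψ* ∘ f`, for `E` and `E'`
the duals of `F` and `F'` and `ψ* : E' → E` the adjoint of a `G`-morphism `ψ : F → F'`. -/
def coefficientMap (S : GSpace X) : GComplexHom M (LComplex μ S F') (LComplex μ S F) where
  hom n :=
    { toFun := coefficientOperator ψ S n
      measurable := fun σ hσ ζ hζ =>
        (hσ _ (isL1Section_map ψ S n ζ hζ)).congr
          (ae_of_all _ fun x => (pair_pull_id (ψ.toFun x) (σ x) (ζ x)).symm)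
      bounded := by
        obtain ⟨C, hC⟩ := ψ.bounded
        refine ⟨C, hC.mono fun x hx => ?_⟩
        refine ContinuousLinearMap.opNorm_le_bound _ ((norm_nonneg _).trans hx) fun q => ?_
        exact (WLinf.norm_pull_le _ _ _ q).trans
          (mul_le_mul_of_nonneg_right hx (norm_nonneg q))
      equivariant := ψ.equivariant.mono fun a ha q => by
        refine coefficientOperator_act ψ S n a.2.2 (fun v => ?_) q
        have h := ha (F.act (Groupoid.inv a.2.2) v)
        rw [F.act_act_inv] at h
        rw [h, F'.act_inv_act] }
  comm n := ae_of_all _ fun x q => coefficientOperator_coboundary ψ S n x q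

end Coefficients

end Cohomology

end MBC

end

open MBC

/-!
The comparison goes through a double complex. Let `C^p(V)` be the space of bounded measurable
invariant families `f_x : (G^x)^p → V_x`, modulo null sets of `x`, and put `V_0 = E` and
`V_{q+1} = L(S^{q+1}, E)`. The spaces `D^{p,q} = C^p(V_q)`, with the homogeneous coboundaries in the
arrows and in the points of `S`, form a double complex (`cochainDouble`). Its edge `p = 0`, `q ≥ 1` is
the complex of invariants that computes the cohomology of `S`, and its edge `q = 0` does not involve
`S` at all.

* The rows `p ≥ 1` are exact: an invariant cochain on `(G^x)^p` is determined by its values at tuples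
  that start with a unit, and there the first variable in `S` can be integrated against the measure
  `τ` (`exists_cochain_tupleCoboundary`).
* The columns `q ≥ 1` are exact: amenability of `S` provides invariant means in an additional first
  arrow, and the contraction is the weak-* mean over that arrow, depending on the first point of the
  tuple in `S` (`exists_cochain_cochainD`). For a mean that is not countably additive the existence
  of a weak-* mean, as a class of functions in all points of the tuple, is the delicate point: for fixed
  first point and vector the means of integrals over sets have a density, martingale convergence
  makes these densities jointly measurable (`exists_joint_version`), and a dense sequence of vectors
  suffices to assemble them (`exists_isMean`).

For `S = G` the means are evaluations (`regularMeans`), so the same holds for the complex that defines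
bounded cohomology. A morphism `L(S^{(•+1)}, E) → L(G^{(•+1)}, E)` that extends the identity of `E`
induces a morphism of double complexes (`doubleHom`) which is the identity on the common edge
`q = 0`. Exactness joins every cocycle of the edge `p = 0` to a cocycle of the edge `q = 0` by a
zigzag, so such a morphism is an isomorphism in cohomology, and this isomorphism does not depend on
the morphism (`mapCohomology_bijective`, `mapCohomology_eq`).

One such morphism is `f ↦ ((g_0, …, g_n) ↦ ∫ f d(g_0 τ × ⋯ × g_n τ))` (`translateHom`). It commutes
with coefficient maps on every fibre, which gives naturality.
-/

noncomputable section

namespace MBC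

/-! ### Zigzags in a double complex -/

section Zigzag

/-- A first-quadrant double complex of abelian groups with commuting differentials, whose rows
`p ≥ 1` are exact (also at the augmentation `q = 0`), and whose columns `q ≥ 1` are exact (also at
the augmentation `p = 0`). -/
structure ExactDouble (D : ℕ → ℕ → Type*) [∀ p q, AddCommGroup (D p q)] where
  dG : ∀ p q, D p q →+ D (p + 1) q
  dS : ∀ p q, D p q →+ D p (q + 1)
  dG_dG : ∀ p q x, dG (p + 1) q (dG p q x) = 0
  dS_dS : ∀ p q x, dS p (q + 1) (dS p q x) = 0
  comm : ∀ p q x, dG p (q + 1) (dS p q x) = dS (p + 1) q (dG p q x)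
  row : ∀ p q x, dS (p + 1) (q + 1) x = 0 → ∃ y, dS (p + 1) q y = x
  row_zero : ∀ p x, dS (p + 1) 0 x = 0 → x = 0
  col : ∀ p q x, dG (p + 1) (q + 1) x = 0 → ∃ y, dG p (q + 1) y = x
  col_zero : ∀ q x, dG 0 (q + 1) x = 0 → x = 0

namespace ExactDouble

variable {D : ℕ → ℕ → Type*} [∀ p q, AddCommGroup (D p q)] (E : ExactDouble D)

/-- The double complex with the two directions exchanged. -/
def transpose : ExactDouble fun p q => D q p where
  dG p q := E.dS q p
  dS p q := E.dG q p
  dG_dG p q := E.dS_dS q p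
  dS_dS p q := E.dG_dG q p
  comm p q x := (E.comm q p x).symm
  row p q := E.col q p
  row_zero := E.col_zero
  col p q := E.row q p
  col_zero := E.row_zero

/-- `a` and `b` are joined by a zigzag through the antidiagonal of total degree `n + 1`. -/
def Rel (n : ℕ) (a : D 0 (n + 1)) (b : D (n + 1) 0) : Prop :=
  ∃ z : ∀ p q, D p q, z 0 (n + 1) = a ∧ z (n + 1) 0 = b ∧
    ∀ p q, p + q = n → E.dG p (q + 1) (z p (q + 1)) = E.dS (p + 1) q (z (p + 1) q)

/-- `a` is a coboundary of the unaugmented edge complex `D^{0,1} → D^{0,2} → ⋯`. -/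
def IsCobS (n : ℕ) (a : D 0 (n + 1)) : Prop :=
  ∃ a' : D 0 n, (n = 0 → a' = 0) ∧ E.dS 0 n a' = a

/-- `b` is a coboundary of the unaugmented edge complex `D^{1,0} → D^{2,0} → ⋯`. -/
def IsCobG (n : ℕ) (b : D (n + 1) 0) : Prop :=
  ∃ b' : D n 0, (n = 0 → b' = 0) ∧ E.dG n 0 b' = b

theorem Rel.transpose {E : ExactDouble D} {n : ℕ} {a : D 0 (n + 1)} {b : D (n + 1) 0}
    (h : E.Rel n a b) : E.transpose.Rel n b a := by
  obtain ⟨z, h0, h1, h2⟩ := h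
  exact ⟨fun p q => z q p, h1, h0, fun p q hpq => (h2 q p (by omega)).symm⟩

theorem Rel.sub {E : ExactDouble D} {n : ℕ} {a a' : D 0 (n + 1)} {b b' : D (n + 1) 0}
    (h : E.Rel n a b) (h' : E.Rel n a' b') : E.Rel n (a - a') (b - b') := by
  obtain ⟨z, h0, h1, h2⟩ := h
  obtain ⟨z', h0', h1', h2'⟩ := h'
  refine ⟨fun p q => z p q - z' p q, by simp only [h0, h0'], by simp only [h1, h1'],
    fun p q hpq => ?_⟩
  rw [map_sub, map_sub, h2 p q hpq, h2' p q hpq]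

/-- Every cocycle of the edge `p = 0` is joined by a zigzag to a cocycle of the edge `q = 0`, by
exactness of the rows. -/
theorem exists_rel {n : ℕ} (a : D 0 (n + 1)) (ha : E.dS 0 (n + 1) a = 0) :
    ∃ b, E.dG (n + 1) 0 b = 0 ∧ E.Rel n a b := by
  classical
  have key : ∀ k ≤ n + 1, ∃ z : ∀ p q, D p q, z 0 (n + 1) = a ∧
      ∀ p q, p + q = n → p < k → E.dG p (q + 1) (z p (q + 1)) = E.dS (p + 1) q (z (p + 1) q) := by
    intro k
    induction k with
    | zero =>
      intro _
      exact ⟨Function.update 0 0 (Function.update 0 (n + 1) a), by simp, fun p q _ h => by omega⟩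
    | succ k ih =>
      intro hk
      obtain ⟨z, hz, h⟩ := ih (by omega)
      obtain ⟨q, hq⟩ : ∃ q, k + q = n := ⟨n - k, by omega⟩
      have hcl : E.dS (k + 1) (q + 1) (E.dG k (q + 1) (z k (q + 1))) = 0 := by
        rw [← E.comm]
        have : E.dG k (q + 1 + 1) (E.dS k (q + 1) (z k (q + 1))) = 0 := by
          cases k with
          | zero =>
            obtain rfl : q = n := by omega
            rw [hz, ha, map_zero]
          | succ k =>
            rw [← h k (q + 1) (by omega) (by omega), E.dG_dG]
        exact this
      obtain ⟨y, hy⟩ := E.row k q _ hcl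
      refine ⟨Function.update z (k + 1) (Function.update (z (k + 1)) q y), ?_, ?_⟩
      · rw [Function.update_of_ne (by omega), hz]
      · intro p q' hpq hp
        by_cases hpk : p = k
        · subst hpk
          obtain rfl : q' = q := by omega
          rw [Function.update_of_ne (by omega), Function.update_self, Function.update_self, hy]
        · rw [Function.update_of_ne (by omega)]
          rw [h p q' hpq (by omega)]
          rw [Function.update_of_ne (by omega)]
  obtain ⟨z, hz, h⟩ := key (n + 1) le_rfl
  refine ⟨z (n + 1) 0, ?_, z, hz, rfl, fun p q hpq => h p q hpq (by omega)⟩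
  apply E.row_zero (n + 1)
  rw [← E.comm, ← h n 0 (by omega) (by omega), E.dG_dG]

/-- A zigzag that starts at a coboundary ends at a coboundary. -/
theorem Rel.isCobG {E : ExactDouble D} {n : ℕ} {a : D 0 (n + 1)} {b : D (n + 1) 0}
    (h : E.Rel n a b) (ha : E.IsCobS n a) : E.IsCobG n b := by
  obtain ⟨z, hz, hb, h⟩ := h
  obtain ⟨a', ha0, ha'⟩ := ha
  have key : ∀ k q, k + q = n → ∃ w : D k q, (n = 0 → w = 0) ∧
      E.dG k (q + 1) (z k (q + 1) - E.dS k q w) = 0 := by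
    intro k
    induction k with
    | zero =>
      intro q hq
      obtain rfl : q = n := by omega
      exact ⟨a', ha0, by rw [hz, ha', sub_self, map_zero]⟩
    | succ k ih =>
      intro q hq
      obtain ⟨w, hw0, hw⟩ := ih (q + 1) (by omega)
      have h1 : E.dS (k + 1) (q + 1) (z (k + 1) (q + 1) - E.dG k (q + 1) w) = 0 := by
        rw [map_sub, ← h k (q + 1) (by omega), ← E.comm, ← map_sub, hw]
      obtain ⟨y, hy⟩ := E.row k q _ h1
      refine ⟨y, fun h => by omega, ?_⟩
      rw [hy, sub_sub_cancel, E.dG_dG]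
  obtain ⟨w, hw0, hw⟩ := key n 0 (by omega)
  refine ⟨w, hw0, ?_⟩
  have h1 : E.dS (n + 1) 0 (b - E.dG n 0 w) = 0 := by
    rw [map_sub, ← hb, ← h n 0 (by omega), ← E.comm, ← map_sub, hw]
  exact (sub_eq_zero.1 (E.row_zero n _ h1)).symm

theorem Rel.isCobS {E : ExactDouble D} {n : ℕ} {a : D 0 (n + 1)} {b : D (n + 1) 0}
    (h : E.Rel n a b) (hb : E.IsCobG n b) : E.IsCobS n a :=
  Rel.isCobG h.transpose hb

variable {D' : ℕ → ℕ → Type*} [∀ p q, AddCommGroup (D' p q)] (E' : ExactDouble D')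

/-- A morphism of double complexes. -/
structure Hom where
  f : ∀ p q, D p q →+ D' p q
  map_dG : ∀ p q x, f (p + 1) q (E.dG p q x) = E'.dG p q (f p q x)
  map_dS : ∀ p q x, f p (q + 1) (E.dS p q x) = E'.dS p q (f p q x)

variable {E E'}

theorem Rel.map (φ : Hom E E') {n : ℕ} {a : D 0 (n + 1)} {b : D (n + 1) 0}
    (h : E.Rel n a b) : E'.Rel n (φ.f _ _ a) (φ.f _ _ b) := by
  obtain ⟨z, h0, h1, h2⟩ := h
  refine ⟨fun p q => φ.f p q (z p q), by simp only [h0], by simp only [h1], fun p q hpq => ?_⟩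
  rw [← φ.map_dG, ← φ.map_dS, h2 p q hpq]

/-- A morphism which is bijective on the edge `q = 0` is injective on the cohomology of the edge
`p = 0`. -/
theorem Hom.isCobS_of_map (φ : Hom E E') (hinj : ∀ p, Function.Injective (φ.f p 0))
    (hsurj : ∀ p, Function.Surjective (φ.f p 0)) {n : ℕ} (a : D 0 (n + 1))
    (ha : E.dS 0 (n + 1) a = 0) (h : E'.IsCobS n (φ.f _ _ a)) : E.IsCobS n a := by
  obtain ⟨b, -, hab⟩ := E.exists_rel a ha
  obtain ⟨c', hc0, hc⟩ := (hab.map φ).isCobG h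
  obtain ⟨c, rfl⟩ := hsurj n c'
  refine hab.isCobS ⟨c, fun hn => hinj n ?_, hinj (n + 1) ?_⟩
  · rw [hc0 hn, map_zero]
  · rw [φ.map_dG, hc]

/-- A morphism which is bijective on the edge `q = 0` is surjective on the cohomology of the edge
`p = 0`. -/
theorem Hom.exists_map_sub_isCobS (φ : Hom E E') (hinj : ∀ p, Function.Injective (φ.f p 0))
    (hsurj : ∀ p, Function.Surjective (φ.f p 0)) {n : ℕ} (a' : D' 0 (n + 1))
    (ha' : E'.dS 0 (n + 1) a' = 0) :
    ∃ a, E.dS 0 (n + 1) a = 0 ∧ E'.IsCobS n (φ.f _ _ a - a') := by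
  obtain ⟨b', hb', hab'⟩ := E'.exists_rel a' ha'
  obtain ⟨b, rfl⟩ := hsurj (n + 1) b'
  have hb : E.dG (n + 1) 0 b = 0 := hinj _ (by rw [φ.map_dG, hb', map_zero])
  obtain ⟨a, ha, hba⟩ := E.transpose.exists_rel b hb
  refine ⟨a, ha, Rel.isCobS ((Rel.map φ hba.transpose).sub hab') ?_⟩
  exact ⟨0, fun _ => rfl, by rw [map_zero]; exact (sub_self _).symm⟩

/-- Two morphisms which agree on the edge `q = 0` agree on the cohomology of the edge `p = 0`. -/
theorem Hom.sub_isCobS (φ φ' : Hom E E') (h : ∀ p x, φ.f p 0 x = φ'.f p 0 x) {n : ℕ}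
    (a : D 0 (n + 1)) (ha : E.dS 0 (n + 1) a = 0) :
    E'.IsCobS n (φ.f _ _ a - φ'.f _ _ a) := by
  obtain ⟨b, -, hab⟩ := E.exists_rel a ha
  refine Rel.isCobS ((hab.map φ).sub (hab.map φ')) ⟨0, fun _ => rfl, ?_⟩
  rw [map_zero, h, sub_self]

end ExactDouble

end Zigzag

/-! ### Densities, and jointly measurable versions of measurable families of functions -/

section Densities

open MeasurableSpace ProbabilityTheory

variable {𝕜 : Type} [RCLike 𝕜]

theorem tendsto_average_partition_real {Y : Type*} [MeasurableSpace Y] [CountablyGenerated Y]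
    (m : Measure Y) [IsFiniteMeasure m] {u : Y → ℝ} (hu : Integrable u m) :
    ∀ᵐ y ∂m, Tendsto (fun n => (m.real (countablePartitionSet n y))⁻¹ •
      ∫ y' in countablePartitionSet n y, u y' ∂m) atTop (𝓝 (u y)) := by
  obtain ⟨u', hu', he⟩ := hu.1
  have hint : Integrable u' m := hu.congr he
  have h1 := hint.tendsto_ae_condExp (ℱ := countableFiltration Y)
    (by rw [iSup_countableFiltration]; exact hu')
  set f : ℕ → Set Y → ℝ := fun n A => (m.real A)⁻¹ • ∫ y' in A, u y' ∂m with hf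
  have h2 : ∀ n, (fun y => f n (countablePartitionSet n y)) =ᵐ[m]
      m[u' | countableFiltration Y n] := by
    intro n
    have hmeas : Measurable[countableFiltration Y n]
        (fun y => f n (countablePartitionSet n y)) :=
      @Measurable.comp _ _ _ (countableFiltration Y n) ⊤ _
        (fun A : countablePartition Y n => f n A.1) _ measurable_from_top
        (measurable_countablePartitionSet_subtype n ⊤)
    have hbd : ∃ C, ∀ y, ‖f n (countablePartitionSet n y)‖ ≤ C := by
      have := (Set.toFinite (Set.range fun A : countablePartition Y n => ‖f n A.1‖)).bddAbove
      obtain ⟨C, hC⟩ := this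
      exact ⟨C, fun y => hC ⟨⟨_, countablePartitionSet_mem n y⟩, rfl⟩⟩
    have hintf : Integrable (fun y => f n (countablePartitionSet n y)) m := by
      obtain ⟨C, hC⟩ := hbd
      exact Integrable.of_bound
        (hmeas.mono ((countableFiltration Y).le n) le_rfl).aestronglyMeasurable
        C (ae_of_all _ hC)
    refine ae_eq_condExp_of_forall_setIntegral_eq ((countableFiltration Y).le n) hint
      (fun s _ _ => hintf.integrableOn) ?_ hmeas.stronglyMeasurable.aestronglyMeasurable
    intro A hA _
    obtain ⟨S, hS, rfl⟩ := (measurableSet_generateFrom_countablePartition_iff _ _).mp hA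
    have hd : (S : Set (Set Y)).PairwiseDisjoint id := fun a ha b hb hab =>
      disjoint_countablePartition (hS ha) (hS hb) hab
    have hms : ∀ a ∈ S, MeasurableSet a := fun a ha => measurableSet_countablePartition n (hS ha)
    have e : (⋃₀ (S : Set (Set Y))) = ⋃ a ∈ S, a := by simp [Set.sUnion_eq_biUnion]
    rw [e, integral_biUnion_finset S hms hd fun a _ => hintf.integrableOn,
      integral_biUnion_finset S hms hd fun a _ => hint.integrableOn]
    refine Finset.sum_congr rfl fun a ha => ?_
    have e1 : ∫ y in a, f n (countablePartitionSet n y) ∂m = ∫ y in a, f n a ∂m :=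
      setIntegral_congr_fun (hms a ha) fun y hy => by
        simp only [countablePartitionSet_of_mem (hS ha) hy]
    have e2 : ∫ y in a, u' y ∂m = ∫ y in a, u y ∂m :=
      integral_congr_ae (ae_restrict_of_ae (he.mono fun y hy => hy.symm))
    rw [e1, e2, setIntegral_const, hf]
    by_cases h0 : m.real a = 0
    · have h0' : m a = 0 := (measureReal_eq_zero_iff).1 h0
      rw [h0, zero_smul, setIntegral_measure_zero _ h0']
    · simp only [smul_eq_mul]
      field_simp
  filter_upwards [h1, he, ae_all_iff.2 h2] with y h1 h2 h3
  rw [h2]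
  exact h1.congr fun n => (h3 n).symm

/-- Lévy's theorem for the averages over the cells of a refining sequence of finite partitions. -/
theorem tendsto_average_partition {Y : Type*} [MeasurableSpace Y] [CountablyGenerated Y]
    (m : Measure Y) [IsFiniteMeasure m] {u : Y → 𝕜} (hu : Integrable u m) :
    ∀ᵐ y ∂m, Tendsto (fun n => (m.real (countablePartitionSet n y))⁻¹ •
      ∫ y' in countablePartitionSet n y, u y' ∂m) atTop (𝓝 (u y)) := by
  filter_upwards [tendsto_average_partition_real m hu.re, tendsto_average_partition_real m hu.im]
    with y h1 h2
  have h := ((RCLike.continuous_ofReal (K := 𝕜)).tendsto _ |>.comp h1).add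
    (((RCLike.continuous_ofReal (K := 𝕜)).tendsto _ |>.comp h2).mul_const (RCLike.I : 𝕜))
  rw [RCLike.re_add_im] at h
  refine h.congr fun n => ?_
  have e := setIntegral_re_add_im (μ := m) (i := countablePartitionSet n y)
    (f := u) hu.integrableOn
  rw [← e]
  simp only [Function.comp, smul_eq_mul, RCLike.ofReal_mul, smul_add, RCLike.real_smul_eq_coe_mul]
  ring

/-- A family of integrable functions `u_z` on the fibres of a kernel `η` which is weakly measurable
in `z` has a jointly measurable version. -/
theorem exists_joint_version {Z Y : Type*} [MeasurableSpace Z] [MeasurableSpace Y]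
    [CountablyGenerated Y] {π : Measure Z} (η : Kernel Z Y) [IsFiniteKernel η] (u : Z → Y → 𝕜)
    (hint : ∀ᵐ z ∂π, Integrable (u z) (η z))
    (hmeas : ∀ A, MeasurableSet A → AEStronglyMeasurable (fun z => ∫ y in A, u z y ∂η z) π) :
    ∃ h : Z × Y → 𝕜, StronglyMeasurable h ∧ ∀ᵐ z ∂π, u z =ᵐ[η z] fun y => h (z, y) := by
  classical
  choose! k hk hke using hmeas
  set g : ℕ → Z × Y → 𝕜 := fun n p =>
    ∑ A ∈ (finite_countablePartition Y n).toFinset,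
      (Prod.snd ⁻¹' A : Set (Z × Y)).indicator (fun p => ((η p.1).real A)⁻¹ • k A p.1) p with hg
  have hgm : ∀ n, StronglyMeasurable (g n) := by
    intro n
    refine Finset.stronglyMeasurable_fun_sum _ fun A hA => ?_
    have hA' : MeasurableSet A :=
      measurableSet_countablePartition n ((finite_countablePartition Y n).mem_toFinset.1 hA)
    refine StronglyMeasurable.indicator ?_ (measurable_snd hA')
    refine StronglyMeasurable.smul ?_ ((hk A hA').comp_measurable measurable_fst)
    exact ((η.measurable_coe hA').ennreal_toReal.inv.stronglyMeasurable).comp_measurable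
      measurable_fst
  refine ⟨fun p => limUnder atTop (fun n => g n p), StronglyMeasurable.limUnder hgm, ?_⟩
  have hall : ∀ᵐ z ∂π, ∀ n, ∀ A : countablePartition Y n,
      ∫ y in A.1, u z y ∂η z = k A.1 z := by
    refine ae_all_iff.2 fun n => ae_all_iff.2 fun A => ?_
    exact hke A.1 (measurableSet_countablePartition n A.2)
  filter_upwards [hint, hall] with z h1 h2
  filter_upwards [tendsto_average_partition (η z) h1] with y hy
  refine (Tendsto.limUnder_eq (hy.congr fun n => ?_)).symm
  have hmem := countablePartitionSet_mem (α := Y) n y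
  rw [hg]
  simp only
  rw [Finset.sum_eq_single (countablePartitionSet n y)]
  · rw [Set.indicator_of_mem (by exact mem_countablePartitionSet n y), ← h2 n ⟨_, hmem⟩]
  · intro A hA hne
    refine Set.indicator_of_notMem (fun hy' => hne ?_) _
    exact (countablePartitionSet_of_mem ((finite_countablePartition Y n).mem_toFinset.1 hA)
        hy').symm
  · intro h
    exact absurd ((finite_countablePartition Y n).mem_toFinset.2 hmem) h

theorem exists_density_real {Y : Type*} [MeasurableSpace Y] (m : Measure Y) [IsFiniteMeasure m]
    (κ : Set Y → ℝ) (C : ℝ)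
    (hadd : ∀ A B, MeasurableSet A → MeasurableSet B → Disjoint A B → κ (A ∪ B) = κ A + κ B)
    (hb : ∀ A, MeasurableSet A → |κ A| ≤ C * m.real A) :
    ∃ u : Y → ℝ, Integrable u m ∧ ∀ A, MeasurableSet A → ∫ y in A, u y ∂m = κ A := by
  -- `κ + C m` is nonnegative, hence a measure absolutely continuous with respect to `m`
  set g : Set Y → ℝ := fun A => κ A + C * m.real A with hg
  have g0 : ∀ A, MeasurableSet A → 0 ≤ g A := fun A hA => by
    have := (abs_le.1 (hb A hA)).1; simp only [hg]; linarith
  have g1 : ∀ A, MeasurableSet A → g A ≤ 2 * C * m.real A := fun A hA => by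
    have := (abs_le.1 (hb A hA)).2; simp only [hg]; linarith
  have gadd : ∀ A B, MeasurableSet A → MeasurableSet B → Disjoint A B →
      g (A ∪ B) = g A + g B := fun A B hA hB h => by
    simp only [hg]; rw [hadd A B hA hB h, measureReal_union h hB]; ring
  have gempty : g ∅ = 0 := by
    have := gadd ∅ ∅ .empty .empty (Set.disjoint_empty _)
    rw [Set.empty_union] at this; linarith
  have gsum : ∀ f : ℕ → Set Y, (∀ i, MeasurableSet (f i)) → Pairwise (Function.onFun Disjoint f) →
      HasSum (fun i => g (f i)) (g (⋃ i, f i)) := by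
    intro f hf hd
    have hm : HasSum (fun i => m.real (f i)) (m.real (⋃ i, f i)) := by
      have := measure_iUnion (μ := m) hd hf
      have hne : ∑' i, m (f i) ≠ ∞ := by rw [← this]; exact measure_ne_top _ _
      rw [measureReal_def, this, ENNReal.tsum_toReal_eq fun i => measure_ne_top _ _]
      exact ENNReal.hasSum_toReal hne
    refine (hasSum_iff_tendsto_nat_of_nonneg (fun i => g0 _ (hf i)) _).2 ?_
    have part : ∀ n, MeasurableSet (⋃ i ∈ Finset.range n, f i) ∧
        g (⋃ i ∈ Finset.range n, f i) = ∑ i ∈ Finset.range n, g (f i) ∧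
        m.real (⋃ i ∈ Finset.range n, f i) = ∑ i ∈ Finset.range n, m.real (f i) := by
      intro n
      refine ⟨Finset.measurableSet_biUnion _ fun i _ => hf i, ?_,
        measureReal_biUnion_finset (fun i _ j _ hij => hd hij) fun i _ => hf i⟩
      induction n with
      | zero => simpa using gempty
      | succ n ih =>
        rw [Finset.sum_range_succ, ← ih, Finset.range_add_one, Finset.set_biUnion_insert,
          Set.union_comm]
        refine gadd _ _ (Finset.measurableSet_biUnion _ fun i _ => hf i) (hf n) ?_
        refine Set.disjoint_iUnion₂_left.2 fun i hi => hd ?_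
        exact (Finset.mem_range.1 hi).ne
    have bound : ∀ n, |g (⋃ i, f i) - ∑ i ∈ Finset.range n, g (f i)| ≤
        2 * C * (m.real (⋃ i, f i) - ∑ i ∈ Finset.range n, m.real (f i)) := by
      intro n
      obtain ⟨p1, p2, p3⟩ := part n
      have hsub : (⋃ i ∈ Finset.range n, f i) ⊆ ⋃ i, f i := Set.iUnion₂_subset_iUnion _ _
      have hU : MeasurableSet (⋃ i, f i) := MeasurableSet.iUnion hf
      have e := gadd _ _ p1 (hU.diff p1) Set.disjoint_sdiff_right
      rw [Set.union_sdiff_cancel hsub] at e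
      rw [← p2, ← p3, e, add_sub_cancel_left, abs_of_nonneg (g0 _ (hU.diff p1)),
        ← measureReal_sdiff hsub p1]
      exact g1 _ (hU.diff p1)
    have lim : Tendsto (fun n => 2 * C * (m.real (⋃ i, f i) -
        ∑ i ∈ Finset.range n, m.real (f i))) atTop (𝓝 0) := by
      have := (hm.tendsto_sum_nat.const_sub (m.real (⋃ i, f i))).const_mul (2 * C)
      simpa using this
    have := squeeze_zero_norm (fun n => (Real.norm_eq_abs _).trans_le (bound n)) lim
    simpa using this.const_sub (g (⋃ i, f i))
  set ρ : Measure Y := Measure.ofMeasurable (fun A _ => ENNReal.ofReal (g A)) (by simp [gempty])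
    (fun f hf hd => by
      have h := gsum f hf hd
      rw [← h.tsum_eq]
      exact ENNReal.ofReal_tsum_of_nonneg (fun i => g0 _ (hf i)) h.summable) with hρ
  have hρA : ∀ A, MeasurableSet A → ρ A = ENNReal.ofReal (g A) := fun A hA =>
    Measure.ofMeasurable_apply A hA
  have : IsFiniteMeasure ρ := ⟨by rw [hρA _ .univ]; exact ENNReal.ofReal_lt_top⟩
  have hac : ρ ≪ m := Measure.AbsolutelyContinuous.mk fun A hA h0 => by
    rw [hρA A hA, ENNReal.ofReal_eq_zero]
    have := g1 A hA
    rwa [measureReal_def, h0, ENNReal.toReal_zero, mul_zero] at this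
  refine ⟨fun y => (ρ.rnDeriv m y).toReal - C,
    Measure.integrable_toReal_rnDeriv.sub (integrable_const C), fun A hA => ?_⟩
  rw [integral_sub Measure.integrable_toReal_rnDeriv.integrableOn (integrable_const C).integrableOn,
    Measure.setIntegral_toReal_rnDeriv hac, setIntegral_const, measureReal_def, hρA A hA,
    ENNReal.toReal_ofReal (g0 A hA)]
  simp only [hg, smul_eq_mul]; ring

theorem ae_norm_le_of_setIntegral {Y : Type*} [MeasurableSpace Y] (m : Measure Y)
    [IsFiniteMeasure m] {u : Y → 𝕜} (hu : Integrable u m) (C : ℝ)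
    (hb : ∀ A, MeasurableSet A → ‖∫ y in A, u y ∂m‖ ≤ C * m.real A) :
    ∀ᵐ y ∂m, ‖u y‖ ≤ 2 * C := by
  have key : ∀ v : Y → ℝ, Integrable v m →
      (∀ A, MeasurableSet A → ∫ y in A, v y ∂m ≤ C * m.real A) → ∀ᵐ y ∂m, v y ≤ C := by
    intro v hv h
    refine ae_le_of_forall_setIntegral_le hv (integrable_const C) fun A hA _ => ?_
    rw [setIntegral_const, smul_eq_mul, mul_comm]
    exact h A hA
  have hre : ∀ A, |∫ y in A, RCLike.re (u y) ∂m| ≤ ‖∫ y in A, u y ∂m‖ := fun A => by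
    have e := integral_re (𝕜 := 𝕜) (hu.integrableOn (s := A))
    rw [e]; exact RCLike.abs_re_le_norm _
  have him : ∀ A, |∫ y in A, RCLike.im (u y) ∂m| ≤ ‖∫ y in A, u y ∂m‖ := fun A => by
    have e := integral_im (𝕜 := 𝕜) (hu.integrableOn (s := A))
    rw [e]; exact RCLike.abs_im_le_norm _
  have h1 := key _ hu.re fun A hA => (le_abs_self _).trans ((hre A).trans (hb A hA))
  have h2 := key _ hu.re.neg fun A hA => by
    simp only [Pi.neg_apply]
    rw [integral_neg]; exact (neg_le_abs _).trans ((hre A).trans (hb A hA))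
  have h3 := key _ hu.im fun A hA => (le_abs_self _).trans ((him A).trans (hb A hA))
  have h4 := key _ hu.im.neg fun A hA => by
    simp only [Pi.neg_apply]
    rw [integral_neg]; exact (neg_le_abs _).trans ((him A).trans (hb A hA))
  filter_upwards [h1, h2, h3, h4] with y h1 h2 h3 h4
  simp only [Pi.neg_apply] at h2 h4
  have a1 : |RCLike.re (u y)| ≤ C := abs_le.2 ⟨by linarith, h1⟩
  have a2 : |RCLike.im (u y)| ≤ C := abs_le.2 ⟨by linarith, h3⟩
  have a3 : ‖u y‖ ≤ |RCLike.re (u y)| + |RCLike.im (u y)| := by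
    conv_lhs => rw [← RCLike.re_add_im (u y)]
    refine (norm_add_le _ _).trans (add_le_add (RCLike.norm_ofReal _).le ?_)
    rw [norm_mul, RCLike.norm_ofReal]
    refine mul_le_of_le_one_right (abs_nonneg _) ?_
    by_cases h : (RCLike.I : 𝕜) = 0
    · rw [h, norm_zero]; exact zero_le_one
    · exact (RCLike.norm_I_of_ne_zero h).le
  linarith

/-- A finitely additive set function dominated by a finite measure has a density. -/
theorem exists_density {Y : Type*} [MeasurableSpace Y] (m : Measure Y) [IsFiniteMeasure m]
    (κ : Set Y → 𝕜) (C : ℝ)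
    (hadd : ∀ A B, MeasurableSet A → MeasurableSet B → Disjoint A B → κ (A ∪ B) = κ A + κ B)
    (hb : ∀ A, MeasurableSet A → ‖κ A‖ ≤ C * m.real A) :
    ∃ u : Y → 𝕜, Integrable u m ∧ ∀ A, MeasurableSet A → ∫ y in A, u y ∂m = κ A := by
  obtain ⟨u1, hi1, h1⟩ := exists_density_real m (fun A => RCLike.re (κ A)) C
    (fun A B hA hB h => by rw [hadd A B hA hB h, map_add])
    (fun A hA => (RCLike.abs_re_le_norm _).trans (hb A hA))
  obtain ⟨u2, hi2, h2⟩ := exists_density_real m (fun A => RCLike.im (κ A)) C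
    (fun A B hA hB h => by rw [hadd A B hA hB h, map_add])
    (fun A hA => (RCLike.abs_im_le_norm _).trans (hb A hA))
  refine ⟨fun y => (u1 y : 𝕜) + (u2 y : 𝕜) * RCLike.I, hi1.ofReal.add (hi2.ofReal.mul_const _),
    fun A hA => ?_⟩
  have i1 : IntegrableOn (fun y => (u1 y : 𝕜)) A m := hi1.ofReal.integrableOn
  have i2 : IntegrableOn (fun y => (u2 y : 𝕜) * RCLike.I) A m :=
    (hi2.ofReal.mul_const _).integrableOn
  change ∫ y in A, ((u1 y : 𝕜) + (u2 y : 𝕜) * RCLike.I) ∂m = κ A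
  rw [integral_add i1 i2, integral_mul_const, integral_ofReal, integral_ofReal, h1 A hA, h2 A hA,
      RCLike.re_add_im]

end Densities

/-! ### The duality between `L^∞_{w*}` and `L^1`, and weak-* integrals -/

section WeakStarTools

variable {𝕜 : Type} [RCLike 𝕜]
variable {Y : Type u} [MeasurableSpace Y] {V : Type u} [NormedAddCommGroup V] [NormedSpace 𝕜 V]

theorem WLinf.pair_add_right {m : Measure Y} (q : WLinf 𝕜 m V) (η ζ : Lp V 1 m) :
    q.pair (η + ζ) = q.pair η + q.pair ζ := by
  unfold WLinf.pair
  rw [← integral_add (q.rep.integrable_pair η) (q.rep.integrable_pair ζ)]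
  refine integral_congr_ae ?_
  filter_upwards [Lp.coeFn_add η ζ] with y hy
  rw [hy, Pi.add_apply, map_add]

theorem WLinf.pair_smul_right {m : Measure Y} (q : WLinf 𝕜 m V) (c : 𝕜) (η : Lp V 1 m) :
    q.pair (c • η) = c * q.pair η := by
  unfold WLinf.pair
  rw [← integral_const_mul]
  refine integral_congr_ae ?_
  filter_upwards [Lp.coeFn_smul c η] with y hy
  rw [hy, Pi.smul_apply, map_smul, smul_eq_mul]

theorem WLinf.norm_pair_le {m : Measure Y} (q : WLinf 𝕜 m V) (η : Lp V 1 m) :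
    ‖q.pair η‖ ≤ ‖q.rep‖ * ‖η‖ := by
  unfold WLinf.pair
  rw [L1.norm_eq_integral_norm, ← integral_const_mul]
  refine norm_integral_le_of_norm_le ((L1.integrable_coeFn η).norm.const_mul _) ?_
  filter_upwards [q.rep.ae_norm_le] with y hy
  exact (ContinuousLinearMap.le_opNorm _ _).trans (by gcongr)

theorem WLinf.tendsto_pair {m : Measure Y} (q : WLinf 𝕜 m V) {η : ℕ → Lp V 1 m} {ζ : Lp V 1 m}
    (h : Tendsto η atTop (𝓝 ζ)) : Tendsto (fun n => q.pair (η n)) atTop (𝓝 (q.pair ζ)) := by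
  have h0 : Tendsto (fun n => ‖η n - ζ‖) atTop (𝓝 0) := tendsto_iff_norm_sub_tendsto_zero.1 h
  refine tendsto_iff_norm_sub_tendsto_zero.2 (squeeze_zero (fun _ => norm_nonneg _) (fun n => ?_)
    (by simpa using h0.const_mul ‖q.rep‖))
  have : q.pair (η n) - q.pair ζ = q.pair (η n - ζ) := by
    have := q.pair_add_right (η n - ζ) ζ
    rw [sub_add_cancel] at this
    rw [this, add_sub_cancel_right]
  rw [this]
  exact q.norm_pair_le _

theorem WLinfPre.integrable_apply {m : Measure Y} [IsFiniteMeasure m] (f : WLinfPre 𝕜 m V) (v : V) :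
    Integrable (fun y => f.fn y v) m :=
  Integrable.of_bound (f.meas v) (‖f‖ * ‖v‖) (f.ae_norm_le.mono fun y hy =>
    (ContinuousLinearMap.le_opNorm _ _).trans (by gcongr))

/-- The weak-* integral `∫ f dm ∈ V*`, given by `⟨∫ f dm, v⟩ = ∫ ⟨f(y), v⟩ dm(y)`. -/
def WLinfPre.integral {m : Measure Y} [IsProbabilityMeasure m] (f : WLinfPre 𝕜 m V) :
    StrongDual 𝕜 V :=
  LinearMap.mkContinuous
    { toFun := fun v => ∫ y, f.fn y v ∂m
      map_add' := fun v w => by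
        rw [← integral_add (f.integrable_apply v) (f.integrable_apply w)]
        simp only [map_add]
      map_smul' := fun c v => by
        simp only [map_smul, RingHom.id_apply]
        exact integral_const_mul c _ } ‖f‖ fun v => by
      have h := norm_integral_le_of_norm_le_const (μ := m) (f := fun y => f.fn y v)
        (C := ‖f‖ * ‖v‖) (f.ae_norm_le.mono fun y hy =>
          (ContinuousLinearMap.le_opNorm _ _).trans (by gcongr))
      simpa using h

theorem WLinfPre.norm_integral_le {m : Measure Y} [IsProbabilityMeasure m] (f : WLinfPre 𝕜 m V) :
    ‖f.integral‖ ≤ ‖f‖ :=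
  LinearMap.mkContinuous_norm_le _ (norm_nonneg _) _

variable (𝕜) in
/-- The weak-* integral of a function, with value `0` if the function does not belong to
`weakStarBounded`. -/
def weakIntegral (m : Measure Y) [IsProbabilityMeasure m] (f : Y → StrongDual 𝕜 V) :
    StrongDual 𝕜 V :=
  open Classical in
  if h : f ∈ weakStarBounded 𝕜 m V then WLinfPre.integral (⟨f, h⟩ : WLinfPre 𝕜 m V) else 0

theorem weakIntegral_apply {m : Measure Y} [IsProbabilityMeasure m] {f : Y → StrongDual 𝕜 V}
    (h : f ∈ weakStarBounded 𝕜 m V) (v : V) : weakIntegral 𝕜 m f v = ∫ y, f y v ∂m := by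
  rw [weakIntegral, dif_pos h]; rfl

theorem norm_weakIntegral_le {m : Measure Y} [IsProbabilityMeasure m] {f : Y → StrongDual 𝕜 V}
    {C : ℝ} (hC : 0 ≤ C) (h : ∀ᵐ y ∂m, ‖f y‖ ≤ C) : ‖weakIntegral 𝕜 m f‖ ≤ C := by
  unfold weakIntegral
  split_ifs with hf
  · exact (WLinfPre.norm_integral_le _).trans (WLinfPre.norm_le _ hC h)
  · simpa using hC

theorem WLinf.rep_mk_ae {m : Measure Y} (f : WLinfPre 𝕜 m V) :
    (WLinf.mk m f).rep.fn =ᵐ[m] f.fn :=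
  (WLinf.mk_eq_mk m _ _).1 (WLinf.mk_rep _)

theorem WLinf.ext_rep {m : Measure Y} {q q' : WLinf 𝕜 m V} (h : q.rep.fn =ᵐ[m] q'.rep.fn) :
    q = q' := by
  rw [← WLinf.mk_rep q, ← WLinf.mk_rep q']
  exact (WLinf.mk_eq_mk m _ _).2 h

theorem WLinf.norm_rep {m : Measure Y} (q : WLinf 𝕜 m V) : ‖q.rep‖ = ‖q‖ := by
  rw [← WLinf.norm_mk, WLinf.mk_rep]

theorem WLinf.ae_norm_rep_le {m : Measure Y} (q : WLinf 𝕜 m V) :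
    ∀ᵐ y ∂m, ‖q.rep.fn y‖ ≤ ‖q‖ := by
  have := q.rep.ae_norm_le
  rwa [WLinf.norm_rep] at this

theorem WLinf.rep_add_ae {m : Measure Y} (q q' : WLinf 𝕜 m V) :
    (q + q').rep.fn =ᵐ[m] q.rep.fn + q'.rep.fn := by
  have e : q + q' = WLinf.mk m (q.rep + q'.rep) := by
    rw [map_add, WLinf.mk_rep, WLinf.mk_rep]
  rw [e]; exact WLinf.rep_mk_ae _

theorem WLinf.rep_smul_ae {m : Measure Y} (c : 𝕜) (q : WLinf 𝕜 m V) :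
    (c • q).rep.fn =ᵐ[m] c • q.rep.fn := by
  have e : c • q = WLinf.mk m (c • q.rep) := by
    rw [map_smul, WLinf.mk_rep]
  rw [e]; exact WLinf.rep_mk_ae _

theorem WLinf.rep_zero_ae {m : Measure Y} : (0 : WLinf 𝕜 m V).rep.fn =ᵐ[m] 0 := by
  rw [← map_zero (WLinf.mk m)]; exact WLinf.rep_mk_ae _

theorem WLinf.rep_pull_ae {Z W : Type u} [MeasurableSpace Z] [NormedAddCommGroup W]
    [NormedSpace 𝕜 W] {m : Measure Y} {m' : Measure Z} (T : Y → Z)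
    (hT : Measure.QuasiMeasurePreserving T m m') (θ : W →L[𝕜] V) (q : WLinf 𝕜 m' V) :
    (WLinf.pull T hT θ q).rep.fn =ᵐ[m] fun y => (q.rep.fn (T y)).comp θ := by
  conv_lhs => rw [← WLinf.mk_rep q, WLinf.pull_mk]
  exact WLinf.rep_mk_ae _

/-- In the dual of a separable space, equality almost everywhere can be tested on each vector. -/
theorem ae_eq_of_forall_apply [TopologicalSpace.SeparableSpace V] {m : Measure Y}
    {f g : Y → StrongDual 𝕜 V} (h : ∀ v, ∀ᵐ y ∂m, f y v = g y v) : f =ᵐ[m] g := by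
  rcases isEmpty_or_nonempty V with hV | hV
  · exact ae_of_all _ fun y => ContinuousLinearMap.ext fun v => hV.elim v
  filter_upwards [ae_all_iff.2 fun n => h (TopologicalSpace.denseSeq V n)] with y hy
  refine ContinuousLinearMap.ext fun v => ?_
  exact congrFun ((TopologicalSpace.denseRange_denseSeq V).equalizer (f y).continuous
    (g y).continuous (funext hy)) v

/-- A system of values `h j` prescribed on vectors `w j` is attained by a functional of norm at
most `C` as soon as the obvious inequalities hold for a dense set of coefficients. -/
theorem exists_dual_of_bound (w : ℕ → V) (h : ℕ → 𝕜) {C : ℝ} (hC : 0 ≤ C)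
    (H : ∀ n k, ‖∑ j : Fin n, TopologicalSpace.denseSeq (Fin n → 𝕜) k j * h j‖ ≤
      C * ‖∑ j : Fin n, TopologicalSpace.denseSeq (Fin n → 𝕜) k j • w j‖) :
    ∃ θ : StrongDual 𝕜 V, ‖θ‖ ≤ C ∧ ∀ j, θ (w j) = h j := by
  have H' : ∀ n, ∀ c : Fin n → 𝕜, ‖∑ j : Fin n, c j * h j‖ ≤ C * ‖∑ j : Fin n, c j • w j‖ := by
    intro n c
    have hcl : IsClosed {c : Fin n → 𝕜 | ‖∑ j : Fin n, c j * h j‖ ≤ C * ‖∑ j : Fin n, c j • w j‖} :=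
      isClosed_le (by fun_prop) (by fun_prop)
    exact (TopologicalSpace.denseRange_denseSeq (Fin n → 𝕜)).induction_on c hcl (H n)
  set A := Finsupp.linearCombination 𝕜 w
  set B := Finsupp.linearCombination 𝕜 h
  have hAB : ∀ c, ‖B c‖ ≤ C * ‖A c‖ := by
    intro c
    obtain ⟨n, hn⟩ : ∃ n, c.support ⊆ Finset.range n := Finset.exists_nat_subset_range _
    have e1 : A c = ∑ j : Fin n, c j • w j := by
      rw [Finsupp.linearCombination_apply, Finsupp.sum_of_support_subset c hn _ (by simp),
        Fin.sum_univ_eq_sum_range (fun j => c j • w j)]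
    have e2 : B c = ∑ j : Fin n, c j * h j := by
      rw [Finsupp.linearCombination_apply, Finsupp.sum_of_support_subset c hn _ (by simp),
        Fin.sum_univ_eq_sum_range (fun j => c j * h j)]
      rfl
    rw [e1, e2]
    exact H' n fun j => c j
  have hker : LinearMap.ker A ≤ LinearMap.ker B := by
    intro c hc
    have := hAB c
    rw [LinearMap.mem_ker.1 hc, norm_zero, mul_zero] at this
    exact norm_le_zero_iff.1 this
  set f : LinearMap.range A →ₗ[𝕜] 𝕜 := ((LinearMap.ker A).liftQ B hker) ∘ₗ
    A.quotKerEquivRange.symm.toLinearMap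
  have hf : ∀ c, f ⟨A c, LinearMap.mem_range_self A c⟩ = B c := by
    intro c
    have : A.quotKerEquivRange.symm ⟨A c, LinearMap.mem_range_self A c⟩ =
        (LinearMap.ker A).mkQ c := by
      rw [LinearEquiv.symm_apply_eq]; rfl
    simp only [f, LinearMap.comp_apply, LinearEquiv.coe_coe, this]
    rfl
  have hfb : ∀ v, ‖f v‖ ≤ C * ‖v‖ := by
    rintro ⟨_, c, rfl⟩
    rw [hf]; exact hAB c
  obtain ⟨θ, hθ, hn⟩ := exists_extension_norm_eq (LinearMap.range A) (f.mkContinuous C hfb)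
  refine ⟨θ, hn.trans_le (LinearMap.mkContinuous_norm_le _ hC _), fun j => ?_⟩
  have e : w j = A (Finsupp.single j 1) := by simp [A]
  have := hθ ⟨A (Finsupp.single j 1), LinearMap.mem_range_self A _⟩
  rw [e, this]
  refine (hf _).trans ?_
  simp [B]

end WeakStarTools

/-! ### Measures on fibred spaces -/

section Fibred

variable {X : Type u} [MeasurableSpace X] {S : X → Type u} [∀ x, MeasurableSpace (S x)]
  [MeasurableSpace (Total S)] {μ : Measure X} {τ : ∀ x, Measure (S x)}

theorem measurable_map_mk (hmk : ∀ x, Measurable (Total.mk x : S x → Total S))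
    (hτ : IsMeasurableFamily τ) : Measurable fun x => (τ x).map (Total.mk x) := by
  refine Measure.measurable_of_measurable_coe _ fun A hA => ?_
  simp_rw [Measure.map_apply (hmk _) hA]
  exact hτ A hA

theorem ae_ae_of_ae_integrate (hmk : ∀ x, Measurable (Total.mk x : S x → Total S))
    (hτ : IsMeasurableFamily τ) {P : Total S → Prop} (h : ∀ᵐ p ∂integrate μ τ, P p) :
    ∀ᵐ x ∂μ, ∀ᵐ s ∂τ x, P (Total.mk x s) :=
  (Measure.ae_ae_of_ae_bind (measurable_map_mk hmk hτ).aemeasurable h).mono fun x hx =>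
    ae_of_ae_map (hmk x).aemeasurable hx

theorem ae_integrate_of_ae_ae (hmk : ∀ x, Measurable (Total.mk x : S x → Total S))
    (hτ : IsMeasurableFamily τ) {P : Total S → Prop} (hP : MeasurableSet {p | P p})
    (h : ∀ᵐ x ∂μ, ∀ᵐ s ∂τ x, P (Total.mk x s)) : ∀ᵐ p ∂integrate μ τ, P p := by
  change (μ.bind fun x => (τ x).map (Total.mk x)) {p | P p}ᶜ = 0
  rw [Measure.bind_apply hP.compl (measurable_map_mk hmk hτ).aemeasurable,
    lintegral_eq_zero_iff (f := fun x => (τ x).map (Total.mk x) {p | P p}ᶜ)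
      ((Measure.measurable_coe hP.compl).comp (measurable_map_mk hmk hτ))]
  filter_upwards [h] with x hx
  rw [Measure.map_apply (hmk x) hP.compl]
  exact hx

/-- A property of `x` which holds almost everywhere holds almost everywhere along the projection. -/
theorem ae_integrate_of_ae (hmk : ∀ x, Measurable (Total.mk x : S x → Total S))
    (hτ : IsMeasurableFamily τ) (hproj : Measurable fun s : Total S => s.1) {P : X → Prop}
    (h : ∀ᵐ x ∂μ, P x) : ∀ᵐ p ∂integrate μ τ, P p.1 := by
  have hN := measurableSet_toMeasurable μ {x | ¬ P x}
  have : ∀ᵐ p ∂integrate μ τ, p.1 ∉ toMeasurable μ {x | ¬ P x} := by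
    refine ae_integrate_of_ae_ae hmk hτ (hproj hN).compl ?_
    have h0 : ∀ᵐ x ∂μ, x ∉ toMeasurable μ {x | ¬ P x} :=
      measure_eq_zero_iff_ae_notMem.1 (by rw [measure_toMeasurable]; exact h)
    exact h0.mono fun x hx => ae_of_all _ fun s => hx
  refine this.mono fun p hp => ?_
  by_contra hc
  exact hp (subset_toMeasurable μ _ hc)

/-- For measures all of whose null sets are empty, null sets of the total space are those with
almost all fibres empty. -/
theorem ae_integrate_iff_forall (hmk : ∀ x, Measurable (Total.mk x : S x → Total S))
    (hτ : IsMeasurableFamily τ) (hproj : Measurable fun s : Total S => s.1)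
    (hfull : ∀ x (s : S x), τ x {s} ≠ 0) {P : Total S → Prop} :
    (∀ᵐ p ∂integrate μ τ, P p) ↔ ∀ᵐ x ∂μ, ∀ s : S x, P (Total.mk x s) := by
  constructor
  · intro h
    filter_upwards [ae_ae_of_ae_integrate hmk hτ h] with x hx s
    by_contra hc
    exact hfull x s (measure_mono_null (by rintro _ rfl; exact hc) hx)
  · intro h
    exact (ae_integrate_of_ae hmk hτ hproj h).mono fun p hp => hp p.2

end Fibred

/-! ### Discrete measured groupoids -/

section Discrete

variable {X : Type u} [MeasurableSpace X] [BorelGroupoid X]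

theorem measurable_arrow_mk (x : X) : Measurable (Total.mk x : ArrowsTo X x → Arrows X) :=
  (BorelGroupoid.measurableEmbedding_mk x).measurable

instance (x : X) : MeasurableSingletonClass (ArrowsTo X x) := by
  refine ⟨fun g => ?_⟩
  have h : ({g} : Set (ArrowsTo X x)) = Total.mk x ⁻¹' {(Total.mk x g : Arrows X)} := by
    ext g'
    simp only [Set.mem_singleton_iff, Set.mem_preimage]
    exact ((BorelGroupoid.measurableEmbedding_mk x).injective.eq_iff).symm
  rw [h]
  exact measurable_arrow_mk x (measurableSet_singleton _)

variable {μ : Measure X} (M : MeasuredGroupoid X μ)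

theorem MeasuredGroupoid.IsTDiscrete.countable (hM : M.IsTDiscrete) (x : X) :
    Countable (ArrowsTo X x) := (hM x).1

theorem MeasuredGroupoid.IsTDiscrete.ν_singleton_ne_zero (hM : M.IsTDiscrete) (x : X)
    (g : ArrowsTo X x) :
    M.ν x {g} ≠ 0 := by
  intro h
  have := (M.equiv x).2 h
  rw [(hM x).2, Measure.count_singleton] at this
  exact one_ne_zero this

theorem MeasuredGroupoid.IsTDiscrete.ae_ν_iff (hM : M.IsTDiscrete) (x : X)
    {P : ArrowsTo X x → Prop} :
    (∀ᵐ g ∂M.ν x, P g) ↔ ∀ g, P g := by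
  refine ⟨fun h g => ?_, fun h => ae_of_all _ h⟩
  by_contra hc
  exact hM.ν_singleton_ne_zero M x g (measure_mono_null (by rintro _ rfl; exact hc) h)

theorem MeasuredGroupoid.IsTDiscrete.ae_arrowMeasure_iff (hM : M.IsTDiscrete)
    {P : Arrows X → Prop} :
    (∀ᵐ a ∂M.arrowMeasure, P a) ↔ ∀ᵐ x ∂μ, ∀ g : ArrowsTo X x, P (Total.mk x g) :=
  ae_integrate_iff_forall measurable_arrow_mk M.measurable_ν BorelGroupoid.measurable_target
    (hM.ν_singleton_ne_zero M)

/-- Inversion preserves the null sets of arrows. -/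
theorem MeasuredGroupoid.IsTDiscrete.ae_inv (hM : M.IsTDiscrete) {P : Arrows X → Prop}
    (h : ∀ᵐ a ∂M.arrowMeasure, P a) :
    ∀ᵐ a ∂M.arrowMeasure, P (arrow (Groupoid.inv a.2.2)) := by
  have hfull : ∀ x (s : ArrowsTo X x), M.haar.ρ x {s} ≠ 0 := fun x s => by
    rw [(hM x).2, Measure.count_singleton]; exact one_ne_zero
  have key : ∀ Q : Arrows X → Prop, (∀ᵐ a ∂M.arrowMeasure, Q a) ↔
      ∀ᵐ a ∂integrate μ M.haar.ρ, Q a := fun Q => by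
    rw [hM.ae_arrowMeasure_iff, ae_integrate_iff_forall measurable_arrow_mk M.haar.measurable
      BorelGroupoid.measurable_target hfull]
  rw [key] at h ⊢
  exact ae_of_ae_map BorelGroupoid.measurable_inv.aemeasurable (M.quasiInvariant.1.ae_le h)

/-- A property that holds almost everywhere on the unit space holds, for almost every `x`, at the
sources of all arrows with target `x`. -/
theorem MeasuredGroupoid.IsTDiscrete.ae_source (hM : M.IsTDiscrete) {P : X → Prop}
    (h : ∀ᵐ x ∂μ, P x) :
    ∀ᵐ x ∂μ, ∀ g : ArrowsTo X x, P g.1 := by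
  have h1 : ∀ᵐ a ∂M.arrowMeasure, P a.1 := (hM.ae_arrowMeasure_iff M).2 (h.mono fun x hx _ => hx)
  exact (hM.ae_arrowMeasure_iff M).1 (hM.ae_inv M h1)

/-- A Borel section of the target map. -/
structure BorelSection (X : Type u) [MeasurableSpace X] [BorelGroupoid X] where
  toFun : ∀ x : X, ArrowsTo X x
  measurable : Measurable fun x => (Total.mk x (toFun x) : Arrows X)

instance : CoeFun (BorelSection X) fun _ => ∀ x, ArrowsTo X x := ⟨BorelSection.toFun⟩

theorem BorelSection.measurable_source (γ : BorelSection X) : Measurable fun x => (γ x).1 :=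
  BorelGroupoid.measurable_source.comp γ.measurable

/-- The Borel section with prescribed arrows. -/
def BorelSection.ofArrows (c : X → Arrows X) (hc : Measurable c) (h : ∀ x, (c x).1 = x) :
    BorelSection X where
  toFun x := h x ▸ (c x).2
  measurable := by
    have : (fun x => (Total.mk x (h x ▸ (c x).2) : Arrows X)) = c := by
      funext x
      generalize_proofs hx
      revert hx
      generalize c x = a
      rintro rfl
      rfl
    rw [this]
    exact hc

theorem BorelSection.mk_ofArrows (c : X → Arrows X) (hc : Measurable c) (h : ∀ x, (c x).1 = x)
    (x : X) : (Total.mk x (BorelSection.ofArrows c hc h x) : Arrows X) = c x := by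
  unfold BorelSection.ofArrows
  simp only
  generalize_proofs hx
  revert hx
  generalize c x = a
  rintro rfl
  rfl

/-- A set of arrows on which the target map is injective is contained in the image of a Borel
section. -/
theorem exists_borelSection_of_injOn [StandardBorelSpace X] {C : Set (Arrows X)}
    (hC : MeasurableSet C) (hinj : ∀ a ∈ C, ∀ b ∈ C, a.1 = b.1 → a = b) :
    ∃ γ : BorelSection X, ∀ x (g : ArrowsTo X x), (Total.mk x g : Arrows X) ∈ C → γ x = g := by
  classical
  have := hC.standardBorel
  have hf : Measurable fun a : C => a.1.1 :=
    BorelGroupoid.measurable_target.comp measurable_subtype_coe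
  have hemb : MeasurableEmbedding fun a : C => a.1.1 :=
    hf.measurableEmbedding fun a b h => Subtype.ext (hinj _ a.2 _ b.2 h)
  obtain ⟨c, hc, hce⟩ := hemb.exists_measurable_extend measurable_subtype_coe
    (fun x => ⟨arrow (𝟙 x)⟩)
  have hs : MeasurableSet {x | (c x).1 = x} :=
    measurableSet_eq_fun (BorelGroupoid.measurable_target.comp hc) measurable_id
  set c' : X → Arrows X := fun x => if (c x).1 = x then c x else arrow (𝟙 x)
  have hc' : Measurable c' := Measurable.ite hs hc BorelGroupoid.measurable_unit
  have h1 : ∀ x, (c' x).1 = x := by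
    intro x
    by_cases h : (c x).1 = x
    · simp only [c', if_pos h, h]
    · simp only [c', if_neg h]; rfl
  refine ⟨BorelSection.ofArrows c' hc' h1, fun x g hg => ?_⟩
  apply (BorelGroupoid.measurableEmbedding_mk x).injective
  rw [BorelSection.mk_ofArrows]
  have h2 : c x = Total.mk x g := congrFun hce ⟨_, hg⟩
  simp only [c', h2]
  exact if_pos rfl

/-- A `t`-discrete measured groupoid is covered by countably many Borel sections of the target map.
The normalized measures `ν^x` make the Lusin–Novikov theorem elementary here: only finitely many
points of `G^x` have mass above a given bound, and these can be separated by rational intervals. -/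
theorem exists_borelSection_enum (hM : M.IsTDiscrete) [StandardBorelSpace X] :
    ∃ γ : ℕ → BorelSection X, ∀ x (g : ArrowsTo X x), ∃ i, γ i x = g := by
  classical
  set N : ProbabilityTheory.Kernel X (Arrows X) :=
    ⟨fun x => (M.ν x).map (Total.mk x), measurable_map_mk measurable_arrow_mk M.measurable_ν⟩
    with hN
  have hprob : ProbabilityTheory.IsMarkovKernel N :=
    ⟨fun x => Measure.isProbabilityMeasure_map (measurable_arrow_mk x).aemeasurable⟩
  have htarget : Measurable fun a : Arrows X => a.1 := BorelGroupoid.measurable_target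
  -- the mass of a single arrow
  set mass : Arrows X → ℝ≥0∞ := fun a => M.ν a.1 {a.2} with hmass
  have hmassm : Measurable mass := by
    have h := ProbabilityTheory.Kernel.measurable_kernel_prodMk_left (κ := N.comap _ htarget)
      (measurableSet_eq_fun (f := fun p : Arrows X × Arrows X => p.1) (g := fun p => p.2)
        measurable_fst measurable_snd)
    convert h using 2 with a
    rw [ProbabilityTheory.Kernel.comap_apply]
    change M.ν a.1 {a.2} = (M.ν a.1).map (Total.mk a.1) _
    rw [Measure.map_apply (measurable_arrow_mk _) ?_]
    · congr 1
      ext g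
      simp only [Set.mem_singleton_iff, Set.mem_preimage]
      constructor
      · rintro rfl; rfl
      · intro h
        exact ((BorelGroupoid.measurableEmbedding_mk a.1).injective h).symm
    · exact measurable_prodMk_left (measurableSet_eq_fun measurable_fst measurable_snd)
  -- the arrows of mass at least `r.1` in an interval with rational end points
  set e := MeasureTheory.embeddingReal (Arrows X)
  have he : MeasurableEmbedding e := measurableEmbedding_embeddingReal _
  set B : ℚ × ℚ × ℚ → Set (Arrows X) := fun r =>
    {a | ENNReal.ofReal (r.1 : ℝ) < mass a} ∩ e ⁻¹' Set.Ioo (r.2.1 : ℝ) (r.2.2 : ℝ) with hB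
  have hBm : ∀ r, MeasurableSet (B r) := fun r =>
    (measurableSet_lt measurable_const hmassm).inter (he.measurable measurableSet_Ioo)
  -- the number of elements of `B r` with target `x`, as an integral
  set cnt : ℚ × ℚ × ℚ → X → ℝ≥0∞ := fun r x => ∫⁻ a, (B r).indicator (fun a => (mass a)⁻¹) a ∂N x
    with hcnt
  have hcntm : ∀ r, Measurable (cnt r) := fun r =>
    Measurable.lintegral_kernel (κ := N) (hmassm.inv.indicator (hBm r))
  have hcnt_eq : ∀ r x, cnt r x =
      ∑' g : ArrowsTo X x, (B r).indicator (fun _ => (1 : ℝ≥0∞)) (Total.mk x g) := by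
    intro r x
    have := (hM x).1
    simp only [hcnt, hN]
    change ∫⁻ a, _ ∂(M.ν x).map (Total.mk x) = _
    rw [lintegral_map (f := (B r).indicator fun a => (mass a)⁻¹) (hmassm.inv.indicator (hBm r))
        (measurable_arrow_mk x),
      lintegral_countable']
    refine tsum_congr fun g => ?_
    by_cases hg : (Total.mk x g : Arrows X) ∈ B r
    · rw [Set.indicator_of_mem hg, Set.indicator_of_mem hg]
      exact ENNReal.inv_mul_cancel (hM.ν_singleton_ne_zero M x g) (measure_ne_top _ _)
    · rw [Set.indicator_of_notMem hg, Set.indicator_of_notMem hg, zero_mul]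
  -- the part of `B r` on which the target map is injective
  set C : ℚ × ℚ × ℚ → Set (Arrows X) := fun r => B r ∩ {a | cnt r a.1 = 1}
  have hCm : ∀ r, MeasurableSet (C r) := fun r =>
    (hBm r).inter ((hcntm r).comp htarget (measurableSet_singleton 1))
  have hCinj : ∀ r, ∀ a ∈ C r, ∀ b ∈ C r, a.1 = b.1 → a = b := by
    rintro r ⟨x, g⟩ ⟨ha, ha1⟩ ⟨y, h⟩ ⟨hb, -⟩ hxy
    obtain rfl : x = y := hxy
    by_contra hne
    have hgh : g ≠ h := fun h => hne (by rw [h])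
    have h1 : cnt r x = 1 := ha1
    rw [hcnt_eq] at h1
    have h2 := ENNReal.sum_le_tsum (f := fun g : ArrowsTo X x =>
      (B r).indicator (fun _ => (1 : ℝ≥0∞)) (Total.mk x g)) {g, h}
    rw [Finset.sum_pair hgh, h1, Set.indicator_of_mem (by exact ha),
      Set.indicator_of_mem (by exact hb)] at h2
    norm_num at h2
  have hcover : ∀ x (g : ArrowsTo X x), ∃ r, (Total.mk x g : Arrows X) ∈ C r := by
    intro x g
    have hc := (hM x).1
    obtain ⟨r, hr0, hr⟩ : ∃ r : ℚ, 0 < (r : ℝ) ∧ ENNReal.ofReal (r : ℝ) < M.ν x {g} := by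
      have hpos : 0 < (M.ν x {g}).toReal :=
        ENNReal.toReal_pos (hM.ν_singleton_ne_zero M x g) (measure_ne_top _ _)
      obtain ⟨r, h0, h1⟩ := exists_rat_btwn hpos
      exact ⟨r, h0, (ENNReal.ofReal_lt_iff_lt_toReal h0.le (measure_ne_top _ _)).2 h1⟩
    have hfin : Set.Finite {h : ArrowsTo X x | ENNReal.ofReal (r : ℝ) ≤ M.ν x {h}} := by
      refine ENNReal.finite_const_le_of_tsum_ne_top (a := fun h : ArrowsTo X x => M.ν x {h}) ?_
        (ENNReal.ofReal_pos.2 hr0).ne'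
      have : ∑' h : ArrowsTo X x, M.ν x {h} = ∫⁻ h, 1 ∂M.ν x := by
        rw [lintegral_countable']; simp
      rw [this, lintegral_one]
      exact measure_ne_top _ _
    set K : Set ℝ := (fun h : ArrowsTo X x => e (Total.mk x h)) ''
      ({h : ArrowsTo X x | ENNReal.ofReal (r : ℝ) ≤ M.ν x {h}} \ {g})
    have hK : K.Finite := (hfin.sdiff).image _
    have hgK : e (Total.mk x g) ∈ Kᶜ := by
      rintro ⟨h, ⟨-, hne⟩, heq⟩
      exact hne ((BorelGroupoid.measurableEmbedding_mk x).injective (he.injective heq))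
    obtain ⟨ε, hε, hball⟩ := Metric.isOpen_iff.1 hK.isClosed.isOpen_compl _ hgK
    obtain ⟨p, hp1, hp2⟩ := exists_rat_btwn (sub_lt_self (e (Total.mk x g)) hε)
    obtain ⟨q, hq1, hq2⟩ := exists_rat_btwn (lt_add_of_pos_right (e (Total.mk x g)) hε)
    have hmem : (Total.mk x g : Arrows X) ∈ B (r, p, q) := ⟨hr, hp2, hq1⟩
    refine ⟨(r, p, q), hmem, ?_⟩
    change cnt (r, p, q) x = 1
    rw [hcnt_eq, tsum_eq_single g, Set.indicator_of_mem hmem]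
    intro h hne
    refine Set.indicator_of_notMem (fun hh => ?_) _
    have hin : e (Total.mk x h) ∈ Kᶜ := hball (by
      rw [Real.ball_eq_Ioo]; exact ⟨hp1.trans hh.2.1, hh.2.2.trans hq2⟩)
    exact hin ⟨h, ⟨show ENNReal.ofReal (r : ℝ) ≤ M.ν x {h} from
      le_of_lt (show ENNReal.ofReal (r : ℝ) < M.ν x {h} from hh.1), hne⟩, rfl⟩
  choose γ hγ using fun r => exists_borelSection_of_injOn (hCm r) (hCinj r)
  obtain ⟨f, hf⟩ := exists_surjective_nat (ℚ × ℚ × ℚ)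
  refine ⟨fun n => γ (f n), fun x g => ?_⟩
  obtain ⟨r, hr⟩ := hcover x g
  obtain ⟨n, rfl⟩ := hf r
  exact ⟨n, hγ _ x g hr⟩

end Discrete

/-! ### Tuples of points in a fibre -/

section Tuples

variable {X : Type u} [MeasurableSpace X] [BorelGroupoid X] (S : GSpace X)

/-- The product measure `(τ^x)^q` on `(S^x)^q`, for `q ≥ 0`. -/
abbrev GSpace.tupleMeasure (q : ℕ) (x : X) : Measure (Fin q → S.fiber x) :=
  Measure.pi fun _ => S.τ x

/-- A `q`-tuple in the fibre `S^x`, as a `q`-tuple in the total space. -/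
def GSpace.tuple {q : ℕ} (x : X) (s : Fin q → S.fiber x) : Fin q → Total S.fiber :=
  fun i => Total.mk x (s i)

theorem GSpace.measurable_mk (x : X) : Measurable (Total.mk x : S.fiber x → Total S.fiber) :=
  (S.measurableEmbedding_mk x).measurable

theorem GSpace.measurable_tuple {q : ℕ} (x : X) : Measurable (S.tuple (q := q) x) :=
  measurable_pi_lambda _ fun i => (S.measurable_mk x).comp (measurable_pi_apply i)

theorem GSpace.comap_tuple {q : ℕ} (x : X) :
    MeasurableSpace.comap (S.tuple (q := q) x) inferInstance = MeasurableSpace.pi := by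
  rw [MeasurableSpace.pi, MeasurableSpace.comap_iSup, MeasurableSpace.pi]
  refine iSup_congr fun i => ?_
  rw [MeasurableSpace.comap_comp, ← (S.measurableEmbedding_mk x).comap_eq,
    MeasurableSpace.comap_comp]
  rfl

/-- An almost everywhere measurable function on `(S^x)^q` extends to a measurable function on the
`q`-th power of the total space. -/
theorem GSpace.exists_tuple_factor {𝕜 : Type} [RCLike 𝕜] {q : ℕ} {x : X}
    {m : Measure (Fin q → S.fiber x)} {u : (Fin q → S.fiber x) → 𝕜}
    (hu : AEStronglyMeasurable u m) :
    ∃ v : (Fin q → Total S.fiber) → 𝕜, StronglyMeasurable v ∧ ∀ᵐ s ∂m, u s = v (S.tuple x s) := by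
  obtain ⟨u', hu', he⟩ := hu
  rw [← S.comap_tuple x] at hu'
  obtain ⟨v, hv, rfl⟩ := hu'.exists_eq_measurable_comp
  exact ⟨v, hv, he⟩

/-- The kernel of product measures of measurable families of probability measures on the fibres. -/
theorem GSpace.measurable_pi_map_tuple {q : ℕ} (l : Fin q → ∀ x, Measure (S.fiber x))
    [∀ i x, IsProbabilityMeasure (l i x)] (hl : ∀ i, IsMeasurableFamily (l i)) :
    Measurable fun x => (Measure.pi fun i => l i x).map (S.tuple x) := by
  have : ∀ x, IsProbabilityMeasure ((Measure.pi fun i => l i x).map (S.tuple x)) := fun x =>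
    Measure.isProbabilityMeasure_map (S.measurable_tuple x).aemeasurable
  refine Measurable.measure_of_isPiSystem_of_isProbabilityMeasure generateFrom_pi.symm isPiSystem_pi
    ?_
  rintro _ ⟨B, hB, rfl⟩
  have hB' : ∀ i, MeasurableSet (B i) := fun i => hB i (Set.mem_univ i)
  have e : ∀ x, (Measure.pi fun i => l i x).map (S.tuple x) (Set.univ.pi B) =
      ∏ i, l i x (Total.mk x ⁻¹' B i) := by
    intro x
    rw [Measure.map_apply (S.measurable_tuple x) (MeasurableSet.univ_pi hB'), ← Measure.pi_pi]
    rfl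
  simp_rw [e]
  exact Finset.measurable_fun_prod _ fun i _ => hl i _ (hB' i)

/-- The kernel `x ↦ (τ^x)^q`, viewed on the `q`-th power of the total space. -/
def GSpace.tupleKernel (q : ℕ) : ProbabilityTheory.Kernel X (Fin q → Total S.fiber) :=
  ⟨fun x => (S.tupleMeasure q x).map (S.tuple x),
    S.measurable_pi_map_tuple (fun _ => S.τ) fun _ => S.measurable_τ⟩

instance (q : ℕ) : ProbabilityTheory.IsMarkovKernel (S.tupleKernel q) :=
  ⟨fun x => Measure.isProbabilityMeasure_map (S.measurable_tuple x).aemeasurable⟩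

theorem measurePreserving_cons {Y : Type u} [MeasurableSpace Y] (m : Measure Y)
    [IsProbabilityMeasure m] (q : ℕ) :
    MeasurePreserving (fun p : Y × (Fin q → Y) => (Fin.cons p.1 p.2 : Fin (q + 1) → Y))
      (m.prod (Measure.pi fun _ => m)) (Measure.pi fun _ => m) := by
  have h := (measurePreserving_piFinSuccAbove (fun _ : Fin (q + 1) => m) 0).symm
  convert h using 1
  funext p i
  refine Fin.cases ?_ (fun j => ?_) i <;> simp [MeasurableEquiv.piFinSuccAbove]

theorem ae_ae_cons {Y : Type u} [MeasurableSpace Y] (m : Measure Y)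
    [IsProbabilityMeasure m] {q : ℕ} {P : (Fin (q + 1) → Y) → Prop}
    (h : ∀ᵐ s ∂Measure.pi (fun _ => m), P s) :
    ∀ᵐ t ∂m, ∀ᵐ s ∂Measure.pi (fun _ : Fin q => m), P (Fin.cons t s) :=
  Measure.ae_ae_of_ae_prod ((measurePreserving_cons m q).quasiMeasurePreserving.ae h)

theorem ae_ae_cons' {Y : Type u} [MeasurableSpace Y] (m : Measure Y)
    [IsProbabilityMeasure m] {q : ℕ} {P : (Fin (q + 1) → Y) → Prop}
    (h : ∀ᵐ s ∂Measure.pi (fun _ => m), P s) :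
    ∀ᵐ s ∂Measure.pi (fun _ : Fin q => m), ∀ᵐ t ∂m, P (Fin.cons t s) := by
  have h1 := (measurePreserving_cons m q).quasiMeasurePreserving.ae h
  exact Measure.ae_ae_of_ae_prod ((Measure.measurePreserving_swap
    (μ := Measure.pi fun _ : Fin q => m) (ν := m)).quasiMeasurePreserving.ae h1)

end Tuples

/-! ### Functions on fibred powers with a jointly measurable version -/

section Joint

variable {𝕜 : Type} [RCLike 𝕜] {X : Type u} [MeasurableSpace X] [BorelGroupoid X]
  {μ : Measure X} {S : GSpace X}

variable (μ S) in
/-- A family of functions `u_x` on `(S^x)^q` is represented by a measurable function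
`h(x, s_1, …, s_q)`, up to null sets. -/
def IsJoint (q : ℕ) (u : ∀ x, (Fin q → S.fiber x) → 𝕜) : Prop :=
  ∃ h : X × (Fin q → Total S.fiber) → 𝕜, StronglyMeasurable h ∧
    ∀ᵐ x ∂μ, ∀ᵐ s ∂S.tupleMeasure q x, u x s = h (x, S.tuple x s)

namespace IsJoint

variable {q : ℕ} {u v : ∀ x, (Fin q → S.fiber x) → 𝕜}

theorem congr (hu : IsJoint μ S q u)
    (h : ∀ᵐ x ∂μ, ∀ᵐ s ∂S.tupleMeasure q x, v x s = u x s) : IsJoint μ S q v := by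
  obtain ⟨k, hk, he⟩ := hu
  refine ⟨k, hk, ?_⟩
  filter_upwards [he, h] with x h1 h2
  filter_upwards [h1, h2] with s h3 h4
  rw [h4, h3]

theorem add (hu : IsJoint μ S q u) (hv : IsJoint μ S q v) :
    IsJoint μ S q fun x s => u x s + v x s := by
  obtain ⟨k, hk, he⟩ := hu
  obtain ⟨l, hl, hf⟩ := hv
  refine ⟨fun p => k p + l p, hk.add hl, ?_⟩
  filter_upwards [he, hf] with x h1 h2
  filter_upwards [h1, h2] with s h3 h4
  rw [h4, h3]

theorem mul (hu : IsJoint μ S q u) (hv : IsJoint μ S q v) :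
    IsJoint μ S q fun x s => u x s * v x s := by
  obtain ⟨k, hk, he⟩ := hu
  obtain ⟨l, hl, hf⟩ := hv
  refine ⟨fun p => k p * l p, hk.mul hl, ?_⟩
  filter_upwards [he, hf] with x h1 h2
  filter_upwards [h1, h2] with s h3 h4
  rw [h4, h3]

theorem of_base {φ : X → 𝕜} (hφ : AEStronglyMeasurable φ μ) :
    IsJoint μ S q fun x _ => φ x := by
  obtain ⟨φ', hφ', he⟩ := hφ
  exact ⟨fun p => φ' p.1, hφ'.comp_measurable measurable_fst,
    he.mono fun x hx => ae_of_all _ fun _ => hx⟩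

theorem const_mul (c : 𝕜) (hu : IsJoint μ S q u) : IsJoint μ S q fun x s => c * u x s :=
  (of_base aestronglyMeasurable_const).mul hu

theorem sum {ι : Type*} (I : Finset ι) {w : ι → ∀ x, (Fin q → S.fiber x) → 𝕜}
    (hw : ∀ i ∈ I, IsJoint μ S q (w i)) : IsJoint μ S q fun x s => ∑ i ∈ I, w i x s := by
  classical
  induction I using Finset.induction_on with
  | empty =>
    simpa using of_base (μ := μ) (S := S) (q := q) (φ := fun _ => (0 : 𝕜))
      aestronglyMeasurable_const
  | insert a I ha ih =>
    simp only [Finset.sum_insert ha]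
    exact (hw a (Finset.mem_insert_self _ _)).add
        (ih fun i hi => hw i (Finset.mem_insert_of_mem hi))

theorem lim {w : ℕ → ∀ x, (Fin q → S.fiber x) → 𝕜} (hw : ∀ n, IsJoint μ S q (w n))
    (h : ∀ᵐ x ∂μ, ∀ᵐ s ∂S.tupleMeasure q x, Tendsto (fun n => w n x s) atTop (𝓝 (u x s))) :
    IsJoint μ S q u := by
  choose k hk he using hw
  refine ⟨fun p => limUnder atTop fun n => k n p, StronglyMeasurable.limUnder hk, ?_⟩
  filter_upwards [ae_all_iff.2 he, h] with x h1 h2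
  filter_upwards [ae_all_iff.2 h1, h2] with s h3 h4
  refine (Tendsto.limUnder_eq (h4.congr fun n => h3 n)).symm

/-- Integration over the fibres against a measurable family of measures. -/
theorem aestronglyMeasurable_integral (hu : IsJoint μ S q u)
    (κ : ProbabilityTheory.Kernel X (Fin q → Total S.fiber)) [ProbabilityTheory.IsSFiniteKernel κ]
    (m : ∀ x, Measure (Fin q → S.fiber x)) (hκ : ∀ x, κ x = (m x).map (S.tuple x))
    (hm : ∀ x, m x ≪ S.tupleMeasure q x) :
    AEStronglyMeasurable (fun x => ∫ s, u x s ∂m x) μ := by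
  obtain ⟨k, hk, he⟩ := hu
  refine ⟨fun x => ∫ y, k (x, y) ∂κ x, hk.integral_kernel_prod_right', ?_⟩
  filter_upwards [he] with x h1
  rw [hκ, integral_map (f := fun y => k (x, y)) (S.measurable_tuple x).aemeasurable
    (hk.comp_measurable measurable_prodMk_left).aestronglyMeasurable]
  exact integral_congr_ae ((hm x).ae_le h1)

theorem zero_iff {φ : X → 𝕜} :
    IsJoint μ S 0 (fun x _ => φ x) ↔ AEStronglyMeasurable φ μ := by
  refine ⟨fun h => ?_, of_base⟩
  have := h.aestronglyMeasurable_integral (S.tupleKernel 0) (S.tupleMeasure 0) (fun _ => rfl)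
    fun _ => Measure.AbsolutelyContinuous.rfl
  simpa using this

/-- Integrating out the first variable, against a measurable family of measures. -/
theorem integral_cons {u : ∀ x, (Fin (q + 1) → S.fiber x) → 𝕜} (hu : IsJoint μ S (q + 1) u)
    (l : ∀ x, Measure (S.fiber x)) [∀ x, IsProbabilityMeasure (l x)] (hl : IsMeasurableFamily l)
    (hac : ∀ x, l x ≪ S.τ x) :
    IsJoint μ S q fun x s => ∫ t, u x (Fin.cons t s) ∂l x := by
  obtain ⟨k, hk, he⟩ := hu
  set κ : ProbabilityTheory.Kernel X (Total S.fiber) :=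
    ⟨fun x => (l x).map (Total.mk x), measurable_map_mk S.measurable_mk hl⟩ with hκ
  have : ProbabilityTheory.IsMarkovKernel κ :=
    ⟨fun x => Measure.isProbabilityMeasure_map (S.measurable_mk x).aemeasurable⟩
  have hc : Measurable fun p : (X × (Fin q → Total S.fiber)) × Total S.fiber =>
      ((p.1.1, Fin.cons p.2 p.1.2) : X × (Fin (q + 1) → Total S.fiber)) := by
    refine (measurable_fst.comp measurable_fst).prodMk (measurable_pi_lambda _ fun i => ?_)
    refine Fin.cases ?_ (fun j => ?_) i
    · simpa using measurable_snd
    · simp only [Fin.cons_succ]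
      exact (measurable_pi_apply j).comp (measurable_snd.comp measurable_fst)
  refine ⟨fun p => ∫ t, k (p.1, Fin.cons t p.2) ∂κ p.1, ?_, ?_⟩
  · exact StronglyMeasurable.integral_kernel_prod_right' (κ := κ.comap Prod.fst measurable_fst)
      (hk.comp_measurable hc)
  · filter_upwards [he] with x h1
    filter_upwards [ae_ae_cons' _ h1] with s h2
    change _ = ∫ t, k (x, Fin.cons t (S.tuple x s)) ∂(l x).map (Total.mk x)
    rw [integral_map (S.measurable_mk x).aemeasurable]
    · refine integral_congr_ae (Eventually.mono ((hac x).ae_le h2) fun t ht => ?_)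
      dsimp only
      rw [ht]
      congr 2
      funext i
      refine Fin.cases ?_ (fun j => ?_) i <;> rfl
    · exact ((hk.comp_measurable hc).comp_measurable
        (measurable_prodMk_left (x := (x, S.tuple x s)))).aestronglyMeasurable

/-- Omitting one of the variables. -/
theorem comp_face (hu : IsJoint μ S q u) (i : Fin (q + 1)) :
    IsJoint μ S (q + 1) fun x s => u x fun j => s (i.succAbove j) := by
  obtain ⟨k, hk, he⟩ := hu
  refine ⟨fun p => k (p.1, fun j => p.2 (i.succAbove j)), hk.comp_measurable ?_, ?_⟩
  · exact measurable_fst.prodMk (measurable_pi_lambda _ fun j =>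
      (measurable_pi_apply _).comp measurable_snd)
  · filter_upwards [he] with x h1
    have hqmp : Measure.QuasiMeasurePreserving (fun (s : Fin (q + 1) → S.fiber x) j =>
        s (i.succAbove j)) (S.tupleMeasure (q + 1) x) (S.tupleMeasure q x) :=
      Measure.quasiMeasurePreserving_snd.comp
        (measurePreserving_piFinSuccAbove (fun _ : Fin (q + 1) => S.τ x) i).quasiMeasurePreserving
    exact hqmp.ae h1

end IsJoint

/-! ### Measurable sections of the bundles `L(S^{(n+1)}, E)` -/

/-- A point of `S^{(n+1)}` as a tuple in the total space. -/
def GSpace.powTuple (S : GSpace X) (n : ℕ) (p : S.Pow n) : Fin (n + 1) → Total S.fiber :=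
  S.tuple p.1 p.2

theorem GSpace.measurable_powTuple (S : GSpace X) (n : ℕ) : Measurable (S.powTuple n) :=
  comap_measurable _

/-- The inclusion of the fibre `(S^x)^{n+1}` in `S^{(n+1)}`. -/
def GSpace.powMk (S : GSpace X) (n : ℕ) (x : X) (s : Fin (n + 1) → S.fiber x) : S.Pow n := ⟨x, s⟩

theorem GSpace.measurable_powMk (S : GSpace X) (n : ℕ) (x : X) : Measurable (S.powMk n x) :=
  measurable_comap_iff.2 (S.measurable_tuple x)

theorem GSpace.measurable_powMeasure_map (S : GSpace X) (n : ℕ) :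
    Measurable fun x => (S.powMeasure n x).map (S.powMk n x) := by
  refine Measure.measurable_of_measurable_coe _ fun A hA => ?_
  obtain ⟨B, hB, rfl⟩ := hA
  have e : ∀ x, (S.powMeasure n x).map (S.powMk n x) (S.powTuple n ⁻¹' B) =
      S.tupleKernel (n + 1) x B := fun x => by
    rw [Measure.map_apply (S.measurable_powMk n x) (S.measurable_powTuple n hB)]
    exact (Measure.map_apply (S.measurable_tuple x) hB).symm
  have h := (S.tupleKernel (n + 1)).measurable_coe hB
  rw [← funext e] at h
  exact h

theorem GSpace.ae_ae_of_ae_totalPowMeasure (S : GSpace X) (n : ℕ) {P : S.Pow n → Prop}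
    (h : ∀ᵐ p ∂S.totalPowMeasure μ n, P p) :
    ∀ᵐ x ∂μ, ∀ᵐ s ∂S.powMeasure n x, P (S.powMk n x s) :=
  (Measure.ae_ae_of_ae_bind (S.measurable_powMeasure_map n).aemeasurable h).mono fun x hx =>
    ae_of_ae_map (S.measurable_powMk n x).aemeasurable hx

variable {F : GField 𝕜 X} {n : ℕ}

/-- Pairing with the measurable sections of a bundle extends to the pullback of the bundle. -/
theorem isJoint_apply_pullbackSection
    {f : ∀ x, (Fin (n + 1) → S.fiber x) → StrongDual 𝕜 (F.fiber x)}
    (hf : ∀ σ ∈ F.sections, IsJoint μ S (n + 1) fun x s => f x s (σ x))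
    {η : ∀ p : S.Pow n, F.fiber p.1} (hη : IsPullbackSection μ S F n η) :
    IsJoint μ S (n + 1) fun x s => f x s (η ⟨x, s⟩) := by
  induction hη with
  | of ξ h =>
    obtain ⟨σ, hσ, rfl⟩ := h
    exact hf σ hσ
  | add ξ ζ _ _ h1 h2 =>
    refine (h1.add h2).congr (ae_of_all _ fun x => ae_of_all _ fun s => ?_)
    exact map_add _ _ _
  | smul φ hφ ξ _ h1 =>
    obtain ⟨φ', hφ', he⟩ := hφ
    obtain ⟨k, hk, rfl⟩ := StronglyMeasurable.exists_eq_measurable_comp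
      (mY := inferInstanceAs (MeasurableSpace (Fin (n + 1) → Total S.fiber)))
      (f := S.powTuple n) hφ'
    have h2 : IsJoint μ S (n + 1) fun x s => φ ⟨x, s⟩ := by
      refine ⟨fun p => k p.2, hk.comp_measurable measurable_snd, ?_⟩
      exact S.ae_ae_of_ae_totalPowMeasure n he
    refine (h2.mul h1).congr (ae_of_all _ fun x => ae_of_all _ fun s => ?_)
    exact map_smul _ _ _
  | lim ξ ζ _ hl h1 =>
    refine IsJoint.lim h1 ((S.ae_ae_of_ae_totalPowMeasure n hl).mono fun x hx =>
      hx.mono fun s hs => ?_)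
    exact ((f x s).continuous.tendsto _).comp hs

/-- The measurable sections of `L(S^{(n+1)}, E)` are the fields of classes of functions which, paired
with the measurable sections of `F`, have jointly measurable versions. -/
theorem mem_LField_sections_iff (ξ : ∀ x, (LField μ S F n).fiber x) :
    ξ ∈ (LField μ S F n).sections ↔ ∀ σ ∈ F.sections,
      IsJoint μ S (n + 1) fun x s => WLinfPre.fn (WLinf.rep (ξ x)) s (σ x) := by
  constructor
  · intro hξ σ hσ
    have hint : ∀ x, Integrable (fun s => WLinfPre.fn (WLinf.rep (ξ x)) s (σ x))
        (S.powMeasure n x) :=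
      fun x => WLinfPre.integrable_apply _ _
    choose v hv hve using fun x => S.exists_tuple_factor (hint x).1
    have hset : ∀ A, MeasurableSet A → ∀ x, ∫ y in A, v x y ∂S.tupleKernel (n + 1) x =
        ∫ s in S.tuple x ⁻¹' A, WLinfPre.fn (WLinf.rep (ξ x)) s (σ x) ∂S.powMeasure n x := by
      intro A hA x
      change ∫ y in A, v x y ∂(S.tupleMeasure (n + 1) x).map (S.tuple x) = _
      rw [setIntegral_map hA (hv x).aestronglyMeasurable (S.measurable_tuple x).aemeasurable]
      exact integral_congr_ae (ae_restrict_of_ae ((hve x).mono fun s hs => hs.symm))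
    obtain ⟨h, hh, he⟩ := exists_joint_version (π := μ) (S.tupleKernel (n + 1)) v
      (ae_of_all _ fun x => by
        change Integrable (v x) ((S.tupleMeasure (n + 1) x).map (S.tuple x))
        rw [integrable_map_measure (hv x).aestronglyMeasurable (S.measurable_tuple x).aemeasurable]
        exact (hint x).congr (hve x)) (by
      intro A hA
      set η : ∀ p : S.Pow n, F.fiber p.1 := fun p =>
        (A.indicator (fun _ => (1 : 𝕜)) (S.powTuple n p)) • σ p.1 with hη
      have hη1 : IsPullbackSection μ S F n η := by
        refine Generated.smul (fun p => A.indicator (fun _ => (1 : 𝕜)) (S.powTuple n p)) ?_ _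
          (Generated.of _ ⟨σ, hσ, rfl⟩)
        exact ((stronglyMeasurable_const.indicator hA).comp_measurable
          (S.measurable_powTuple n)).aestronglyMeasurable
      have hη2 : ∀ x, MemLp (fun s => η ⟨x, s⟩ : (Fin (n + 1) → S.fiber x) → F.fiber x) 1
          (S.powMeasure n x) := by
        intro x
        have hm : @AEStronglyMeasurable _ (F.fiber x) _ _ _
            (fun s => η ⟨x, s⟩ : (Fin (n + 1) → S.fiber x) → F.fiber x) (S.powMeasure n x) := by
          have h1 : StronglyMeasurable fun s => A.indicator (fun _ => (1 : 𝕜)) (S.tuple x s) :=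
            (stronglyMeasurable_const.indicator hA).comp_measurable (S.measurable_tuple x)
          exact (h1.smul_const (σ x)).aestronglyMeasurable
        refine MemLp.of_bound hm ‖σ x‖ (ae_of_all _ fun s => ?_)
        rw [hη, norm_smul]
        refine mul_le_of_le_one_left (norm_nonneg _) ?_
        refine (norm_indicator_le_norm_self _ _).trans ?_
        simp
      have h := hξ _ (Generated.of _ ⟨η, hη1, ae_of_all _ hη2, rfl⟩)
      refine h.congr (ae_of_all _ fun x => ?_)
      dsimp only
      rw [hset A hA x, ← integral_indicator (S.measurable_tuple x hA)]
      refine integral_congr_ae ?_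
      have e1 : lpField S F n η x = (hη2 x).toLp _ := dif_pos (hη2 x)
      rw [e1]
      filter_upwards [(hη2 x).coeFn_toLp] with s hs
      rw [hs]
      by_cases hsA : S.tuple x s ∈ A
      · have e2 : η ⟨x, s⟩ = σ x := by
          simp only [hη]
          rw [Set.indicator_of_mem (by exact hsA), one_smul]
        rw [e2, Set.indicator_of_mem (by exact hsA)]
      · have e2 : η ⟨x, s⟩ = 0 := by
          simp only [hη]
          rw [Set.indicator_of_notMem (by exact hsA), zero_smul]
        rw [e2, map_zero, Set.indicator_of_notMem (by exact hsA)])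
    refine ⟨h, hh, he.mono fun x hx => ?_⟩
    filter_upwards [hve x, ae_of_ae_map (S.measurable_tuple x).aemeasurable hx] with s h1 h2
    rw [h1, h2]
  · intro h ζ hζ
    induction hζ with
    | of ζ h' =>
      obtain ⟨η, hη, hm, rfl⟩ := h'
      have h1 := isJoint_apply_pullbackSection h hη
      have h2 := h1.aestronglyMeasurable_integral (S.tupleKernel (n + 1)) (S.tupleMeasure (n + 1))
        (fun _ => rfl) fun _ => Measure.AbsolutelyContinuous.rfl
      refine h2.congr (hm.mono fun x hx => integral_congr_ae ?_)
      have e1 : lpField S F n η x = hx.toLp _ := dif_pos hx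
      rw [e1]
      filter_upwards [hx.coeFn_toLp] with s hs
      rw [hs]
    | add ζ ζ' _ _ h1 h2 =>
      exact (h1.add h2).congr (ae_of_all _ fun x => (WLinf.pair_add_right (ξ x) _ _).symm)
    | smul φ hφ ζ _ h1 =>
      exact (hφ.mul h1).congr (ae_of_all _ fun x => (WLinf.pair_smul_right (ξ x) _ _).symm)
    | lim ζ ζ' _ hl h1 =>
      exact aestronglyMeasurable_of_tendsto_ae atTop h1
        (hl.mono fun x hx => WLinf.tendsto_pair (ξ x) hx)

end Joint

/-! ### Alternating sums over the faces of a tuple -/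

section AltSum

variable {𝕜 : Type} [RCLike 𝕜] {Y A : Type*} [AddCommGroup A] [Module 𝕜 A]

variable (𝕜) in
/-- The homogeneous coboundary of a function of `q` variables, `q ≥ 0`. -/
def altSum (q : ℕ) (c : (Fin q → Y) → A) (s : Fin (q + 1) → Y) : A :=
  ∑ i : Fin (q + 1), (-1 : 𝕜) ^ (i : ℕ) • c fun j => s (i.succAbove j)

theorem altSum_altSum (q : ℕ) (c : (Fin q → Y) → A) (s : Fin (q + 1 + 1) → Y) :
    altSum 𝕜 (q + 1) (altSum 𝕜 q c) s = 0 := by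
  simp only [altSum, Finset.smul_sum, smul_smul, ← pow_add]
  rw [← Fintype.sum_prod_type' (f := fun (i : Fin (q + 1 + 1)) (j : Fin (q + 1)) =>
    (-1 : 𝕜) ^ ((i : ℕ) + j) • c fun k => s (i.succAbove (j.succAbove k)))]
  refine Finset.sum_involution (fun p _ => (p.1.succAbove p.2, p.2.predAbove p.1)) ?_ ?_ ?_ ?_
  · rintro ⟨i, j⟩ -
    simp only [Fin.neg_one_pow_succAbove_add_predAbove, Fin.succAbove_succAbove_succAbove_predAbove]
    rw [neg_smul, add_neg_cancel]
  · rintro ⟨i, j⟩ - - h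
    exact Fin.succAbove_ne i j (congrArg Prod.fst h)
  · exact fun _ _ => Finset.mem_univ _
  · rintro ⟨i, j⟩ -
    simp only [Fin.succAbove_succAbove_predAbove, Prod.mk.injEq, true_and]
    exact Fin.predAbove_predAbove_succAbove i j

theorem altSum_apply {V : Type*} [NormedAddCommGroup V] [NormedSpace 𝕜 V] (q : ℕ)
    (c : (Fin q → Y) → StrongDual 𝕜 V) (s : Fin (q + 1) → Y) (v : V) :
    altSum 𝕜 q c s v = altSum 𝕜 q (fun s => c s v) s := by
  simp [altSum, sum_apply]

theorem altSum_add (q : ℕ) (c c' : (Fin q → Y) → A) (s : Fin (q + 1) → Y) :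
    altSum 𝕜 q (c + c') s = altSum 𝕜 q c s + altSum 𝕜 q c' s := by
  simp only [altSum, Pi.add_apply, smul_add, Finset.sum_add_distrib]

theorem altSum_smul (q : ℕ) (a : 𝕜) (c : (Fin q → Y) → A) (s : Fin (q + 1) → Y) :
    altSum 𝕜 q (a • c) s = a • altSum 𝕜 q c s := by
  simp only [altSum, Pi.smul_apply, Finset.smul_sum, smul_comm a]

theorem altSum_cons (q : ℕ) (c : (Fin (q + 1) → Y) → A) (t : Y) (s : Fin (q + 1) → Y) :
    altSum 𝕜 (q + 1) c (Fin.cons t s) =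
      c s - altSum 𝕜 q (fun s' => c (Fin.cons t s')) s := by
  rw [altSum, Fin.sum_univ_succ, altSum, sub_eq_add_neg, ← Finset.sum_neg_distrib]
  congr 1
  · simp
  · refine Finset.sum_congr rfl fun i _ => ?_
    rw [Fin.val_succ, pow_succ, mul_neg_one, neg_smul]
    congr 3
    funext j
    refine Fin.cases ?_ (fun k => ?_) j <;> simp

end AltSum

/-! ### The translates of the measures on the fibres -/

section Push

variable {X : Type u} [MeasurableSpace X] [BorelGroupoid X] (S : GSpace X)

/-- The action of `G` extends to a Borel map on the whole product `G × S`. -/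
theorem GSpace.exists_measurable_act : ∃ T : Arrows X × Total S.fiber → Total S.fiber,
    Measurable T ∧ ∀ {x y : X} (g : x ⟶ y) (s : S.fiber x),
      T (arrow g, Total.mk x s) = Total.mk y (S.act g s) := by
  rcases isEmpty_or_nonempty (Total S.fiber) with h | h
  · exact ⟨fun p => p.2, measurable_snd, fun {x y} g s => (h.false (Total.mk x s)).elim⟩
  · obtain ⟨T, hT, he⟩ := Measurable.exists_eq_measurable_comp S.measurable_act
    exact ⟨T, hT, fun {x y} g s => (congrFun he ⟨x, y, g, s⟩).symm⟩

/-- The translate `g_* τ^{s(g)}`, a probability measure on `S^{t(g)}`. -/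
def GSpace.push {x : X} (g : ArrowsTo X x) : Measure (S.fiber x) := (S.τ g.1).map (S.act g.2)

theorem GSpace.measurable_act' {x y : X} (g : x ⟶ y) : Measurable (S.act g) :=
  (S.quasiMeasurePreserving_act g).measurable

instance {x : X} (g : ArrowsTo X x) : IsProbabilityMeasure (S.push g) :=
  Measure.isProbabilityMeasure_map (S.measurable_act' g.2).aemeasurable

theorem GSpace.push_absolutelyContinuous {x : X} (g : ArrowsTo X x) : S.push g ≪ S.τ x :=
  (S.quasiInvariant g.2).1

theorem GSpace.push_leftMul {x y : X} (g : x ⟶ y) (h : ArrowsTo X x) :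
    S.push (leftMul g h) = (S.push h).map (S.act g) := by
  rw [GSpace.push, GSpace.push, Measure.map_map (S.measurable_act' g) (S.measurable_act' h.2)]
  congr 1
  funext s
  exact S.act_comp h.2 g s

/-- The kernel `x ↦ τ^x`, viewed on the total space. -/
def GSpace.fiberKernel : ProbabilityTheory.Kernel X (Total S.fiber) :=
  ⟨fun x => (S.τ x).map (Total.mk x), measurable_map_mk S.measurable_mk S.measurable_τ⟩

instance : ProbabilityTheory.IsMarkovKernel S.fiberKernel :=
  ⟨fun x => Measure.isProbabilityMeasure_map (S.measurable_mk x).aemeasurable⟩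

theorem GSpace.isMeasurableFamily_push (γ : BorelSection X) :
    IsMeasurableFamily fun x => S.push (γ x) := by
  intro A hA
  obtain ⟨T, hT, he⟩ := S.exists_measurable_act
  have hB : MeasurableSet {p : X × Total S.fiber | T (Total.mk p.1 (γ p.1), p.2) ∈ A} :=
    hT.comp ((γ.measurable.comp measurable_fst).prodMk measurable_snd) hA
  have h := ProbabilityTheory.Kernel.measurable_kernel_prodMk_left
    (κ := S.fiberKernel.comap (fun x => (γ x).1) γ.measurable_source) hB
  convert h using 2 with x
  have e : S.fiberKernel.comap (fun x => (γ x).1) γ.measurable_source x =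
      (S.τ (γ x).1).map (Total.mk (γ x).1) := rfl
  change (S.τ (γ x).1).map (S.act (γ x).2) (Total.mk x ⁻¹' A) = _
  rw [e, Measure.map_apply (S.measurable_act' _) (S.measurable_mk x hA),
    Measure.map_apply (S.measurable_mk _) (measurable_prodMk_left hB)]
  congr 1
  ext t
  change Total.mk x (S.act (γ x).2 t) ∈ A ↔ T (Total.mk x (γ x), Total.mk (γ x).1 t) ∈ A
  rw [← he]
  rfl

end Push

/-! ### The bundles of functions of `q ≥ 0` variables -/

section TupleBundle

variable {𝕜 : Type} [RCLike 𝕜] {X : Type u} [MeasurableSpace X] [BorelGroupoid X] {μ : Measure X}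
  {S : GSpace X} {F : GField 𝕜 X} {q : ℕ}

/-- The diagonal action on the fibres of the `q`-th fibred power. -/
def GSpace.actTuple (S : GSpace X) (q : ℕ) {x y : X} (g : x ⟶ y) (s : Fin q → S.fiber x)
    (i : Fin q) : S.fiber y :=
  S.act g (s i)

theorem GSpace.quasiMeasurePreserving_actTuple (S : GSpace X) (q : ℕ) {x y : X} (g : x ⟶ y) :
    Measure.QuasiMeasurePreserving (S.actTuple q g) (S.tupleMeasure q x) (S.tupleMeasure q y) :=
  quasiMeasurePreserving_pi _ _ (S.quasiMeasurePreserving_act g) q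

/-- The action of an arrow on classes of functions of `q` variables. -/
def actTupleWLinf (S : GSpace X) (F : GField 𝕜 X) (q : ℕ) {x y : X} (g : x ⟶ y) :
    WLinf 𝕜 (S.tupleMeasure q x) (F.fiber x) →L[𝕜] WLinf 𝕜 (S.tupleMeasure q y) (F.fiber y) :=
  WLinf.pull (S.actTuple q (Groupoid.inv g)) (S.quasiMeasurePreserving_actTuple q (Groupoid.inv g))
    (F.actL (Groupoid.inv g))

theorem actTupleWLinf_id (x : X) (u : WLinf 𝕜 (S.tupleMeasure q x) (F.fiber x)) :
    actTupleWLinf S F q (𝟙 x) u = u := by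
  refine (WLinf.pull_congr _ (Measure.QuasiMeasurePreserving.id _) ?_ ?_ u).trans
    (WLinf.pull_id u)
  · funext s i
    change S.act (Groupoid.inv (𝟙 x)) (s i) = s i
    rw [inv_unit, S.act_id]
  · ext v
    change F.act (Groupoid.inv (𝟙 x)) v = v
    rw [inv_unit, F.act_id]

theorem actTupleWLinf_comp {x y z : X} (h : x ⟶ y) (g : y ⟶ z)
    (u : WLinf 𝕜 (S.tupleMeasure q x) (F.fiber x)) :
    actTupleWLinf S F q (h ≫ g) u = actTupleWLinf S F q g (actTupleWLinf S F q h u) := by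
  refine Eq.trans ?_ (WLinf.pull_pull _ _ _ _ _ _ u).symm
  refine WLinf.pull_congr _ _ ?_ ?_ u
  · funext s i
    change S.act (Groupoid.inv (h ≫ g)) (s i) =
      S.act (Groupoid.inv h) (S.act (Groupoid.inv g) (s i))
    rw [inv_comp_rev, S.act_comp]
  · ext v
    change F.act (Groupoid.inv (h ≫ g)) v = F.act (Groupoid.inv h) (F.act (Groupoid.inv g) v)
    rw [inv_comp_rev, F.act_comp]

theorem norm_actTupleWLinf_le {x y : X} (g : x ⟶ y)
    (u : WLinf 𝕜 (S.tupleMeasure q x) (F.fiber x)) : ‖actTupleWLinf S F q g u‖ ≤ ‖u‖ :=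
  (WLinf.norm_pull_le _ _ _ u).trans
    (mul_le_of_le_one_left (norm_nonneg u) (F.norm_actL_le _))

/-- The bundle of classes of functions `(S^x)^q → E_x`, for `q ≥ 0` and `E` the dual of `F`. For
`q = 0` this is a copy of `E`, and for `q = n + 1` it is `L(S^{(n+1)}, E)`; the measurable sections
are described through jointly measurable functions. -/
def tupleBundle (μ : Measure X) (S : GSpace X) (F : GField 𝕜 X) (q : ℕ) : GField 𝕜 X where
  fiber x := WLinf 𝕜 (S.tupleMeasure q x) (F.fiber x)
  sections :=
    { carrier := {ξ | ∀ σ ∈ F.sections,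
        IsJoint μ S q fun x s => WLinfPre.fn (WLinf.rep (ξ x)) s (σ x)}
      zero_mem' := fun σ _ => by
        refine (IsJoint.of_base (φ := fun _ => (0 : 𝕜)) aestronglyMeasurable_const).congr
          (ae_of_all _ fun x => ?_)
        filter_upwards [WLinf.rep_zero_ae (𝕜 := 𝕜) (V := F.fiber x) (m := S.tupleMeasure q x)]
          with s hs
        exact congrArg (fun θ : StrongDual 𝕜 (F.fiber x) => θ (σ x)) hs
      add_mem' := fun {a b} h1 h2 σ hσ => by
        refine ((h1 σ hσ).add (h2 σ hσ)).congr (ae_of_all _ fun x => ?_)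
        filter_upwards [WLinf.rep_add_ae (a x) (b x)] with s hs
        exact congrArg (fun θ : StrongDual 𝕜 (F.fiber x) => θ (σ x)) hs
      smul_mem' := fun c a h σ hσ => by
        refine ((h σ hσ).const_mul c).congr (ae_of_all _ fun x => ?_)
        filter_upwards [WLinf.rep_smul_ae c (a x)] with s hs
        exact congrArg (fun θ : StrongDual 𝕜 (F.fiber x) => θ (σ x)) hs }
  act {x y} g :=
    { toLinearMap := (actTupleWLinf S F q g).toLinearMap
      norm_map' := fun u => by
        refine le_antisymm (norm_actTupleWLinf_le g u) ?_
        have h := norm_actTupleWLinf_le (Groupoid.inv g) (actTupleWLinf S F q g u)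
        rwa [← actTupleWLinf_comp, Groupoid.comp_inv, actTupleWLinf_id] at h }
  act_id x u := actTupleWLinf_id x u
  act_comp h g u := actTupleWLinf_comp h g u

theorem mem_tupleBundle_sections {ξ : ∀ x, (tupleBundle μ S F q).fiber x} :
    ξ ∈ (tupleBundle μ S F q).sections ↔ ∀ σ ∈ F.sections,
      IsJoint μ S q fun x s => WLinfPre.fn (WLinf.rep (ξ x)) s (σ x) := Iff.rfl

theorem tupleBundle_sections_succ (n : ℕ) :
    (tupleBundle μ S F (n + 1)).sections = (LField μ S F n).sections :=
  Submodule.ext fun ξ => (mem_LField_sections_iff ξ).symm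

theorem tupleBundle_rep_act_ae {x y : X} (g : x ⟶ y) (u : (tupleBundle μ S F q).fiber x) :
    ∀ᵐ s ∂S.tupleMeasure q y, (WLinf.rep ((tupleBundle μ S F q).act g u)).fn s =
      ((WLinf.rep u).fn (S.actTuple q (Groupoid.inv g) s)).comp (F.actL (Groupoid.inv g)) :=
  WLinf.rep_pull_ae _ _ _ u

/-- Two fields of classes are equal in a fibre as soon as they agree when paired with vectors. -/
theorem tupleBundle_ext {x : X} [TopologicalSpace.SeparableSpace (F.fiber x)]
    {u u' : WLinf 𝕜 (S.tupleMeasure q x) (F.fiber x)}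
    (h : ∀ v, ∀ᵐ s ∂S.tupleMeasure q x, u.rep.fn s v = u'.rep.fn s v) : u = u' :=
  WLinf.ext_rep (ae_eq_of_forall_apply h)

/-- Weak-* measurability can be tested on a dense sequence of vectors. -/
theorem mem_weakStarBounded_of_denseRange {V : Type u} [NormedAddCommGroup V] [NormedSpace 𝕜 V]
    {Y : Type u} [MeasurableSpace Y] {m : Measure Y} {f : Y → StrongDual 𝕜 V} {w : ℕ → V}
    (hw : DenseRange w) (h : ∀ n, AEStronglyMeasurable (fun y => f y (w n)) m) {C : ℝ}
    (hC : ∀ᵐ y ∂m, ‖f y‖ ≤ C) : f ∈ weakStarBounded 𝕜 m V := by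
  refine ⟨fun v => ?_, C, hC⟩
  obtain ⟨w', hw', hlim⟩ := mem_closure_iff_seq_limit.1 (hw v)
  choose k hk using hw'
  refine aestronglyMeasurable_of_tendsto_ae atTop (fun n => h (k n)) (ae_of_all _ fun y => ?_)
  refine (((f y).continuous.tendsto v).comp hlim).congr fun n => ?_
  simp [hk]

/-! ### The coboundary in the `S`-variables -/

theorem quasiMeasurePreserving_omit (S : GSpace X) (q : ℕ) (i : Fin (q + 1)) (x : X) :
    Measure.QuasiMeasurePreserving (fun (s : Fin (q + 1) → S.fiber x) j => s (i.succAbove j))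
      (S.tupleMeasure (q + 1) x) (S.tupleMeasure q x) :=
  Measure.quasiMeasurePreserving_snd.comp
    (measurePreserving_piFinSuccAbove (fun _ : Fin (q + 1) => S.τ x) i).quasiMeasurePreserving

/-- The homogeneous coboundary, from functions of `q ≥ 0` variables to functions of `q + 1`
variables; for `q = 0` it is the inclusion of the constant functions. -/
def tupleCoboundary (S : GSpace X) (F : GField 𝕜 X) (q : ℕ) (x : X) :
    WLinf 𝕜 (S.tupleMeasure q x) (F.fiber x) →L[𝕜] WLinf 𝕜 (S.tupleMeasure (q + 1) x) (F.fiber x) :=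
  ∑ i : Fin (q + 1), (-1 : 𝕜) ^ (i : ℕ) •
    WLinf.pull _ (quasiMeasurePreserving_omit S q i x) (ContinuousLinearMap.id 𝕜 (F.fiber x))

theorem WLinf.rep_sum_ae {Y V : Type u} [MeasurableSpace Y] {m : Measure Y}
    [NormedAddCommGroup V] [NormedSpace 𝕜 V] {ι : Type*} (I : Finset ι) (u : ι → WLinf 𝕜 m V) :
    (∑ i ∈ I, u i).rep.fn =ᵐ[m] fun y => ∑ i ∈ I, (u i).rep.fn y := by
  classical
  induction I using Finset.induction_on with
  | empty =>
    rw [Finset.sum_empty]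
    exact WLinf.rep_zero_ae (𝕜 := 𝕜) (V := V) (m := m)
  | insert a I ha ih =>
    rw [Finset.sum_insert ha]
    filter_upwards [WLinf.rep_add_ae (u a) (∑ i ∈ I, u i), ih] with y h1 h2
    rw [h1, Pi.add_apply, h2, Finset.sum_insert ha]

theorem rep_tupleCoboundary_ae (x : X) (u : WLinf 𝕜 (S.tupleMeasure q x) (F.fiber x)) :
    ∀ᵐ s ∂S.tupleMeasure (q + 1) x,
      (tupleCoboundary S F q x u).rep.fn s = altSum 𝕜 q u.rep.fn s := by
  have e : tupleCoboundary S F q x u = ∑ i : Fin (q + 1), (-1 : 𝕜) ^ (i : ℕ) •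
      WLinf.pull _ (quasiMeasurePreserving_omit S q i x)
        (ContinuousLinearMap.id 𝕜 (F.fiber x)) u := by
    simp [tupleCoboundary, sum_apply]
  rw [e]
  have h1 := fun i : Fin (q + 1) => WLinf.rep_smul_ae ((-1 : 𝕜) ^ (i : ℕ))
    (WLinf.pull _ (quasiMeasurePreserving_omit S q i x) (ContinuousLinearMap.id 𝕜 (F.fiber x)) u)
  have h2 := fun i : Fin (q + 1) => WLinf.rep_pull_ae _ (quasiMeasurePreserving_omit S q i x)
    (ContinuousLinearMap.id 𝕜 (F.fiber x)) u
  filter_upwards [WLinf.rep_sum_ae Finset.univ fun i : Fin (q + 1) => (-1 : 𝕜) ^ (i : ℕ) •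
    WLinf.pull _ (quasiMeasurePreserving_omit S q i x) (ContinuousLinearMap.id 𝕜 (F.fiber x)) u,
    ae_all_iff.2 h1, ae_all_iff.2 h2] with s h3 h4 h5
  rw [h3, altSum]
  refine Finset.sum_congr rfl fun i _ => ?_
  rw [h4, Pi.smul_apply, h5]
  rfl

theorem ae_altSum_congr {x : X} {A : Type*} [AddCommGroup A] [Module 𝕜 A]
    {c c' : (Fin q → S.fiber x) → A} (h : ∀ᵐ s ∂S.tupleMeasure q x, c s = c' s) :
    ∀ᵐ s ∂S.tupleMeasure (q + 1) x, altSum 𝕜 q c s = altSum 𝕜 q c' s := by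
  filter_upwards [ae_all_iff.2 fun i => (quasiMeasurePreserving_omit S q i x).ae h] with s hs
  exact Finset.sum_congr rfl fun i _ => by rw [hs i]

theorem tupleCoboundary_tupleCoboundary (x : X) (u : WLinf 𝕜 (S.tupleMeasure q x) (F.fiber x)) :
    tupleCoboundary S F (q + 1) x (tupleCoboundary S F q x u) = 0 := by
  refine WLinf.ext_rep ?_
  filter_upwards [rep_tupleCoboundary_ae x (tupleCoboundary S F q x u),
    WLinf.rep_zero_ae (𝕜 := 𝕜) (V := F.fiber x) (m := S.tupleMeasure (q + 1 + 1) x),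
    ae_altSum_congr (𝕜 := 𝕜) (rep_tupleCoboundary_ae x u)] with s h1 h2 h3
  rw [h1, h2, h3, altSum_altSum]
  rfl

variable (M : MeasuredGroupoid X μ)

theorem norm_tupleCoboundary_le (x : X) : ‖tupleCoboundary S F q x‖ ≤ q + 1 := by
  refine (norm_sum_le _ _).trans ?_
  refine (Finset.sum_le_card_nsmul _ _ 1 fun i _ => ?_).trans (by simp)
  rw [norm_smul, norm_pow, norm_neg, norm_one, one_pow, one_mul]
  refine ContinuousLinearMap.opNorm_le_bound _ zero_le_one fun u => ?_
  exact (WLinf.norm_pull_le _ _ _ u).trans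
    (mul_le_mul_of_nonneg_right ContinuousLinearMap.norm_id_le (norm_nonneg u))

theorem tupleCoboundary_act {x y : X} (g : x ⟶ y) (u : (tupleBundle μ S F q).fiber x) :
    tupleCoboundary S F q y ((tupleBundle μ S F q).act g u) =
      (tupleBundle μ S F (q + 1)).act g (tupleCoboundary S F q x u) := by
  refine WLinf.ext_rep ?_
  filter_upwards [rep_tupleCoboundary_ae y ((tupleBundle μ S F q).act g u),
    tupleBundle_rep_act_ae (μ := μ) g (tupleCoboundary S F q x u),
    ae_altSum_congr (𝕜 := 𝕜) (tupleBundle_rep_act_ae g u),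
    (S.quasiMeasurePreserving_actTuple (q + 1) (Groupoid.inv g)).ae (rep_tupleCoboundary_ae x u)]
    with s h1 h2 h3 h4
  refine (h1.trans h3).trans (Eq.trans ?_ h2.symm)
  rw [h4]
  ext v
  simp [altSum, sum_apply]
  rfl

/-- The coboundary as a morphism of bundles. -/
def tupleCoboundaryHom (S : GSpace X) (F : GField 𝕜 X) (q : ℕ) :
    GMorphism M (tupleBundle μ S F q) (tupleBundle μ S F (q + 1)) where
  toFun := tupleCoboundary S F q
  measurable ξ hξ σ hσ := by
    have h := IsJoint.sum Finset.univ (fun (i : Fin (q + 1)) _ =>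
      ((hξ σ hσ).comp_face i).const_mul ((-1 : 𝕜) ^ (i : ℕ)))
    refine h.congr (ae_of_all _ fun x => ?_)
    filter_upwards [rep_tupleCoboundary_ae x (ξ x)] with s hs
    exact (congrArg (fun θ : StrongDual 𝕜 (F.fiber x) => θ (σ x)) hs).trans
      (altSum_apply q _ s (σ x))
  bounded := ⟨q + 1, ae_of_all _ norm_tupleCoboundary_le⟩
  equivariant := ae_of_all _ fun a u => tupleCoboundary_act a.2.2 u

/-! ### Integration of the first variable -/

/-- `u'` is obtained from `u` by integrating the first variable against `l`. -/
def IsFirstIntegral {x : X} (l : Measure (S.fiber x))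
    (u : WLinf 𝕜 (S.tupleMeasure (q + 1) x) (F.fiber x))
    (u' : WLinf 𝕜 (S.tupleMeasure q x) (F.fiber x)) : Prop :=
  ∀ v, ∀ᵐ s ∂S.tupleMeasure q x, u'.rep.fn s v = ∫ t, u.rep.fn (Fin.cons t s) v ∂l

theorem IsFirstIntegral.unique {x : X} [TopologicalSpace.SeparableSpace (F.fiber x)]
    {l : Measure (S.fiber x)} {u : WLinf 𝕜 (S.tupleMeasure (q + 1) x) (F.fiber x)}
    {u' u'' : WLinf 𝕜 (S.tupleMeasure q x) (F.fiber x)} (h' : IsFirstIntegral l u u')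
    (h'' : IsFirstIntegral l u u'') : u' = u'' :=
  tupleBundle_ext fun v => by
    filter_upwards [h' v, h'' v] with s h1 h2
    rw [h1, h2]

theorem ae_ae_cons_of_absolutelyContinuous {x : X} {l : Measure (S.fiber x)} (hl : l ≪ S.τ x)
    {P : (Fin (q + 1) → S.fiber x) → Prop} (h : ∀ᵐ s ∂S.tupleMeasure (q + 1) x, P s) :
    ∀ᵐ s ∂S.tupleMeasure q x, ∀ᵐ t ∂l, P (Fin.cons t s) :=
  (ae_ae_cons' _ h).mono fun _ hs => hl.ae_le hs

theorem ae_aestronglyMeasurable_cons {x : X} {l : Measure (S.fiber x)} (hl : l ≪ S.τ x)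
    {f : (Fin (q + 1) → S.fiber x) → 𝕜} (hf : AEStronglyMeasurable f (S.tupleMeasure (q + 1) x)) :
    ∀ᵐ s ∂S.tupleMeasure q x, AEStronglyMeasurable (fun t => f (Fin.cons t s)) l := by
  obtain ⟨f', hf', he⟩ := hf
  filter_upwards [ae_ae_cons_of_absolutelyContinuous hl he] with s hs
  refine ⟨fun t => f' (Fin.cons t s), hf'.comp_measurable ?_, hs⟩
  refine measurable_pi_lambda _ fun i => ?_
  refine Fin.cases ?_ (fun j => ?_) i
  · exact measurable_id
  · exact measurable_const

theorem exists_isFirstIntegral {x : X} [TopologicalSpace.SeparableSpace (F.fiber x)]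
    {l : Measure (S.fiber x)} [IsProbabilityMeasure l] (hl : l ≪ S.τ x)
    (u : WLinf 𝕜 (S.tupleMeasure (q + 1) x) (F.fiber x)) :
    ∃ u' : WLinf 𝕜 (S.tupleMeasure q x) (F.fiber x), ‖u'‖ ≤ ‖u‖ ∧ IsFirstIntegral l u u' := by
  have hmem : ∀ᵐ s ∂S.tupleMeasure q x,
      (fun t => u.rep.fn (Fin.cons t s)) ∈ weakStarBounded 𝕜 l (F.fiber x) := by
    have h1 : ∀ n, ∀ᵐ s ∂S.tupleMeasure q x, AEStronglyMeasurable (fun t =>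
        u.rep.fn (Fin.cons t s) (TopologicalSpace.denseSeq (F.fiber x) n)) l := fun n =>
      ae_aestronglyMeasurable_cons hl (u.rep.meas _)
    filter_upwards [ae_all_iff.2 h1, ae_ae_cons_of_absolutelyContinuous hl u.ae_norm_rep_le]
      with s h2 h3
    exact mem_weakStarBounded_of_denseRange (TopologicalSpace.denseRange_denseSeq _) h2 h3
  have happ : ∀ v, ∀ᵐ s ∂S.tupleMeasure q x,
      weakIntegral 𝕜 l (fun t => u.rep.fn (Fin.cons t s)) v = ∫ t, u.rep.fn (Fin.cons t s) v ∂l :=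
    fun v => hmem.mono fun s hs => weakIntegral_apply hs v
  have hnorm : ∀ᵐ s ∂S.tupleMeasure q x,
      ‖weakIntegral 𝕜 l (fun t => u.rep.fn (Fin.cons t s))‖ ≤ ‖u‖ := by
    filter_upwards [ae_ae_cons_of_absolutelyContinuous hl u.ae_norm_rep_le] with s hs
    exact norm_weakIntegral_le (norm_nonneg u) hs
  have hf : (fun s => weakIntegral 𝕜 l (fun t => u.rep.fn (Fin.cons t s))) ∈
      weakStarBounded 𝕜 (S.tupleMeasure q x) (F.fiber x) := by
    refine ⟨fun v => ?_, ‖u‖, hnorm⟩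
    refine AEStronglyMeasurable.congr ?_ ((happ v).mono fun s hs => hs.symm)
    have h1 := (u.rep.meas v).comp_quasiMeasurePreserving
      (measurePreserving_cons (S.τ x) q).quasiMeasurePreserving
    have h2 : Measure.QuasiMeasurePreserving
        (fun p : (Fin q → S.fiber x) × S.fiber x => (p.2, p.1))
        ((S.tupleMeasure q x).prod l) ((S.τ x).prod (S.tupleMeasure q x)) := by
      have := Measure.measurePreserving_swap (μ := S.tupleMeasure q x) (ν := S.τ x)
      exact this.quasiMeasurePreserving.mono_left
        (Measure.AbsolutelyContinuous.rfl.prod hl)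
    exact (h1.comp_quasiMeasurePreserving h2).integral_prod_right'
  set p : WLinfPre 𝕜 (S.tupleMeasure q x) (F.fiber x) := ⟨_, hf⟩
  refine ⟨WLinf.mk _ p, ?_, fun v => ?_⟩
  · rw [WLinf.norm_mk]
    exact WLinfPre.norm_le _ (norm_nonneg u) hnorm
  · filter_upwards [WLinf.rep_mk_ae p, happ v] with s h1 h2
    rw [h1, ← h2]
    rfl

/-- Integration of the first variable is a contracting homotopy. -/
theorem IsFirstIntegral.tupleCoboundary_eq {x : X} [TopologicalSpace.SeparableSpace (F.fiber x)]
    {l : Measure (S.fiber x)} [IsProbabilityMeasure l] (hl : l ≪ S.τ x)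
    {u : WLinf 𝕜 (S.tupleMeasure (q + 1) x) (F.fiber x)}
    {u' : WLinf 𝕜 (S.tupleMeasure q x) (F.fiber x)} (h : IsFirstIntegral l u u')
    (hu : tupleCoboundary S F (q + 1) x u = 0) : tupleCoboundary S F q x u' = u := by
  refine tupleBundle_ext fun v => ?_
  have h0 : ∀ᵐ s ∂S.tupleMeasure (q + 1 + 1) x, altSum 𝕜 (q + 1) u.rep.fn s = 0 := by
    have h2 := rep_tupleCoboundary_ae x u
    rw [hu] at h2
    filter_upwards [h2, WLinf.rep_zero_ae (𝕜 := 𝕜) (V := F.fiber x)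
      (m := S.tupleMeasure (q + 1 + 1) x)] with s h3 h4
    rw [← h3, h4]; rfl
  have hint : ∀ᵐ s ∂S.tupleMeasure (q + 1) x, ∀ i : Fin (q + 1),
      Integrable (fun t => u.rep.fn (Fin.cons t fun j => s (i.succAbove j)) v) l := by
    refine ae_all_iff.2 fun i => (quasiMeasurePreserving_omit S q i x).ae
      (p := fun s => Integrable (fun t => u.rep.fn (Fin.cons t s) v) l) ?_
    filter_upwards [ae_aestronglyMeasurable_cons hl (u.rep.meas v),
      ae_ae_cons_of_absolutelyContinuous hl u.ae_norm_rep_le] with s h1 h2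
    refine Integrable.of_bound h1 (‖u‖ * ‖v‖) (h2.mono fun t ht => ?_)
    exact (ContinuousLinearMap.le_opNorm _ _).trans (by gcongr)
  filter_upwards [rep_tupleCoboundary_ae x u', ae_ae_cons_of_absolutelyContinuous hl h0,
    ae_altSum_congr (𝕜 := 𝕜) (h v), hint] with s h1 h2 h3 h4
  rw [h1, altSum_apply, h3]
  have h5 : ∀ᵐ t ∂l, altSum 𝕜 q (fun s' => u.rep.fn (Fin.cons t s') v) s = u.rep.fn s v := by
    filter_upwards [h2] with t ht
    rw [altSum_cons, sub_eq_zero] at ht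
    rw [ht, altSum_apply]
  have h6 : ∫ t, altSum 𝕜 q (fun s' => u.rep.fn (Fin.cons t s') v) s ∂l = u.rep.fn s v := by
    rw [integral_congr_ae h5]; simp
  rw [← h6]
  simp only [altSum]
  refine Eq.trans ?_ (integral_finsetSum (μ := l) Finset.univ (f := fun (i : Fin (q + 1)) t =>
    (-1 : 𝕜) ^ (i : ℕ) • u.rep.fn (Fin.cons t fun j => s (i.succAbove j)) v)
    fun i _ => (h4 i).smul ((-1 : 𝕜) ^ (i : ℕ))).symm
  exact Finset.sum_congr rfl fun i _ => (integral_smul _ _).symm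

/-- On functions of no variables the coboundary is injective. -/
theorem tupleCoboundary_injective (x : X) {u : WLinf 𝕜 (S.tupleMeasure 0 x) (F.fiber x)}
    (hu : tupleCoboundary S F 0 x u = 0) : u = 0 := by
  refine WLinf.ext_rep ?_
  have h2 := rep_tupleCoboundary_ae x u
  rw [hu] at h2
  have h3 : ∀ᵐ s ∂S.tupleMeasure 1 x, u.rep.fn (fun i => i.elim0) = 0 := by
    filter_upwards [h2, WLinf.rep_zero_ae (𝕜 := 𝕜) (V := F.fiber x)
      (m := S.tupleMeasure (0 + 1) x)] with s h3 h4
    refine Eq.trans ?_ (h3.symm.trans h4)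
    rw [altSum, Fin.sum_univ_one, Fin.val_zero, pow_zero, one_smul]
    congr 1
    funext i; exact i.elim0
  obtain ⟨_, h4⟩ := h3.exists
  filter_upwards [WLinf.rep_zero_ae (𝕜 := 𝕜) (V := F.fiber x) (m := S.tupleMeasure 0 x)]
    with s hs
  refine Eq.trans ?_ (h4.trans hs.symm)
  congr 1
  funext i; exact i.elim0

/-- Integration of the first variable commutes with the action. -/
theorem IsFirstIntegral.act {x y : X} (g : x ⟶ y) {l : Measure (S.fiber x)} (hl : l ≪ S.τ x)
    {u : (tupleBundle μ S F (q + 1)).fiber x} {u' : (tupleBundle μ S F q).fiber x}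
    (h : IsFirstIntegral l u u') :
    IsFirstIntegral (l.map (S.act g)) ((tupleBundle μ S F (q + 1)).act g u)
      ((tupleBundle μ S F q).act g u') := by
  intro v
  have hac : l.map (S.act g) ≪ S.τ y := (hl.map (S.measurable_act' g)).trans (S.quasiInvariant g).1
  filter_upwards [tupleBundle_rep_act_ae (μ := μ) g u',
    (S.quasiMeasurePreserving_actTuple q (Groupoid.inv g)).ae (h (F.actL (Groupoid.inv g) v)),
    ae_ae_cons_of_absolutelyContinuous hac (tupleBundle_rep_act_ae (μ := μ) g u),
    ae_aestronglyMeasurable_cons hac (((WLinf.rep ((tupleBundle μ S F (q + 1)).act g u))).meas v)]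
    with s h1 h2 h3 h4
  have e : (WLinf.rep ((tupleBundle μ S F q).act g u')).fn s v =
    ∫ t, (WLinf.rep u).fn (Fin.cons t (S.actTuple q (Groupoid.inv g) s))
      (F.actL (Groupoid.inv g) v) ∂l := by
    rw [h1, ← h2]; rfl
  rw [e, integral_map (S.measurable_act' g).aemeasurable h4]
  refine integral_congr_ae ?_
  filter_upwards [ae_of_ae_map (S.measurable_act' g).aemeasurable h3] with t ht
  rw [ht]
  have e2 : S.actTuple (q + 1) (Groupoid.inv g) (Fin.cons (S.act g t) s) =
      Fin.cons t (S.actTuple q (Groupoid.inv g) s) := by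
    funext i
    refine Fin.cases ?_ (fun j => ?_) i
    · change S.act (Groupoid.inv g) (S.act g t) = t
      rw [← S.act_comp, Groupoid.comp_inv, S.act_id]
    · rfl
  rw [e2]
  rfl

end TupleBundle

/-! ### Invariant cochains on the groupoid -/

section Cochains

variable {𝕜 : Type} [RCLike 𝕜] {X : Type u} [MeasurableSpace X] [BorelGroupoid X] {μ : Measure X}
  {V V' V'' : GField 𝕜 X} {p : ℕ}

variable (μ) in
/-- The bounded measurable invariant functions of `p ≥ 0` arrows with a common target `x` and with
values in `V_x`. As `G` has countably many arrows over each point, all of which lie on Borel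
sections, measurability is tested on the tuples of Borel sections. -/
def cochains (V : GField 𝕜 X) (p : ℕ) : Submodule 𝕜 (∀ x, (Fin p → ArrowsTo X x) → V.fiber x) where
  carrier := {f | (∀ δ : Fin p → BorelSection X, (fun x => f x fun i => δ i x) ∈ V.sections) ∧
    (∃ C : ℝ, ∀ᵐ x ∂μ, ∀ h, ‖f x h‖ ≤ C) ∧
    ∀ᵐ x ∂μ, ∀ (g : ArrowsTo X x) (h : Fin p → ArrowsTo X g.1),
      V.act g.2 (f g.1 h) = f x fun i => leftMul g.2 (h i)}
  zero_mem' := ⟨fun _ => V.sections.zero_mem, ⟨0, ae_of_all _ fun _ _ => by simp⟩,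
    ae_of_all _ fun _ _ _ => by simp⟩
  add_mem' := by
    rintro a b ⟨ha, ⟨C, hC⟩, ia⟩ ⟨hb, ⟨D, hD⟩, ib⟩
    refine ⟨fun δ => V.sections.add_mem (ha δ) (hb δ), ⟨C + D, ?_⟩, ?_⟩
    · filter_upwards [hC, hD] with x h1 h2 h
      exact (norm_add_le _ _).trans (add_le_add (h1 h) (h2 h))
    · filter_upwards [ia, ib] with x h1 h2 g h
      simp only [Pi.add_apply, map_add, h1, h2]
  smul_mem' := by
    rintro c a ⟨ha, ⟨C, hC⟩, ia⟩
    refine ⟨fun δ => V.sections.smul_mem c (ha δ), ⟨‖c‖ * C, ?_⟩, ?_⟩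
    · filter_upwards [hC] with x h1 h
      exact (norm_smul_le _ _).trans (mul_le_mul_of_nonneg_left (h1 h) (norm_nonneg c))
    · filter_upwards [ia] with x h1 g h
      simp only [Pi.smul_apply, map_smul, h1]

variable (μ) in
/-- The functions which vanish over almost every point. -/
def nullCochains (V : GField 𝕜 X) (p : ℕ) :
    Submodule 𝕜 (∀ x, (Fin p → ArrowsTo X x) → V.fiber x) where
  carrier := {f | ∀ᵐ x ∂μ, ∀ h, f x h = 0}
  zero_mem' := ae_of_all _ fun _ _ => rfl
  add_mem' := by
    rintro a b ha hb
    filter_upwards [show ∀ᵐ x ∂μ, ∀ h, a x h = 0 from ha, show ∀ᵐ x ∂μ, ∀ h, b x h = 0 from hb]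
      with x h1 h2 h
    simp only [Pi.add_apply, h1, h2, add_zero]
  smul_mem' := by
    rintro c a ha
    filter_upwards [show ∀ᵐ x ∂μ, ∀ h, a x h = 0 from ha] with x h1 h
    simp only [Pi.smul_apply, h1, smul_zero]

variable (μ) in
/-- Invariant cochains modulo almost everywhere equality. -/
abbrev Cochain (V : GField 𝕜 X) (p : ℕ) : Type u :=
  cochains μ V p ⧸ (nullCochains μ V p).submoduleOf (cochains μ V p)

/-- The class of an invariant cochain. -/
def Cochain.mk (f : cochains μ V p) : Cochain μ V p := Submodule.Quotient.mk f

theorem Cochain.mk_surjective : Function.Surjective (Cochain.mk (μ := μ) (V := V) (p := p)) :=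
  Submodule.Quotient.mk_surjective _

theorem Cochain.mk_eq_mk {f f' : cochains μ V p} :
    Cochain.mk f = Cochain.mk f' ↔ ∀ᵐ x ∂μ, ∀ h, f.1 x h = f'.1 x h := by
  rw [Cochain.mk, Cochain.mk, Submodule.Quotient.eq]
  constructor
  · intro h
    filter_upwards [show ∀ᵐ x ∂μ, ∀ h, (f.1 - f'.1) x h = 0 from h] with x hx h
    exact sub_eq_zero.1 (hx h)
  · intro h
    change ∀ᵐ x ∂μ, ∀ h, (f.1 - f'.1) x h = 0
    filter_upwards [h] with x hx h
    exact sub_eq_zero.2 (hx h)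

theorem Cochain.mk_eq_zero {f : cochains μ V p} :
    Cochain.mk f = 0 ↔ ∀ᵐ x ∂μ, ∀ h, f.1 x h = 0 :=
  Cochain.mk_eq_mk (f' := 0)

theorem altSum_mem_sections {f : ∀ x, (Fin p → ArrowsTo X x) → V.fiber x} (hf : f ∈ cochains μ V p)
    (δ : Fin (p + 1) → BorelSection X) :
    (fun x => altSum 𝕜 p (f x) fun i => δ i x) ∈ V.sections := by
  have h : ∑ i : Fin (p + 1), (-1 : 𝕜) ^ (i : ℕ) • (fun x => f x fun j => δ (i.succAbove j) x) ∈
      V.sections :=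
    Submodule.sum_mem _ fun i _ => V.sections.smul_mem _ (hf.1 fun j => δ (i.succAbove j))
  convert h using 1
  funext x
  simp [altSum, Finset.sum_apply]

theorem norm_altSum_le {Y A : Type*} [NormedAddCommGroup A] [NormedSpace 𝕜 A] (q : ℕ)
    (c : (Fin q → Y) → A) {C : ℝ} (hC : ∀ s, ‖c s‖ ≤ C) (s : Fin (q + 1) → Y) :
    ‖altSum 𝕜 q c s‖ ≤ (q + 1) * C := by
  refine (norm_sum_le _ _).trans ?_
  refine (Finset.sum_le_card_nsmul _ _ C fun i _ => ?_).trans (by simp)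
  rw [norm_smul, norm_pow, norm_neg, norm_one, one_pow, one_mul]
  exact hC _

/-- The homogeneous coboundary in the groupoid variables. -/
def cochainD (V : GField 𝕜 X) (p : ℕ) : cochains μ V p →ₗ[𝕜] cochains μ V (p + 1) where
  toFun f := ⟨fun x => altSum 𝕜 p (f.1 x), altSum_mem_sections f.2, by
    obtain ⟨C, hC⟩ := f.2.2.1
    exact ⟨_, hC.mono fun x hx => norm_altSum_le p _ hx⟩, by
    filter_upwards [f.2.2.2] with x hx g h
    simp only [altSum, map_sum, map_smul, hx]⟩
  map_add' f f' := Subtype.ext (funext fun x => funext fun h => altSum_add p (f.1 x) (f'.1 x) h)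
  map_smul' c f := Subtype.ext (funext fun x => funext fun h => altSum_smul p c (f.1 x) h)

/-- The coboundary in the groupoid variables, on classes. -/
def Cochain.d (V : GField 𝕜 X) (p : ℕ) : Cochain μ V p →ₗ[𝕜] Cochain μ V (p + 1) :=
  Submodule.mapQ _ _ (cochainD V p) fun f hf => by
    change ∀ᵐ x ∂μ, ∀ h, altSum 𝕜 p (f.1 x) h = 0
    filter_upwards [show ∀ᵐ x ∂μ, ∀ h, f.1 x h = 0 from hf] with x hx h
    simp [altSum, hx]

theorem Cochain.d_mk (f : cochains μ V p) :
    Cochain.d V p (Cochain.mk f) = Cochain.mk (cochainD V p f) :=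
  rfl

theorem Cochain.d_d (c : Cochain μ V p) : Cochain.d V (p + 1) (Cochain.d V p c) = 0 := by
  obtain ⟨f, rfl⟩ := Cochain.mk_surjective c
  rw [Cochain.d_mk, Cochain.d_mk, Cochain.mk_eq_zero]
  exact ae_of_all _ fun x h => altSum_altSum p (f.1 x) h

variable {M : MeasuredGroupoid X μ} (hM : M.IsTDiscrete)

/-- The map induced on cochains by a morphism of bundles. -/
def cochainMap (T : GMorphism M V V') (p : ℕ) : cochains μ V p →ₗ[𝕜] cochains μ V' p where
  toFun f := ⟨fun x h => T.toFun x (f.1 x h), fun δ => T.measurable _ (f.2.1 δ), by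
    obtain ⟨C, hC⟩ := f.2.2.1
    obtain ⟨D, hD⟩ := T.bounded
    refine ⟨D * C, ?_⟩
    filter_upwards [hC, hD] with x h1 h2 h
    exact ((T.toFun x).le_opNorm _).trans
      (mul_le_mul h2 (h1 h) (norm_nonneg _) ((norm_nonneg _).trans h2)), by
    filter_upwards [f.2.2.2, (hM.ae_arrowMeasure_iff M).1 T.equivariant] with x h1 h2 g h
    rw [← h1]
    exact (h2 g (f.1 g.1 h)).symm⟩
  map_add' f f' := Subtype.ext (funext fun x => funext fun h => map_add _ _ _)
  map_smul' c f := Subtype.ext (funext fun x => funext fun h => map_smul _ _ _)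

/-- The map induced on classes of cochains by a morphism of bundles. -/
def Cochain.map (T : GMorphism M V V') (p : ℕ) : Cochain μ V p →ₗ[𝕜] Cochain μ V' p :=
  Submodule.mapQ _ _ (cochainMap hM T p) fun f hf => by
    change ∀ᵐ x ∂μ, ∀ h, T.toFun x (f.1 x h) = 0
    filter_upwards [show ∀ᵐ x ∂μ, ∀ h, f.1 x h = 0 from hf] with x hx h
    rw [hx, map_zero]

theorem Cochain.map_mk (T : GMorphism M V V') (f : cochains μ V p) :
    Cochain.map hM T p (Cochain.mk f) = Cochain.mk (cochainMap hM T p f) := rfl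

theorem Cochain.map_d (T : GMorphism M V V') (c : Cochain μ V p) :
    Cochain.map hM T (p + 1) (Cochain.d V p c) = Cochain.d V' p (Cochain.map hM T p c) := by
  obtain ⟨f, rfl⟩ := Cochain.mk_surjective c
  rw [Cochain.d_mk, Cochain.map_mk, Cochain.map_mk, Cochain.d_mk, Cochain.mk_eq_mk]
  refine ae_of_all _ fun x h => ?_
  change T.toFun x (altSum 𝕜 p (f.1 x) h) = altSum 𝕜 p (fun h => T.toFun x (f.1 x h)) h
  simp only [altSum, map_sum, map_smul]

theorem Cochain.map_map_eq {W : GField 𝕜 X} (T : GMorphism M V V') (R : GMorphism M V' V'')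
    (T' : GMorphism M V W) (R' : GMorphism M W V'')
    (h : ∀ᵐ x ∂μ, ∀ v, R.toFun x (T.toFun x v) = R'.toFun x (T'.toFun x v)) (c : Cochain μ V p) :
    Cochain.map hM R p (Cochain.map hM T p c) = Cochain.map hM R' p (Cochain.map hM T' p c) := by
  obtain ⟨f, rfl⟩ := Cochain.mk_surjective c
  simp only [Cochain.map_mk]
  rw [Cochain.mk_eq_mk]
  exact h.mono fun x hx g => hx _

theorem Cochain.map_map_eq_zero (T : GMorphism M V V') (R : GMorphism M V' V'')
    (h : ∀ᵐ x ∂μ, ∀ v, R.toFun x (T.toFun x v) = 0) (c : Cochain μ V p) :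
    Cochain.map hM R p (Cochain.map hM T p c) = 0 := by
  obtain ⟨f, rfl⟩ := Cochain.mk_surjective c
  simp only [Cochain.map_mk]
  rw [Cochain.mk_eq_zero]
  exact h.mono fun x hx g => hx _

end Cochains

/-! ### Exactness in the `S`-variables -/

section Rows

variable {𝕜 : Type} [RCLike 𝕜] {X : Type u} [MeasurableSpace X] [BorelGroupoid X] {μ : Measure X}
  {M : MeasuredGroupoid X μ} {S : GSpace X} (F : SeparableGBundle 𝕜 M) {p q : ℕ}

theorem SeparableGBundle.ae_separableSpace (F : SeparableGBundle 𝕜 M) :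
    ∀ᵐ x ∂μ, TopologicalSpace.SeparableSpace (F.fiber x) := by
  obtain ⟨σ, -, h⟩ := F.separable
  exact h.mono fun x hx => ⟨⟨_, Set.countable_range _, hx⟩⟩

/-- The integral of the first variable against `l`, if it exists. -/
def firstIntegral {F : GField 𝕜 X} {x : X} (l : Measure (S.fiber x))
    (u : WLinf 𝕜 (S.tupleMeasure (q + 1) x) (F.fiber x)) :
    WLinf 𝕜 (S.tupleMeasure q x) (F.fiber x) :=
  open Classical in
  if h : ∃ u' : WLinf 𝕜 (S.tupleMeasure q x) (F.fiber x), ‖u'‖ ≤ ‖u‖ ∧ IsFirstIntegral l u u'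
  then h.choose else 0

theorem norm_firstIntegral_le {F : GField 𝕜 X} {x : X} (l : Measure (S.fiber x))
    (u : WLinf 𝕜 (S.tupleMeasure (q + 1) x) (F.fiber x)) : ‖firstIntegral l u‖ ≤ ‖u‖ := by
  unfold firstIntegral
  split_ifs with h
  · exact h.choose_spec.1
  · rw [norm_zero]; exact norm_nonneg u

theorem isFirstIntegral_firstIntegral {F : GField 𝕜 X} {x : X}
    [TopologicalSpace.SeparableSpace (F.fiber x)] {l : Measure (S.fiber x)} [IsProbabilityMeasure l]
    (hl : l ≪ S.τ x) (u : WLinf 𝕜 (S.tupleMeasure (q + 1) x) (F.fiber x)) :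
    IsFirstIntegral l u (firstIntegral l u) := by
  have h := exists_isFirstIntegral hl u
  unfold firstIntegral
  rw [dif_pos h]
  exact h.choose_spec.2

/-- The rows `p ≥ 1` are exact: the first `S`-variable is integrated against the translate of `τ` by
the first groupoid variable. -/
theorem exists_cochain_tupleCoboundary (hM : M.IsTDiscrete) {f : ∀ x, (Fin (p + 1) → ArrowsTo X x) →
      (tupleBundle μ S F.toGField (q + 1)).fiber x}
    (hf : f ∈ cochains μ (tupleBundle μ S F.toGField (q + 1)) (p + 1))
    (hd : ∀ᵐ x ∂μ, ∀ h, tupleCoboundary S F.toGField (q + 1) x (f x h) = 0) :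
    ∃ f' ∈ cochains μ (tupleBundle μ S F.toGField q) (p + 1),
      ∀ᵐ x ∂μ, ∀ h, tupleCoboundary S F.toGField q x (f' x h) = f x h := by
  have hspec : ∀ᵐ x ∂μ, ∀ h, IsFirstIntegral (S.push (h 0)) (f x h)
      (firstIntegral (S.push (h 0)) (f x h)) := by
    filter_upwards [F.ae_separableSpace] with x hx h
    exact isFirstIntegral_firstIntegral (S.push_absolutelyContinuous _) (f x h)
  refine ⟨fun x h => firstIntegral (S.push (h 0)) (f x h), ⟨fun δ σ hσ => ?_, ?_, ?_⟩, ?_⟩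
  · refine ((hf.1 δ σ hσ).integral_cons (fun x => S.push (δ 0 x)) (S.isMeasurableFamily_push (δ 0))
      fun x => S.push_absolutelyContinuous _).congr ?_
    exact hspec.mono fun x hx => hx _ (σ x)
  · obtain ⟨C, hC⟩ := hf.2.1
    exact ⟨C, hC.mono fun x hx h => (norm_firstIntegral_le _ _).trans (hx h)⟩
  · filter_upwards [hf.2.2, hspec, hM.ae_source M hspec, F.ae_separableSpace] with x h1 h2 h3 h4 g h
    have e := (h3 g h).act (μ := μ) g.2 (S.push_absolutelyContinuous _)
    rw [h1 g h, ← GSpace.push_leftMul] at e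
    exact e.unique (h2 _)
  · filter_upwards [hspec, hd, F.ae_separableSpace] with x h1 h2 h3 h
    exact (h1 h).tupleCoboundary_eq (S.push_absolutelyContinuous _) (h2 h)

end Rows

/-! ### Invariant means -/

section Means

variable {X : Type u} [MeasurableSpace X] [BorelGroupoid X] {μ : Measure X}

/-- An invariant measurable system of means `N_{x,s}` on the bounded scalar functions on `G^x`, for
`s ∈ S^x`. Over a discrete fibre every function is measurable, and no null sets intervene. The
constant `2` in the norm bound leaves room for the complexification of a real mean. -/
structure InvariantMeans (𝕜 : Type) [RCLike 𝕜] (μ : Measure X) (S : GSpace X) where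
  N : ∀ x, S.fiber x → (ArrowsTo X x → 𝕜) → 𝕜
  add : ∀ x s φ ψ, (∃ C, ∀ g, ‖φ g‖ ≤ C) → (∃ C, ∀ g, ‖ψ g‖ ≤ C) →
    N x s (fun g => φ g + ψ g) = N x s φ + N x s ψ
  smul : ∀ x s (c : 𝕜) φ, (∃ C, ∀ g, ‖φ g‖ ≤ C) → N x s (fun g => c * φ g) = c * N x s φ
  const : ∀ x s c, N x s (fun _ => c) = c
  norm_le : ∀ x s φ C, (∀ g, ‖φ g‖ ≤ C) → ‖N x s φ‖ ≤ 2 * C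
  measurable : ∀ φ : Total S.fiber × Arrows X → 𝕜, StronglyMeasurable φ → (∃ C, ∀ p, ‖φ p‖ ≤ C) →
    AEStronglyMeasurable (fun p : Total S.fiber => N p.1 p.2 fun g => φ (p, Total.mk p.1 g))
      (integrate μ S.τ)
  invariant : ∀ᵐ x ∂μ, ∀ᵐ s ∂S.τ x, ∀ (g : ArrowsTo X x) φ, (∃ C, ∀ h, ‖φ h‖ ≤ C) →
    N x s φ = N g.1 (S.act (Groupoid.inv g.2) s) fun h => φ (leftMul g.2 h)

/-- The evaluations form an invariant system of means for the action of `G` on itself. -/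
def regularMeans (𝕜 : Type) [RCLike 𝕜] (M : MeasuredGroupoid X μ) :
    InvariantMeans 𝕜 μ M.regular where
  N x s φ := φ s
  add _ _ _ _ _ _ := rfl
  smul _ _ _ _ _ := rfl
  const _ _ _ := rfl
  norm_le x s φ C h := by
    have h1 := h s
    have h2 := norm_nonneg (φ s)
    change ‖φ s‖ ≤ _
    linarith
  measurable φ hφ _ := by
    have h : StronglyMeasurable fun p : Arrows X => φ (p, p) :=
      hφ.comp_measurable (measurable_id.prodMk measurable_id)
    exact h.aestronglyMeasurable
  invariant := by
    refine ae_of_all _ fun x => ae_of_all _ fun s g φ _ => congrArg φ ?_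
    obtain ⟨y, s⟩ := s
    refine (congrArg (Sigma.mk y) ?_ : (⟨y, s⟩ : ArrowsTo X x) = ⟨y, (s ≫ Groupoid.inv g.2) ≫ g.2⟩)
    rw [Category.assoc, Groupoid.inv_comp, Category.comp_id]

theorem memLp_top_of_norm_le {Y : Type u} [MeasurableSpace Y] {m : Measure Y} {f : Y → ℝ}
    (hf : Measurable f) {C : ℝ} (hC : ∀ y, |f y| ≤ C) : MemLp f ∞ m :=
  memLp_top_of_bound hf.aestronglyMeasurable C (ae_of_all _ hC)

theorem norm_linfClass_le {Y : Type u} [MeasurableSpace Y] {m : Measure Y} {f : Y → ℝ}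
    (hf : Measurable f) {C : ℝ} (h0 : 0 ≤ C) (hC : ∀ y, |f y| ≤ C) : ‖linfClass m f‖ ≤ C := by
  rw [linfClass, dif_pos (memLp_top_of_norm_le hf hC), Lp.norm_toLp]
  refine ENNReal.toReal_le_of_le_ofReal h0 ?_
  rw [eLpNorm_exponent_top]
  exact eLpNormEssSup_le_of_ae_bound (ae_of_all _ hC)

theorem linfClass_add {Y : Type u} [MeasurableSpace Y] {m : Measure Y} {f g : Y → ℝ}
    (hf : MemLp f ∞ m) (hg : MemLp g ∞ m) :
    linfClass m (fun y => f y + g y) = linfClass m f + linfClass m g := by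
  rw [linfClass, linfClass, linfClass, dif_pos hf, dif_pos hg, dif_pos (by exact hf.add hg)]
  exact MemLp.toLp_add hf hg

theorem linfClass_smul {Y : Type u} [MeasurableSpace Y] {m : Measure Y} {f : Y → ℝ}
    (hf : MemLp f ∞ m) (c : ℝ) : linfClass m (fun y => c * f y) = c • linfClass m f := by
  rw [linfClass, linfClass, dif_pos hf, dif_pos (by exact hf.const_mul c)]
  exact MemLp.toLp_const_smul c hf

variable {M : MeasuredGroupoid X μ} {S : GSpace X}

/-- The identification of the fibre of `S ⋊ G` over `s` with `G^{t_S(s)}`. -/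
def GSpace.semidirectArrow (S : GSpace X) (e : S.Semidirect) (h : ArrowsTo S.Semidirect e) :
    ArrowsTo X e.1 := ⟨h.1.1, h.2.1⟩

/-- The arrow `(s, g)` of `S ⋊ G`. -/
def GSpace.semidirectMk (S : GSpace X) (e : S.Semidirect) (h : ArrowsTo X e.1) :
    ArrowsTo S.Semidirect e :=
  ⟨⟨h.1, S.act (Groupoid.inv h.2) e.2⟩, ⟨h.2, by
    rw [← S.act_comp, Groupoid.inv_comp, S.act_id]⟩⟩

theorem measurable_semidirectMk (e : S.Semidirect) : Measurable (S.semidirectMk e) :=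
  measurable_comap_iff.2 measurable_id

theorem MeasuredGroupoid.IsTDiscrete.measurable_semidirect (hM : M.IsTDiscrete) (e : S.Semidirect)
    (φ : ArrowsTo X e.1 → ℝ) : Measurable fun h => φ (S.semidirectArrow e h) := by
  have := hM.countable M e.1
  have h : Measurable φ := measurable_of_countable φ
  exact h.comp (comap_measurable _)

theorem isMeasurableFamily_semidirectMeasure (M : MeasuredGroupoid X μ) (S : GSpace X) :
    IsMeasurableFamily (S := ArrowsTo S.Semidirect) (S.semidirectMeasure M) := by
  rintro _ ⟨B, hB, rfl⟩
  have hmk : Measurable fun e : S.Semidirect => e.1 := S.measurable_proj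
  set κ : ProbabilityTheory.Kernel X (Arrows X) :=
    ⟨fun x => (M.ν x).map (Total.mk x), measurable_map_mk measurable_arrow_mk M.measurable_ν⟩
  have : ProbabilityTheory.IsMarkovKernel κ :=
    ⟨fun x => Measure.isProbabilityMeasure_map (measurable_arrow_mk x).aemeasurable⟩
  have h := ProbabilityTheory.Kernel.measurable_kernel_prodMk_left (κ := κ.comap _ hmk) hB
  convert h using 2 with e
  change (M.ν e.1).map (S.semidirectMk e) _ = (M.ν e.1).map (Total.mk e.1) _
  have hm : Measurable fun h : ArrowsTo S.Semidirect e =>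
      (e, (Total.mk e.1 (S.semidirectArrow e h) : Arrows X)) :=
    measurable_const.prodMk ((measurable_arrow_mk e.1).comp (comap_measurable _))
  rw [Measure.map_apply (measurable_arrow_mk _) (measurable_prodMk_left hB)]
  exact Measure.map_apply (measurable_semidirectMk e) (hm hB)

/-- A point of `S`, as a unit of `S ⋊ G`. -/
def GSpace.semidirectPt (S : GSpace X) (x : X) (s : S.fiber x) : S.Semidirect := ⟨x, s⟩

/-- The real-valued means of an amenable `G`-space, as functions on all bounded functions. -/
theorem GSpace.IsAmenable.exists_real_means (hS : S.IsAmenable M) (hM : M.IsTDiscrete) :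
    ∃ R : ∀ x, S.fiber x → (ArrowsTo X x → ℝ) → ℝ,
      (∀ x s φ ψ, (∃ C, ∀ g, |φ g| ≤ C) → (∃ C, ∀ g, |ψ g| ≤ C) →
        R x s (fun g => φ g + ψ g) = R x s φ + R x s ψ) ∧
      (∀ x s (c : ℝ) φ, (∃ C, ∀ g, |φ g| ≤ C) → R x s (fun g => c * φ g) = c * R x s φ) ∧
      (∀ x s c, R x s (fun _ => c) = c) ∧
      (∀ x s φ C, (∀ g, |φ g| ≤ C) → |R x s φ| ≤ C) ∧
      (∀ φ : Total S.fiber × Arrows X → ℝ, Measurable φ → (∃ C, ∀ p, |φ p| ≤ C) →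
        AEMeasurable (fun p : Total S.fiber => R p.1 p.2 fun g => φ (p, Total.mk p.1 g))
          (integrate μ S.τ)) ∧
      ∀ᵐ x ∂μ, ∀ᵐ s ∂S.τ x, ∀ (g : ArrowsTo X x) φ, (∃ C, ∀ h, |φ h| ≤ C) →
        R x s φ = R g.1 (S.act (Groupoid.inv g.2) s) fun h => φ (leftMul g.2 h) := by
  obtain ⟨m, hm1, hm2, hm3⟩ := hS
  set R : ∀ x, S.fiber x → (ArrowsTo X x → ℝ) → ℝ := fun x s φ =>
    m (S.semidirectPt x s) (linfClass (S.semidirectMeasure M (S.semidirectPt x s))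
      fun h => φ (S.semidirectArrow (S.semidirectPt x s) h)) with hR
  have hLp : ∀ x s (φ : ArrowsTo X x → ℝ), (∃ C, ∀ g, |φ g| ≤ C) →
      MemLp (fun h => φ (S.semidirectArrow (S.semidirectPt x s) h)) ∞
        (S.semidirectMeasure M (S.semidirectPt x s)) := by
    rintro x s φ ⟨C, hC⟩
    exact memLp_top_of_norm_le (hM.measurable_semidirect (S.semidirectPt x s) φ) fun h => hC _
  have hsmul : ∀ x s (c : ℝ) (φ : ArrowsTo X x → ℝ), (∃ C, ∀ g, |φ g| ≤ C) →
      R x s (fun g => c * φ g) = c * R x s φ := by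
    intro x s c φ h1
    simp only [hR]
    rw [linfClass_smul (hLp x s φ h1), map_smul, smul_eq_mul]
  refine ⟨R, ?_, hsmul, ?_, ?_, ?_, ?_⟩
  · intro x s φ ψ h1 h2
    simp only [hR]
    rw [linfClass_add (hLp x s φ h1) (hLp x s ψ h2), map_add]
  · intro x s c
    have h := hsmul x s c (fun _ => 1) ⟨1, fun _ => by simp⟩
    have hone : R x s (fun _ => 1) = 1 := (hm1 (S.semidirectPt x s)).2
    simp only [mul_one, hone] at h
    exact h
  · intro x s φ C hC
    have h0 : 0 ≤ C := (abs_nonneg _).trans (hC ⟨x, 𝟙 x⟩)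
    have h1 := (m (S.semidirectPt x s)).le_opNorm
      (linfClass (S.semidirectMeasure M (S.semidirectPt x s))
        fun h => φ (S.semidirectArrow (S.semidirectPt x s) h))
    rw [(hm1 _).1, one_mul] at h1
    exact h1.trans (norm_linfClass_le (hM.measurable_semidirect (S.semidirectPt x s) φ) h0
      fun h => hC _)
  · rintro φ hφ ⟨C, hC⟩
    exact hm2 (fun a => φ (a.1, arrow a.2.2.1)) (hφ.comp (comap_measurable _)) ⟨C, fun a => hC _⟩
  · have hmk : ∀ e : S.Semidirect,
        Measurable (Total.mk e : ArrowsTo S.Semidirect e → Arrows S.Semidirect) := fun e => by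
      refine measurable_comap_iff.2 ?_
      exact measurable_const.prodMk ((measurable_arrow_mk e.1).comp (comap_measurable _))
    have h1 := ae_ae_of_ae_integrate hmk (isMeasurableFamily_semidirectMeasure M S) hm3
    have h2 : ∀ᵐ e ∂(integrate (S := S.fiber) μ S.τ), ∀ g : ArrowsTo X e.1,
        ∀ f : ArrowsTo S.Semidirect e → ℝ, Measurable f → (∃ C, ∀ h, |f h| ≤ C) →
        m e (linfClass (S.semidirectMeasure M e) f) = m (S.semidirectMk e g).1
          (linfClass (S.semidirectMeasure M (S.semidirectMk e g).1) fun h =>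
            f (leftMul (S.semidirectMk e g).2 h)) := by
      filter_upwards [h1] with e he
      exact (hM.ae_ν_iff M e.1).1 (ae_of_ae_map (measurable_semidirectMk e).aemeasurable he)
    filter_upwards [ae_ae_of_ae_integrate S.measurable_mk S.measurable_τ h2] with x hx
    filter_upwards [hx] with s hs g φ hφ
    obtain ⟨C, hC⟩ := hφ
    exact hs g (fun h => φ (S.semidirectArrow (S.semidirectPt x s) h))
      (hM.measurable_semidirect (S.semidirectPt x s) φ) ⟨C, fun h => hC _⟩

/-- The invariant means of an amenable `G`-space, extended to scalar-valued functions. -/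
theorem GSpace.IsAmenable.nonempty_invariantMeans (hS : S.IsAmenable M) (hM : M.IsTDiscrete)
    (𝕜 : Type) [RCLike 𝕜] : Nonempty (InvariantMeans 𝕜 μ S) := by
  obtain ⟨R, hadd, hsmul, hconst, hbd, hmeas, hinv⟩ := hS.exists_real_means hM
  have hre : ∀ {x} (φ : ArrowsTo X x → 𝕜), (∃ C, ∀ g, ‖φ g‖ ≤ C) →
      ∃ C, ∀ g, |(fun g => RCLike.re (φ g)) g| ≤ C :=
    fun φ ⟨C, hC⟩ => ⟨C, fun g => (RCLike.abs_re_le_norm _).trans (hC g)⟩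
  have him : ∀ {x} (φ : ArrowsTo X x → 𝕜), (∃ C, ∀ g, ‖φ g‖ ≤ C) →
      ∃ C, ∀ g, |(fun g => RCLike.im (φ g)) g| ≤ C :=
    fun φ ⟨C, hC⟩ => ⟨C, fun g => (RCLike.abs_im_le_norm _).trans (hC g)⟩
  have hmul : ∀ x (φ : ArrowsTo X x → ℝ) (c : ℝ), (∃ C, ∀ g, |φ g| ≤ C) →
      ∃ C, ∀ g, |(fun g => c * φ g) g| ≤ C := by
    rintro x φ c ⟨C, hC⟩
    refine ⟨|c| * C, fun g => ?_⟩
    dsimp only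
    rw [abs_mul]
    exact mul_le_mul_of_nonneg_left (hC g) (abs_nonneg c)
  refine ⟨{
    N := fun x s φ => ((R x s fun g => RCLike.re (φ g) : ℝ) : 𝕜) +
      RCLike.I * ((R x s fun g => RCLike.im (φ g) : ℝ) : 𝕜)
    add := ?_, smul := ?_, const := ?_, norm_le := ?_, measurable := ?_, invariant := ?_ }⟩
  · intro x s φ ψ h1 h2
    have e1 : (R x s fun g => RCLike.re (φ g + ψ g)) =
        (R x s fun g => RCLike.re (φ g)) + R x s fun g => RCLike.re (ψ g) := by
      rw [← hadd x s _ _ (hre φ h1) (hre ψ h2)]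
      simp only [map_add]
    have e2 : (R x s fun g => RCLike.im (φ g + ψ g)) =
        (R x s fun g => RCLike.im (φ g)) + R x s fun g => RCLike.im (ψ g) := by
      rw [← hadd x s _ _ (him φ h1) (him ψ h2)]
      simp only [map_add]
    rw [e1, e2, RCLike.ofReal_add, RCLike.ofReal_add]
    ring
  · intro x s c φ h
    have e1 : (R x s fun g => RCLike.re (c * φ g)) =
        RCLike.re c * (R x s fun g => RCLike.re (φ g)) -
        RCLike.im c * R x s fun g => RCLike.im (φ g) := by
      have h3 := hadd x s _ _ (hmul x _ (RCLike.re c) (hre φ h)) (hmul x _ (-RCLike.im c) (him φ h))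
      rw [hsmul x s _ _ (hre φ h), hsmul x s _ _ (him φ h)] at h3
      rw [sub_eq_add_neg, ← neg_mul, ← h3]
      congr 1
      funext g
      rw [RCLike.mul_re]
      ring
    have e2 : (R x s fun g => RCLike.im (c * φ g)) =
        RCLike.re c * (R x s fun g => RCLike.im (φ g)) +
        RCLike.im c * R x s fun g => RCLike.re (φ g) := by
      have h3 := hadd x s _ _ (hmul x _ (RCLike.re c) (him φ h)) (hmul x _ (RCLike.im c) (hre φ h))
      rw [hsmul x s _ _ (him φ h), hsmul x s _ _ (hre φ h)] at h3
      rw [← h3]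
      congr 1
      funext g
      rw [RCLike.mul_im]
    rw [e1, e2]
    generalize (R x s fun g => RCLike.re (φ g)) = a
    generalize (R x s fun g => RCLike.im (φ g)) = b
    have hI : (RCLike.I : 𝕜) * RCLike.I * ((RCLike.im c : ℝ) : 𝕜) = - ((RCLike.im c : ℝ) : 𝕜) := by
      rcases RCLike.I_eq_zero_or_im_I_eq_one (K := 𝕜) with h0 | h0
      · have : RCLike.im c = 0 := by
          rw [← RCLike.mul_im_I_ax c, h0]; simp
        simp [this]
      · rw [RCLike.I_mul_I_of_nonzero (by intro h1; simp [h1] at h0), neg_one_mul]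
    have hc : c = ((RCLike.re c : ℝ) : 𝕜) + ((RCLike.im c : ℝ) : 𝕜) * RCLike.I :=
      (RCLike.re_add_im c).symm
    rw [RCLike.ofReal_sub, RCLike.ofReal_add, RCLike.ofReal_mul, RCLike.ofReal_mul,
      RCLike.ofReal_mul, RCLike.ofReal_mul]
    linear_combination (-(b : 𝕜)) * hI - ((a : 𝕜) + RCLike.I * (b : 𝕜)) * hc
  · intro x s c
    simp only [hconst]
    rw [mul_comm]
    exact RCLike.re_add_im c
  · intro x s φ C hC
    refine (norm_add_le _ _).trans ?_
    have h1 : ‖((R x s fun g => RCLike.re (φ g) : ℝ) : 𝕜)‖ ≤ C := by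
      rw [RCLike.norm_ofReal]
      exact hbd x s _ C fun g => (RCLike.abs_re_le_norm _).trans (hC g)
    have h2 : ‖((R x s fun g => RCLike.im (φ g) : ℝ) : 𝕜)‖ ≤ C := by
      rw [RCLike.norm_ofReal]
      exact hbd x s _ C fun g => (RCLike.abs_im_le_norm _).trans (hC g)
    have h3 : ‖(RCLike.I : 𝕜) * ((R x s fun g => RCLike.im (φ g) : ℝ) : 𝕜)‖ ≤ C := by
      rw [norm_mul]
      refine (mul_le_of_le_one_left (norm_nonneg _) ?_).trans h2
      rcases RCLike.I_eq_zero_or_im_I_eq_one (K := 𝕜) with h0 | h0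
      · rw [h0, norm_zero]; exact zero_le_one
      · rw [RCLike.norm_I_of_ne_zero (by intro h1; simp [h1] at h0)]
    linarith
  · rintro φ hφ ⟨C, hC⟩
    have h1 := hmeas (fun p => RCLike.re (φ p)) (RCLike.measurable_re.comp hφ.measurable)
      ⟨C, fun p => (RCLike.abs_re_le_norm _).trans (hC p)⟩
    have h2 := hmeas (fun p => RCLike.im (φ p)) (RCLike.measurable_im.comp hφ.measurable)
      ⟨C, fun p => (RCLike.abs_im_le_norm _).trans (hC p)⟩
    have h3 := RCLike.measurable_ofReal (𝕜 := 𝕜) |>.comp_aemeasurable h1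
    have h4 := RCLike.measurable_ofReal (𝕜 := 𝕜) |>.comp_aemeasurable h2
    exact (h3.add (h4.const_mul _)).aestronglyMeasurable
  · filter_upwards [hinv] with x hx
    filter_upwards [hx] with s hs g φ hφ
    have e1 := hs g _ (hre φ hφ)
    have e2 := hs g _ (him φ hφ)
    exact congrArg₂ (fun a b : ℝ => (a : 𝕜) + RCLike.I * (b : 𝕜)) e1 e2

end Means

/-! ### Weak-* means of families of classes of functions -/

section FubiniCons

variable {Y : Type u} [MeasurableSpace Y] (m : Measure Y) [IsProbabilityMeasure m] {q : ℕ}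

theorem ae_of_ae_prod_cons {P : (Fin (q + 1) → Y) → Prop}
    (h : ∀ᵐ p ∂m.prod (Measure.pi fun _ : Fin q => m), P (Fin.cons p.1 p.2)) :
    ∀ᵐ s ∂Measure.pi (fun _ => m), P s := by
  have h1 :=
      (measurePreserving_piFinSuccAbove (fun _ : Fin (q + 1) => m) 0).quasiMeasurePreserving.ae h
  filter_upwards [h1] with s hs
  convert hs using 1
  exact (Fin.cons_self_tail s).symm

theorem ae_of_ae_ae_cons {P : (Fin (q + 1) → Y) → Prop} (hP : MeasurableSet {s | P s})
    (h : ∀ᵐ t ∂m, ∀ᵐ s ∂Measure.pi (fun _ : Fin q => m), P (Fin.cons t s)) :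
    ∀ᵐ s ∂Measure.pi (fun _ => m), P s := by
  refine ae_of_ae_prod_cons m ?_
  have hm : MeasurableSet {p : Y × (Fin q → Y) | P (Fin.cons p.1 p.2)} :=
    (measurePreserving_cons m q).measurable hP
  exact (Measure.ae_prod_iff_ae_ae hm).2 h

theorem ae_eq_of_ae_ae_cons {𝕜 : Type} [RCLike 𝕜] {f f' : (Fin (q + 1) → Y) → 𝕜}
    (hf : AEStronglyMeasurable f (Measure.pi fun _ => m))
    (hf' : AEStronglyMeasurable f' (Measure.pi fun _ => m))
    (h : ∀ᵐ t ∂m, ∀ᵐ s ∂Measure.pi (fun _ : Fin q => m), f (Fin.cons t s) = f' (Fin.cons t s)) :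
    f =ᵐ[Measure.pi fun _ => m] f' := by
  have h1 : ∀ᵐ s ∂Measure.pi (fun _ => m), hf.mk f s = hf'.mk f' s := by
    refine ae_of_ae_ae_cons m
      (measurableSet_eq_fun hf.stronglyMeasurable_mk.measurable
          hf'.stronglyMeasurable_mk.measurable) ?_
    filter_upwards [h, ae_ae_cons m hf.ae_eq_mk, ae_ae_cons m hf'.ae_eq_mk] with t h2 h3 h4
    filter_upwards [h2, h3, h4] with s h5 h6 h7
    rw [← h6, ← h7, h5]
  filter_upwards [h1, hf.ae_eq_mk, hf'.ae_eq_mk] with s h2 h3 h4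
  rw [h3, h4, h2]

end FubiniCons

section IsMean

variable {𝕜 : Type} [RCLike 𝕜] {X : Type u} [MeasurableSpace X] [BorelGroupoid X] {μ : Measure X}
  {S : GSpace X} {F : GField 𝕜 X} {q : ℕ} {x : X}

theorem ae_integrable_cons [TopologicalSpace.SeparableSpace (F.fiber x)]
    (u : WLinf 𝕜 (S.tupleMeasure (q + 1) x) (F.fiber x)) :
    ∀ᵐ t ∂S.τ x, ∀ v, ∀ m' : Measure (Fin q → S.fiber x), IsFiniteMeasure m' →
      m' ≪ S.tupleMeasure q x → Integrable (fun y => u.rep.fn (Fin.cons t y) v) m' ∧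
        ‖∫ y, u.rep.fn (Fin.cons t y) v ∂m'‖ ≤ ‖u‖ * ‖v‖ * m'.real Set.univ := by
  have h1 : ∀ n, ∀ᵐ t ∂S.τ x, AEStronglyMeasurable (fun y =>
      u.rep.fn (Fin.cons t y) (TopologicalSpace.denseSeq (F.fiber x) n)) (S.tupleMeasure q x) := by
    intro n
    obtain ⟨f', hf', he⟩ := u.rep.meas (TopologicalSpace.denseSeq (F.fiber x) n)
    filter_upwards [ae_ae_cons _ he] with t ht
    exact ⟨fun y => f' (Fin.cons t y), hf'.comp_measurable
      ((measurePreserving_cons (S.τ x) q).measurable.comp measurable_prodMk_left), ht⟩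
  filter_upwards [ae_all_iff.2 h1, ae_ae_cons _ u.ae_norm_rep_le] with t h2 h3 v m' hm' hac
  have h4 := mem_weakStarBounded_of_denseRange (TopologicalSpace.denseRange_denseSeq _) h2 h3
  have h5 : ∀ᵐ y ∂m', ‖u.rep.fn (Fin.cons t y) v‖ ≤ ‖u‖ * ‖v‖ :=
    Eventually.mono (hac.ae_le h3) fun y hy => (ContinuousLinearMap.le_opNorm _ _).trans (by gcongr)
  exact ⟨Integrable.of_bound ((h4.1 v).mono_ac hac) _ h5, norm_integral_le_of_norm_le_const h5⟩

/-- `ξ` is the weak-* mean of the family `a`: for almost every `t ∈ S^x`, the integrals of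
`ξ(t, ·)` against finite measures and vectors are the means, with respect to `N_{x,t}`, of those of
the functions `a_g(t, ·)`. -/
def IsMean (N : InvariantMeans 𝕜 μ S)
    (a : ArrowsTo X x → WLinf 𝕜 (S.tupleMeasure (q + 1) x) (F.fiber x))
    (ξ : WLinf 𝕜 (S.tupleMeasure (q + 1) x) (F.fiber x)) : Prop :=
  ∀ᵐ t ∂S.τ x, ∀ v, ∀ m' : Measure (Fin q → S.fiber x), IsFiniteMeasure m' →
    m' ≪ S.tupleMeasure q x → ∫ y, ξ.rep.fn (Fin.cons t y) v ∂m' =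
      N.N x t fun g => ∫ y, (a g).rep.fn (Fin.cons t y) v ∂m'

variable {N : InvariantMeans 𝕜 μ S}
  {a a' : ArrowsTo X x → WLinf 𝕜 (S.tupleMeasure (q + 1) x) (F.fiber x)}
  {ξ ξ' : WLinf 𝕜 (S.tupleMeasure (q + 1) x) (F.fiber x)}

theorem IsMean.unique [TopologicalSpace.SeparableSpace (F.fiber x)] (h : IsMean N a ξ)
    (h' : IsMean N a ξ') : ξ = ξ' := by
  refine tupleBundle_ext fun v => ae_eq_of_ae_ae_cons _ (ξ.rep.meas v) (ξ'.rep.meas v) ?_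
  filter_upwards [h, h', ae_integrable_cons ξ, ae_integrable_cons ξ'] with t h1 h2 h3 h4
  refine Integrable.ae_eq_of_forall_setIntegral_eq _ _
    (h3 v _ inferInstance Measure.AbsolutelyContinuous.rfl).1
    (h4 v _ inferInstance Measure.AbsolutelyContinuous.rfl).1 fun A _ _ => ?_
  rw [h1 v _ inferInstance Measure.restrict_le_self.absolutelyContinuous,
    h2 v _ inferInstance Measure.restrict_le_self.absolutelyContinuous]

theorem IsMean.const (u : WLinf 𝕜 (S.tupleMeasure (q + 1) x) (F.fiber x)) :
    IsMean N (fun _ => u) u :=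
  ae_of_all _ fun _ _ _ _ _ => (N.const _ _ _).symm

theorem ae_integrable_cons_family [TopologicalSpace.SeparableSpace (F.fiber x)]
    [Countable (ArrowsTo X x)] {C : ℝ} (ha : ∀ g, ‖a g‖ ≤ C) :
    ∀ᵐ t ∂S.τ x, ∀ v, ∀ m' : Measure (Fin q → S.fiber x), IsFiniteMeasure m' →
      m' ≪ S.tupleMeasure q x → (∀ g, Integrable (fun y => (a g).rep.fn (Fin.cons t y) v) m') ∧
        ∀ g, ‖∫ y, (a g).rep.fn (Fin.cons t y) v ∂m'‖ ≤ C * ‖v‖ * m'.real Set.univ := by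
  filter_upwards [ae_all_iff.2 fun g => ae_integrable_cons (a g)] with t ht v m' hm' hac
  refine ⟨fun g => (ht g v m' hm' hac).1, fun g => (ht g v m' hm' hac).2.trans ?_⟩
  have := ha g
  gcongr

theorem IsMean.add [TopologicalSpace.SeparableSpace (F.fiber x)]
    [Countable (ArrowsTo X x)] {C C' : ℝ}
    (ha : ∀ g, ‖a g‖ ≤ C) (ha' : ∀ g, ‖a' g‖ ≤ C') (h : IsMean N a ξ) (h' : IsMean N a' ξ') :
    IsMean N (fun g => a g + a' g) (ξ + ξ') := by
  filter_upwards [h, h', ae_integrable_cons ξ, ae_integrable_cons ξ', ae_integrable_cons_family ha,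
    ae_integrable_cons_family ha', ae_ae_cons _ (WLinf.rep_add_ae ξ ξ'),
    ae_all_iff.2 fun g => ae_ae_cons _ (WLinf.rep_add_ae (a g) (a' g))]
    with t h1 h2 h3 h4 h5 h6 h7 h8 v m' hm' hac
  have e1 : ∫ y, (ξ + ξ').rep.fn (Fin.cons t y) v ∂m' = ∫ y, ξ.rep.fn (Fin.cons t y) v ∂m' +
      ∫ y, ξ'.rep.fn (Fin.cons t y) v ∂m' := by
    rw [← integral_add (h3 v m' hm' hac).1 (h4 v m' hm' hac).1]
    refine integral_congr_ae (Eventually.mono (hac.ae_le h7) fun y hy => ?_)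
    exact congrArg (fun θ : StrongDual 𝕜 (F.fiber x) => θ v) hy
  have e2 : ∀ g, ∫ y, (a g + a' g).rep.fn (Fin.cons t y) v ∂m' =
      ∫ y, (a g).rep.fn (Fin.cons t y) v ∂m' + ∫ y, (a' g).rep.fn (Fin.cons t y) v ∂m' := by
    intro g
    rw [← integral_add ((h5 v m' hm' hac).1 g) ((h6 v m' hm' hac).1 g)]
    refine integral_congr_ae (Eventually.mono (hac.ae_le (h8 g)) fun y hy => ?_)
    exact congrArg (fun θ : StrongDual 𝕜 (F.fiber x) => θ v) hy
  simp_rw [e2]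
  rw [e1, N.add x t _ _ ⟨_, (h5 v m' hm' hac).2⟩ ⟨_, (h6 v m' hm' hac).2⟩, h1 v m' hm' hac,
    h2 v m' hm' hac]

theorem IsMean.smul [TopologicalSpace.SeparableSpace (F.fiber x)] [Countable (ArrowsTo X x)] {C : ℝ}
    (ha : ∀ g, ‖a g‖ ≤ C) (c : 𝕜) (h : IsMean N a ξ) : IsMean N (fun g => c • a g) (c • ξ) := by
  filter_upwards [h, ae_integrable_cons_family ha, ae_ae_cons _ (WLinf.rep_smul_ae c ξ),
    ae_all_iff.2 fun g => ae_ae_cons _ (WLinf.rep_smul_ae c (a g))]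
    with t h1 h5 h7 h8 v m' hm' hac
  have e1 : ∫ y, (c • ξ).rep.fn (Fin.cons t y) v ∂m' = c * ∫ y, ξ.rep.fn (Fin.cons t y) v ∂m' := by
    rw [← integral_const_mul]
    refine integral_congr_ae (Eventually.mono (hac.ae_le h7) fun y hy => ?_)
    exact congrArg (fun θ : StrongDual 𝕜 (F.fiber x) => θ v) hy
  have e2 : ∀ g, ∫ y, (c • a g).rep.fn (Fin.cons t y) v ∂m' =
      c * ∫ y, (a g).rep.fn (Fin.cons t y) v ∂m' := by
    intro g
    rw [← integral_const_mul]
    refine integral_congr_ae (Eventually.mono (hac.ae_le (h8 g)) fun y hy => ?_)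
    exact congrArg (fun θ : StrongDual 𝕜 (F.fiber x) => θ v) hy
  simp_rw [e2]
  rw [e1, N.smul x t _ _ ⟨_, (h5 v m' hm' hac).2⟩, h1 v m' hm' hac]

theorem IsMean.sum [TopologicalSpace.SeparableSpace (F.fiber x)] [Countable (ArrowsTo X x)]
    {ι : Type*} (I : Finset ι)
    {b : ι → ArrowsTo X x → WLinf 𝕜 (S.tupleMeasure (q + 1) x) (F.fiber x)}
    {ζ : ι → WLinf 𝕜 (S.tupleMeasure (q + 1) x) (F.fiber x)} {C : ℝ} (hb : ∀ i g, ‖b i g‖ ≤ C)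
    (h : ∀ i, IsMean N (b i) (ζ i)) : IsMean N (fun g => ∑ i ∈ I, b i g) (∑ i ∈ I, ζ i) := by
  classical
  induction I using Finset.induction_on with
  | empty => simpa using IsMean.const (N := N) (0 : WLinf 𝕜 (S.tupleMeasure (q + 1) x) (F.fiber x))
  | insert i I hi ih =>
    simp only [Finset.sum_insert hi]
    refine (h i).add (hb i) (C' := ∑ i ∈ I, C) (fun g => ?_) ih
    exact (norm_sum_le _ _).trans (Finset.sum_le_sum fun j _ => hb j g)

/-- Weak-* means are compatible with the action. -/
theorem IsMean.act (hM : Countable (ArrowsTo X x))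
    (hN : ∀ᵐ s ∂S.τ x, ∀ (g : ArrowsTo X x) φ, (∃ C, ∀ h, ‖φ h‖ ≤ C) →
      N.N x s φ = N.N g.1 (S.act (Groupoid.inv g.2) s) fun h => φ (leftMul g.2 h))
    (g : ArrowsTo X x) (hM' : Countable (ArrowsTo X g.1))
    [TopologicalSpace.SeparableSpace (F.fiber x)] [TopologicalSpace.SeparableSpace (F.fiber g.1)]
    {b : ArrowsTo X g.1 → (tupleBundle μ S F (q + 1)).fiber g.1}
    {ζ : (tupleBundle μ S F (q + 1)).fiber g.1} {C : ℝ} (ha : ∀ h, ‖a h‖ ≤ C) (hb : ∀ h, ‖b h‖ ≤ C)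
    (hab : ∀ h, a (leftMul g.2 h) = (tupleBundle μ S F (q + 1)).act g.2 (b h))
    (h : IsMean N b ζ) : IsMean N a ((tupleBundle μ S F (q + 1)).act g.2 ζ) := by
  have hq := S.quasiMeasurePreserving_act (Groupoid.inv g.2)
  filter_upwards [hq.ae h, hN, ae_integrable_cons_family ha, hq.ae (ae_integrable_cons_family hb),
    hq.ae (ae_integrable_cons ζ), ae_ae_cons _ (tupleBundle_rep_act_ae (μ := μ) g.2 ζ),
    ae_all_iff.2 fun h => ae_ae_cons _ (tupleBundle_rep_act_ae (μ := μ) g.2 (b h))]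
    with t h1 h2 h3 h4 h5 h6 h7 v m' hm' hac
  have hm : Measurable (S.actTuple q (Groupoid.inv g.2)) :=
    (S.quasiMeasurePreserving_actTuple q (Groupoid.inv g.2)).measurable
  have hac' : m'.map (S.actTuple q (Groupoid.inv g.2)) ≪ S.tupleMeasure q g.1 :=
    (hac.map hm).trans (S.quasiMeasurePreserving_actTuple q (Groupoid.inv g.2)).absolutelyContinuous
  have hfin : IsFiniteMeasure (m'.map (S.actTuple q (Groupoid.inv g.2))) :=
    Measure.isFiniteMeasure_map _ _
  have key : ∀ u : (tupleBundle μ S F (q + 1)).fiber g.1,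
      Integrable (fun y => (WLinf.rep u).fn (Fin.cons (S.act (Groupoid.inv g.2) t) y)
        (F.actL (Groupoid.inv g.2) v)) (m'.map (S.actTuple q (Groupoid.inv g.2))) →
      (∀ᵐ y ∂S.tupleMeasure q x,
        (WLinf.rep ((tupleBundle μ S F (q + 1)).act g.2 u)).fn (Fin.cons t y) =
          ((WLinf.rep u).fn (S.actTuple (q + 1) (Groupoid.inv g.2) (Fin.cons t y))).comp
            (F.actL (Groupoid.inv g.2))) →
      ∫ y, (WLinf.rep ((tupleBundle μ S F (q + 1)).act g.2 u)).fn (Fin.cons t y) v ∂m' =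
        ∫ y, (WLinf.rep u).fn (Fin.cons (S.act (Groupoid.inv g.2) t) y)
          (F.actL (Groupoid.inv g.2) v) ∂m'.map (S.actTuple q (Groupoid.inv g.2)) := by
    intro u hu1 hu2
    rw [integral_map hm.aemeasurable hu1.1]
    refine integral_congr_ae (Eventually.mono (hac.ae_le hu2) fun y hy => ?_)
    refine (congrArg (fun θ : StrongDual 𝕜 (F.fiber x) => θ v) hy).trans ?_
    have e2 : S.actTuple (q + 1) (Groupoid.inv g.2) (Fin.cons t y) =
        Fin.cons (S.act (Groupoid.inv g.2) t) (S.actTuple q (Groupoid.inv g.2) y) := by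
      funext i
      refine Fin.cases ?_ (fun j => ?_) i <;> rfl
    rw [e2]
    rfl
  refine (key ζ (h5 _ _ hfin hac').1 h6).trans ((h1 _ _ hfin hac').trans ?_)
  refine Eq.trans ?_ (h2 g (fun k => ∫ y, (a k).rep.fn (Fin.cons t y) v ∂m')
    ⟨_, (h3 v m' hm' hac).2⟩).symm
  congr 1
  funext k
  rw [hab]
  exact (key (b k) ((h4 _ _ hfin hac').1 k) (h7 k)).symm

end IsMean

/-! ### Existence of weak-* means -/

section MeanExtension

variable {𝕜 : Type} [RCLike 𝕜]

theorem eq_zero_of_additive_of_bound {V : Type*} [NormedAddCommGroup V] {ι : Type*} {w : ι → V}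
    (hw : DenseRange w) (E : V → 𝕜) (hadd : ∀ v v', E (v + v') = E v + E v') (K : ℝ)
    (hb : ∀ v, ‖E v‖ ≤ K * ‖v‖) (h0 : ∀ i, E (w i) = 0) (v : V) : E v = 0 := by
  have hc : Continuous (AddMonoidHom.mk' E hadd) :=
    AddMonoidHomClass.continuous_of_bound (AddMonoidHom.mk' E hadd) K hb
  have hcl : IsClosed {v : V | E v = 0} := isClosed_eq hc continuous_const
  exact hw.induction_on v hcl h0

/-- If `∫_B p dm` is the mean of the `∫_B P_g dm` for all measurable sets `B`, then the same holds for
the integrals against all finite measures absolutely continuous with respect to `m`. -/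
theorem integral_eq_mean_of_setIntegral {Y ι : Type*} [MeasurableSpace Y] {m : Measure Y}
    [IsFiniteMeasure m] (n : (ι → 𝕜) → 𝕜)
    (nadd : ∀ φ ψ, (∃ C, ∀ g, ‖φ g‖ ≤ C) → (∃ C, ∀ g, ‖ψ g‖ ≤ C) →
      n (fun g => φ g + ψ g) = n φ + n ψ)
    (nsmul : ∀ (c : 𝕜) φ, (∃ C, ∀ g, ‖φ g‖ ≤ C) → n (fun g => c * φ g) = c * n φ)
    (nle : ∀ φ C, (∀ g, ‖φ g‖ ≤ C) → ‖n φ‖ ≤ 2 * C)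
    {p : Y → 𝕜} {P : ι → Y → 𝕜} {D : ℝ} (hp : AEStronglyMeasurable p m)
    (hP : ∀ g, AEStronglyMeasurable (P g) m) (hpD : ∀ᵐ y ∂m, ‖p y‖ ≤ D)
    (hPD : ∀ g, ∀ᵐ y ∂m, ‖P g y‖ ≤ D)
    (h : ∀ B, MeasurableSet B → ∫ y in B, p y ∂m = n fun g => ∫ y in B, P g y ∂m)
    (m' : Measure Y) [IsFiniteMeasure m'] (hac : m' ≪ m) :
    ∫ y, p y ∂m' = n fun g => ∫ y, P g y ∂m' := by
  have int : ∀ {r : Y → 𝕜}, AEStronglyMeasurable r m → (∀ᵐ y ∂m, ‖r y‖ ≤ D) →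
      ∀ {ρ : Y → ℝ}, Integrable ρ m → Integrable (fun y => ρ y • r y) m ∧
        ‖∫ y, ρ y • r y ∂m‖ ≤ D * ∫ y, ‖ρ y‖ ∂m := by
    intro r hr hrD ρ hρ
    have hb : ∀ᵐ y ∂m, ‖ρ y • r y‖ ≤ D * ‖ρ y‖ := by
      filter_upwards [hrD] with y hy
      rw [norm_smul, mul_comm]
      gcongr
    refine ⟨(hρ.norm.const_mul D).mono' (hρ.1.smul hr) hb, ?_⟩
    rw [← integral_const_mul]
    exact norm_integral_le_of_norm_le (hρ.norm.const_mul D) hb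
  set E : (Y → ℝ) → 𝕜 := fun ρ => ∫ y, ρ y • p y ∂m - n fun g => ∫ y, ρ y • P g y ∂m with hE
  have hbdd : ∀ {ρ : Y → ℝ}, Integrable ρ m → ∃ C, ∀ g, ‖∫ y, ρ y • P g y ∂m‖ ≤ C :=
    fun hρ => ⟨_, fun g => (int (hP g) (hPD g) hρ).2⟩
  have Eadd : ∀ {ρ ρ' : Y → ℝ}, Integrable ρ m → Integrable ρ' m →
      E (fun y => ρ y + ρ' y) = E ρ + E ρ' := by
    intro ρ ρ' hρ hρ'
    simp only [hE, add_smul]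
    rw [integral_add (int hp hpD hρ).1 (int hp hpD hρ').1]
    have e : ∀ g, ∫ y, ρ y • P g y + ρ' y • P g y ∂m =
        ∫ y, ρ y • P g y ∂m + ∫ y, ρ' y • P g y ∂m := fun g =>
      integral_add (int (hP g) (hPD g) hρ).1 (int (hP g) (hPD g) hρ').1
    simp_rw [e]
    rw [nadd _ _ (hbdd hρ) (hbdd hρ')]
    ring
  have Econgr : ∀ {ρ ρ' : Y → ℝ}, ρ =ᵐ[m] ρ' → E ρ = E ρ' := by
    intro ρ ρ' hρ
    have e : ∀ r : Y → 𝕜, ∫ y, ρ y • r y ∂m = ∫ y, ρ' y • r y ∂m := fun r =>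
      integral_congr_ae (hρ.mono fun y hy => by simp only [hy])
    simp only [hE, e]
  have key : ∀ ρ : Y → ℝ, Integrable ρ m → E ρ = 0 := by
    intro ρ hρ
    refine Integrable.induction (P := fun ρ => E ρ = 0) ?_ ?_ ?_ ?_ hρ
    · intro c B hB _
      have e : ∀ r : Y → 𝕜, ∫ y, B.indicator (fun _ => c) y • r y ∂m =
          (c : 𝕜) * ∫ y in B, r y ∂m := by
        intro r
        rw [← integral_const_mul, ← integral_indicator hB]
        refine integral_congr_ae (ae_of_all _ fun y => ?_)
        by_cases hy : y ∈ B <;> simp [hy, RCLike.real_smul_eq_coe_mul]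
      simp only [hE, e]
      rw [nsmul, h B hB, sub_self]
      refine ⟨D * ∫ y, ‖B.indicator (fun _ => (1 : ℝ)) y‖ ∂m, fun g => ?_⟩
      have e1 := (int (hP g) (hPD g) ((integrable_const (1 : ℝ)).indicator hB)).2
      refine le_trans (le_of_eq ?_) e1
      congr 1
      rw [← integral_indicator hB]
      refine integral_congr_ae (ae_of_all _ fun y => ?_)
      by_cases hy : y ∈ B <;> simp [hy]
    · intro f g _ hf hg h1 h2
      exact (Eadd hf hg).trans (by rw [h1, h2, add_zero])
    · set L : Lp ℝ 1 m →+ 𝕜 := AddMonoidHom.mk' (fun f => E f) fun f g =>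
        (Econgr (Lp.coeFn_add f g)).trans (Eadd (L1.integrable_coeFn f) (L1.integrable_coeFn g))
      have hL : Continuous L := AddMonoidHomClass.continuous_of_bound L (D + 2 * D) fun f => by
        have hf := L1.integrable_coeFn f
        rw [L1.norm_eq_integral_norm, add_mul, mul_assoc]
        exact (norm_sub_le _ _).trans (add_le_add (int hp hpD hf).2
          (nle _ _ fun g => (int (hP g) (hPD g) hf).2))
      exact isClosed_eq hL continuous_const
    · intro f g hfg _ h1
      exact (Econgr hfg).symm.trans h1
  have hd := key _ (Measure.integrable_toReal_rnDeriv (μ := m') (ν := m))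
  have e : ∀ r : Y → 𝕜, ∫ y, (m'.rnDeriv m y).toReal • r y ∂m = ∫ y, r y ∂m' := fun r =>
    integral_rnDeriv_smul hac
  simp only [hE, e] at hd
  exact sub_eq_zero.1 hd

end MeanExtension

section MeanFibre

variable {𝕜 : Type} [RCLike 𝕜] {X : Type u} [MeasurableSpace X] [BorelGroupoid X] {μ : Measure X}
  {S : GSpace X} {F : GField 𝕜 X} {q : ℕ} {x : X}

/-- Existence of the mean over a single fibre, given its values `K_j` on a sequence of vectors `w_j`
of which suitable multiples are dense. Almost every `K_j(s)` is bounded on linear combinations with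
coefficients in countable dense sets, and so extends to a functional on the whole fibre. -/
theorem exists_isMean_of_values (N : InvariantMeans 𝕜 μ S) [Countable (ArrowsTo X x)]
    [TopologicalSpace.SeparableSpace (F.fiber x)]
    {a : ArrowsTo X x → WLinf 𝕜 (S.tupleMeasure (q + 1) x) (F.fiber x)} {C : ℝ} (hC : 0 ≤ C)
    (ha : ∀ g, ‖a g‖ ≤ C) (w : ℕ → F.fiber x) (r : ℕ → 𝕜) (hw : DenseRange fun j => r j • w j)
    (K : ℕ → (Fin (q + 1) → S.fiber x) → 𝕜) (hK : ∀ j, StronglyMeasurable (K j))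
    (h : ∀ᵐ t ∂S.τ x, ∀ j, Integrable (fun y => K j (Fin.cons t y)) (S.tupleMeasure q x) ∧
      ∀ B, MeasurableSet B → ∫ y in B, K j (Fin.cons t y) ∂S.tupleMeasure q x =
        N.N x t fun g => ∫ y in B, (a g).rep.fn (Fin.cons t y) (w j) ∂S.tupleMeasure q x) :
    ∃ ξ : WLinf 𝕜 (S.tupleMeasure (q + 1) x) (F.fiber x), ‖ξ‖ ≤ 4 * C ∧ IsMean N a ξ ∧
      ∀ j, ∀ᵐ s ∂S.tupleMeasure (q + 1) x, ξ.rep.fn s (w j) = K j s := by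
  classical
  have hC4 : 0 ≤ 4 * C := by linarith
  have hfam := ae_integrable_cons_family ha
  -- bounds for the linear combinations of the values
  have hbound : ∀ᵐ s ∂S.tupleMeasure (q + 1) x, ∀ n k,
      ‖∑ j : Fin n, TopologicalSpace.denseSeq (Fin n → 𝕜) k j * K j s‖ ≤
        4 * C * ‖∑ j : Fin n, TopologicalSpace.denseSeq (Fin n → 𝕜) k j • w j‖ := by
    refine ae_all_iff.2 fun n => ae_all_iff.2 fun k => ?_
    set c := TopologicalSpace.denseSeq (Fin n → 𝕜) k
    refine ae_of_ae_ae_cons _ ?_ ?_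
    · refine measurableSet_le (Measurable.norm ?_) measurable_const
      exact Finset.measurable_fun_sum _ fun j _ => (hK j).measurable.const_mul (c j)
    filter_upwards [h, hfam] with t h1 h2
    have hi : ∀ j : Fin n, Integrable (fun y => c j * K j (Fin.cons t y)) (S.tupleMeasure q x) :=
      fun j => (h1 j).1.const_mul _
    have h3 := ae_norm_le_of_setIntegral (S.tupleMeasure q x)
      (u := fun y => ∑ j : Fin n, c j * K j (Fin.cons t y)) (integrable_finsetSum _ fun j _ => hi j)
      (2 * (C * ‖∑ j : Fin n, c j • w j‖)) fun B hB => ?_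
    · filter_upwards [h3] with y hy
      linarith
    have hac : (S.tupleMeasure q x).restrict B ≪ S.tupleMeasure q x :=
      Measure.restrict_le_self.absolutelyContinuous
    have hsum : ∀ I : Finset (Fin n), (N.N x t fun g => ∫ y in B,
        (a g).rep.fn (Fin.cons t y) (∑ j ∈ I, c j • w j) ∂S.tupleMeasure q x) =
        ∑ j ∈ I, c j * N.N x t fun g => ∫ y in B,
          (a g).rep.fn (Fin.cons t y) (w j) ∂S.tupleMeasure q x := by
      intro I
      induction I using Finset.induction_on with
      | empty => simpa using N.const x t 0
      | insert j I hj ih =>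
        simp only [Finset.sum_insert hj, map_add, map_smul, smul_eq_mul]
        have e : ∀ g, ∫ y in B, (c j * (a g).rep.fn (Fin.cons t y) (w j) +
            (a g).rep.fn (Fin.cons t y) (∑ j ∈ I, c j • w j)) ∂S.tupleMeasure q x =
            c j * ∫ y in B, (a g).rep.fn (Fin.cons t y) (w j) ∂S.tupleMeasure q x +
            ∫ y in B, (a g).rep.fn (Fin.cons t y) (∑ j ∈ I, c j • w j) ∂S.tupleMeasure q x := by
          intro g
          rw [integral_add (((h2 _ _ inferInstance hac).1 g).const_mul _)
            ((h2 _ _ inferInstance hac).1 g), integral_const_mul]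
        simp_rw [e]
        have hb1 := (h2 (w j) _ inferInstance hac).2
        rw [N.add _ _ _ _ ⟨_, fun g => (norm_mul_le _ _).trans
          (mul_le_mul_of_nonneg_left (hb1 g) (norm_nonneg (c j)))⟩
          ⟨_, (h2 _ _ inferInstance hac).2⟩, N.smul _ _ _ _ ⟨_, hb1⟩, ih]
    rw [integral_finsetSum _ fun j _ => (hi j).integrableOn]
    simp_rw [integral_const_mul, fun j : Fin n => (h1 j).2 B hB]
    rw [← hsum, mul_assoc, measureReal_def]
    refine N.norm_le _ _ _ _ fun g => ?_
    have := (h2 (∑ j : Fin n, c j • w j) _ inferInstance hac).2 g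
    rwa [measureReal_restrict_apply_univ, measureReal_def] at this
  -- the functional at each point
  have hex : ∀ s, ∃ θ : StrongDual 𝕜 (F.fiber x), (∀ n k,
      ‖∑ j : Fin n, TopologicalSpace.denseSeq (Fin n → 𝕜) k j * K j s‖ ≤
        4 * C * ‖∑ j : Fin n, TopologicalSpace.denseSeq (Fin n → 𝕜) k j • w j‖) →
      ‖θ‖ ≤ 4 * C ∧ ∀ j, θ (w j) = K j s := by
    intro s
    by_cases hs : ∀ n k, ‖∑ j : Fin n, TopologicalSpace.denseSeq (Fin n → 𝕜) k j * K j s‖ ≤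
        4 * C * ‖∑ j : Fin n, TopologicalSpace.denseSeq (Fin n → 𝕜) k j • w j‖
    · obtain ⟨θ, h1, h2⟩ := exists_dual_of_bound w (fun j => K j s) hC4 hs
      exact ⟨θ, fun _ => ⟨h1, h2⟩⟩
    · exact ⟨0, fun h => absurd h hs⟩
  choose f hf using hex
  have hf1 : ∀ᵐ s ∂S.tupleMeasure (q + 1) x, ‖f s‖ ≤ 4 * C := hbound.mono fun s hs => (hf s hs).1
  have hf2 : ∀ j, ∀ᵐ s ∂S.tupleMeasure (q + 1) x, f s (w j) = K j s := fun j =>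
    hbound.mono fun s hs => (hf s hs).2 j
  have hfm : f ∈ weakStarBounded 𝕜 (S.tupleMeasure (q + 1) x) (F.fiber x) := by
    refine mem_weakStarBounded_of_denseRange hw (fun j => ?_) hf1
    refine ⟨fun s => r j * K j s, (hK j).const_mul _, (hf2 j).mono fun s hs => ?_⟩
    dsimp only
    rw [map_smul, hs, smul_eq_mul]
  set ξ : WLinf 𝕜 (S.tupleMeasure (q + 1) x) (F.fiber x) := WLinf.mk _ ⟨f, hfm⟩ with hξ
  have hrep : ∀ᵐ s ∂S.tupleMeasure (q + 1) x, ξ.rep.fn s = f s := WLinf.rep_mk_ae _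
  have hval : ∀ j, ∀ᵐ s ∂S.tupleMeasure (q + 1) x, ξ.rep.fn s (w j) = K j s := fun j => by
    filter_upwards [hrep, hf2 j] with s h1 h2
    rw [h1, h2]
  have hnorm : ‖ξ‖ ≤ 4 * C :=
     (WLinf.norm_mk _ _).trans_le (WLinfPre.norm_le _ hC4 hf1)
  refine ⟨ξ, hnorm, ?_, hval⟩
  filter_upwards [h, hfam, ae_integrable_cons ξ, ae_all_iff.2 fun j => ae_ae_cons _ (hval j),
    ae_ae_cons _ ξ.ae_norm_rep_le, ae_all_iff.2 fun g => ae_ae_cons _ (a g).ae_norm_rep_le]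
    with t h1 h2 h3 h4 h5 h6 v m' hm' hac
  have hw1 : ∀ j, ∫ y, ξ.rep.fn (Fin.cons t y) (w j) ∂m' =
      N.N x t fun g => ∫ y, (a g).rep.fn (Fin.cons t y) (w j) ∂m' := by
    intro j
    refine integral_eq_mean_of_setIntegral (m := S.tupleMeasure q x) (N.N x t)
      (N.add x t) (N.smul x t)
      (N.norm_le x t) (D := 4 * C * ‖w j‖)
          (h3 _ _ inferInstance Measure.AbsolutelyContinuous.rfl).1.1
      (fun g => ((h2 _ _ inferInstance Measure.AbsolutelyContinuous.rfl).1 g).1) ?_ (fun g => ?_)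
      (fun B hB => ?_) m' hac
    · filter_upwards [h5] with y hy
      exact (ContinuousLinearMap.le_opNorm _ _).trans (by gcongr; exact hy.trans hnorm)
    · filter_upwards [h6 g] with y hy
      refine (ContinuousLinearMap.le_opNorm _ _).trans ?_
      gcongr
      have := ha g
      linarith
    · rw [← (h1 j).2 B hB]
      exact integral_congr_ae (ae_restrict_of_ae (h4 j))
  refine sub_eq_zero.1 (eq_zero_of_additive_of_bound hw (fun v =>
    ∫ y, ξ.rep.fn (Fin.cons t y) v ∂m' - N.N x t fun g => ∫ y, (a g).rep.fn (Fin.cons t y) v ∂m')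
    ?_ (‖ξ‖ * m'.real Set.univ + 2 * (C * m'.real Set.univ)) ?_ ?_ v)
  · intro v v'
    simp only [map_add]
    rw [integral_add (h3 _ _ hm' hac).1 (h3 _ _ hm' hac).1]
    have e : ∀ g, ∫ y, ((a g).rep.fn (Fin.cons t y) v + (a g).rep.fn (Fin.cons t y) v') ∂m' =
        ∫ y, (a g).rep.fn (Fin.cons t y) v ∂m' + ∫ y, (a g).rep.fn (Fin.cons t y) v' ∂m' := fun g =>
      integral_add ((h2 _ _ hm' hac).1 g) ((h2 _ _ hm' hac).1 g)
    simp_rw [e]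
    rw [N.add _ _ _ _ ⟨_, (h2 _ _ hm' hac).2⟩ ⟨_, (h2 _ _ hm' hac).2⟩]
    ring
  · intro v
    refine (norm_sub_le _ _).trans ?_
    rw [add_mul]
    refine add_le_add ((h3 _ _ hm' hac).2.trans (by linarith)) ?_
    refine (N.norm_le _ _ _ _ (h2 v _ hm' hac).2).trans (by linarith)
  · intro j
    simp only [map_smul, smul_eq_mul, integral_const_mul]
    rw [N.smul _ _ _ _ ⟨_, (h2 _ _ hm' hac).2⟩, hw1 j, sub_self]

end MeanFibre

section MeanSection

variable {𝕜 : Type} [RCLike 𝕜] {X : Type u} [MeasurableSpace X] [BorelGroupoid X] {μ : Measure X}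
  {S : GSpace X} {q : ℕ}

theorem IsJoint.select {u : ℕ → ∀ x, (Fin q → S.fiber x) → 𝕜} (hu : ∀ j, IsJoint μ S q (u j))
    {i : X → ℕ} (hi : Measurable i) : IsJoint μ S q fun x => u (i x) x := by
  choose k hk he using hu
  refine ⟨fun p => k (i p.1) p, ?_, (ae_all_iff.2 he).mono fun x hx => hx (i x)⟩
  have h : Measurable fun p : ℕ × (X × (Fin q → Total S.fiber)) => k p.1 p.2 :=
    measurable_from_prod_countable_right fun n => (hk n).measurable
  exact (h.comp ((hi.comp measurable_fst).prodMk measurable_id)).stronglyMeasurable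

/-- Measurable sections are approximated by measurable selections from a dense sequence. -/
theorem exists_measurable_approx {M : MeasuredGroupoid X μ} (F : SeparableGBundle 𝕜 M)
    {σ : ℕ → ∀ x, F.fiber x} (hσ : ∀ j, σ j ∈ F.sections)
    (hd : ∀ᵐ x ∂μ, DenseRange fun j => σ j x) {ζ : ∀ x, F.fiber x} (hζ : ζ ∈ F.sections) {ε : ℝ}
    (hε : 0 < ε) : ∃ i : X → ℕ, Measurable i ∧ ∀ᵐ x ∂μ, ‖ζ x - σ (i x) x‖ < ε := by
  classical
  have hm : ∀ j, AEMeasurable (fun x => ‖ζ x - σ j x‖) μ := fun j =>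
    F.isMeasurableStructure.norm_measurable _ (F.sections.sub_mem hζ (hσ j))
  set p : X → ℕ → Prop := fun x j => (hm j).mk _ x < ε ∨ ∀ j', ¬ (hm j').mk _ x < ε with hp
  have hmk : ∀ j, MeasurableSet {x | (hm j).mk _ x < ε} := fun j =>
    measurableSet_lt (hm j).measurable_mk measurable_const
  have hex : ∀ x, ∃ j, p x j := fun x => by
    by_cases h : ∃ j, (hm j).mk _ x < ε
    · exact h.imp fun j hj => Or.inl hj
    · exact ⟨0, Or.inr (not_exists.1 h)⟩
  refine ⟨fun x => Nat.find (hex x), measurable_find hex fun j => ?_, ?_⟩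
  · exact (hmk j).union (MeasurableSet.iInter fun j' => (hmk j').compl) |>.congr (by
      ext x; simp [hp])
  · filter_upwards [hd, ae_all_iff.2 fun j => (hm j).ae_eq_mk] with x h1 h2
    obtain ⟨j, hj⟩ := h1.exists_dist_lt (ζ x) hε
    rw [dist_eq_norm, h2 j] at hj
    rcases Nat.find_spec (hex x) with h3 | h3
    · rw [h2]; exact h3
    · exact absurd hj (h3 j)

/-- Joint measurability can be tested on a dense sequence of sections. -/
theorem isJoint_of_dense {M : MeasuredGroupoid X μ} (F : SeparableGBundle 𝕜 M)
    {σ : ℕ → ∀ x, F.fiber x} (hσ : ∀ j, σ j ∈ F.sections)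
    (hd : ∀ᵐ x ∂μ, DenseRange fun j => σ j x)
    {f : ∀ x, (Fin q → S.fiber x) → StrongDual 𝕜 (F.fiber x)}
    (hf : ∀ j, IsJoint μ S q fun x s => f x s (σ j x)) {ζ : ∀ x, F.fiber x} (hζ : ζ ∈ F.sections) :
    IsJoint μ S q fun x s => f x s (ζ x) := by
  choose i hi happ using fun n : ℕ =>
    exists_measurable_approx F hσ hd hζ (Nat.one_div_pos_of_nat (α := ℝ) (n := n))
  refine IsJoint.lim (w := fun n x s => f x s (σ (i n x) x)) (fun n => IsJoint.select hf (hi n)) ?_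
  filter_upwards [ae_all_iff.2 happ] with x hx
  refine ae_of_all _ fun s => ((f x s).continuous.tendsto _).comp ?_
  refine tendsto_iff_norm_sub_tendsto_zero.2 (squeeze_zero (fun _ => norm_nonneg _) (fun n => ?_)
    tendsto_one_div_add_atTop_nhds_zero_nat)
  rw [norm_sub_rev]
  exact (hx n).le

/-- The index of an arrow in an enumeration by Borel sections. -/
theorem exists_measurable_index {γ : ℕ → BorelSection X}
    (hγ : ∀ x (g : ArrowsTo X x), ∃ i, γ i x = g) :
    ∃ I : Arrows X → ℕ, Measurable I ∧ ∀ x (g : ArrowsTo X x), γ (I (Total.mk x g)) x = g := by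
  classical
  have hex : ∀ a : Arrows X, ∃ i, γ i a.1 = a.2 := fun a => hγ a.1 a.2
  refine ⟨fun a => Nat.find (hex a), measurable_find hex fun i => ?_, fun x g =>
    Nat.find_spec (hex (Total.mk x g))⟩
  have h := measurableSet_eq_fun ((γ i).measurable.comp BorelGroupoid.measurable_target)
    (measurable_id (α := Arrows X))
  convert h using 1
  ext a
  constructor
  · intro ha
    exact congrArg (Total.mk a.1) ha
  · intro ha
    exact (BorelGroupoid.measurableEmbedding_mk a.1).injective ha

end MeanSection

section ExistsMean

variable {𝕜 : Type} [RCLike 𝕜] {X : Type u} [MeasurableSpace X] [BorelGroupoid X] {μ : Measure X}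
  {S : GSpace X} {q : ℕ}

/-- The values on a single vector field `w` of the weak-* means to be constructed: a jointly
measurable function `K` whose integrals over sets of tuples `y` are the means, over `g`, of the
integrals of `⟨a_g, w⟩`. For a fixed first point `t`, the means form an additive function of the set
which is bounded by a multiple of the product measure, so they have a density. -/
theorem exists_mean_values [StandardBorelSpace X] [IsProbabilityMeasure μ]
    {M : MeasuredGroupoid X μ} {F : GField 𝕜 X} (hM : M.IsTDiscrete) (N : InvariantMeans 𝕜 μ S)
    {a : ∀ x, ArrowsTo X x → WLinf 𝕜 (S.tupleMeasure (q + 1) x) (F.fiber x)} {C : ℝ}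
    (hC : 0 ≤ C) (ha : ∀ᵐ x ∂μ, ∀ g, ‖a x g‖ ≤ C) {w : ∀ x, F.fiber x} (hw : ∀ x, ‖w x‖ ≤ 1)
    (hmeas : ∀ γ : BorelSection X, IsJoint μ S (q + 1) fun x s => (a x (γ x)).rep.fn s (w x)) :
    ∃ K : (Fin (q + 1) → Total S.fiber) → 𝕜, StronglyMeasurable K ∧ ∀ᵐ x ∂μ, ∀ᵐ t ∂S.τ x,
      Integrable (fun y => K (S.tuple x (Fin.cons t y))) (S.tupleMeasure q x) ∧
      ∀ B, MeasurableSet B → ∫ y in B, K (S.tuple x (Fin.cons t y)) ∂S.tupleMeasure q x =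
        N.N x t fun g => ∫ y in B, (a x g).rep.fn (Fin.cons t y) (w x) ∂S.tupleMeasure q x := by
  classical
  obtain ⟨γ, hγ⟩ := exists_borelSection_enum M hM
  obtain ⟨I, hI, hIγ⟩ := exists_measurable_index hγ
  choose h hh he using fun k => hmeas (γ k)
  -- bounded Borel versions of the functions `⟨a_g, w⟩`
  set H : ℕ → X × (Fin (q + 1) → Total S.fiber) → 𝕜 := fun k p =>
    if ‖h k p‖ ≤ C then h k p else 0 with hH
  have hHm : ∀ k, Measurable (H k) := fun k =>
    Measurable.ite (measurableSet_le (hh k).measurable.norm measurable_const) (hh k).measurable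
      measurable_const
  have hHC : ∀ k p, ‖H k p‖ ≤ C := fun k p => by
    simp only [hH]
    split_ifs with h1
    · exact h1
    · simpa using hC
  set η : ProbabilityTheory.Kernel (Total S.fiber) (Fin q → Total S.fiber) :=
    (S.tupleKernel q).comap (fun z => z.1) S.measurable_proj with hη
  have hcons : Measurable fun p : Total S.fiber × (Fin q → Total S.fiber) =>
      ((p.1.1, Fin.cons p.1 p.2) : X × (Fin (q + 1) → Total S.fiber)) := by
    refine (S.measurable_proj.comp measurable_fst).prodMk (measurable_pi_lambda _ fun i => ?_)
    refine Fin.cases ?_ (fun j => ?_) i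
    · simpa using measurable_fst
    · simp only [Fin.cons_succ]
      exact (measurable_pi_apply j).comp measurable_snd
  have hHz : ∀ k z, Measurable fun y : Fin q → Total S.fiber => H k (z.1, Fin.cons z y) :=
    fun k z => (hHm k).comp (hcons.comp measurable_prodMk_left)
  have hHi : ∀ k z, Integrable (fun y : Fin q → Total S.fiber => H k (z.1, Fin.cons z y)) (η z) :=
    fun k z => Integrable.of_bound (hHz k z).aestronglyMeasurable C (ae_of_all _ fun y => hHC _ _)
  set Φ : Set (Fin q → Total S.fiber) → Total S.fiber × Arrows X → 𝕜 := fun A p =>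
    ∫ y in A, H (I p.2) (p.1.1, Fin.cons p.1 y) ∂η p.1 with hΦ
  have hΦm : ∀ A, MeasurableSet A → StronglyMeasurable (Φ A) := by
    intro A hA
    have h1 : ∀ k, Measurable fun z : Total S.fiber =>
        ∫ y in A, H k (z.1, Fin.cons z y) ∂η z := fun k =>
      (StronglyMeasurable.integral_kernel_prod_right' (κ := η.restrict hA)
        ((hHm k).comp hcons).stronglyMeasurable).measurable
    have h2 : Measurable fun p : ℕ × Total S.fiber =>
        ∫ y in A, H p.1 (p.2.1, Fin.cons p.2 y) ∂η p.2 :=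
      measurable_from_prod_countable_right h1
    exact (h2.comp ((hI.comp measurable_snd).prodMk measurable_fst)).stronglyMeasurable
  have hΦC : ∀ A p, ‖Φ A p‖ ≤ C * (η p.1).real A := fun A p =>
    norm_setIntegral_le_of_norm_le_const (measure_lt_top _ _) fun y _ => hHC _ _
  have hΦC' : ∀ A z, ∃ D, ∀ g : ArrowsTo X z.1, ‖Φ A (z, Total.mk z.1 g)‖ ≤ D :=
    fun A z => ⟨C * (η z).real A, fun g => hΦC A _⟩
  choose u hu hu' using fun z : Total S.fiber => exists_density (η z)
    (fun A => N.N z.1 z.2 fun g => Φ A (z, Total.mk z.1 g)) (2 * C)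
    (fun A B hA hB hAB => by
      have e : ∀ g : ArrowsTo X z.1, Φ (A ∪ B) (z, Total.mk z.1 g) =
          Φ A (z, Total.mk z.1 g) + Φ B (z, Total.mk z.1 g) := fun g =>
        setIntegral_union hAB hB (hHi _ _).integrableOn (hHi _ _).integrableOn
      simp_rw [e]
      exact N.add _ _ _ _ (hΦC' A z) (hΦC' B z))
    (fun A hA => by
      rw [mul_assoc]
      exact N.norm_le _ _ _ _ fun g => hΦC A _)
  obtain ⟨k, hk, hke⟩ := exists_joint_version (π := integrate μ S.τ) η u (ae_of_all _ hu)
    (fun A hA => by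
      simp_rw [hu' _ A hA]
      refine N.measurable (Φ A) (hΦm A hA) ⟨C, fun p => (hΦC A p).trans ?_⟩
      exact mul_le_of_le_one_right hC measureReal_le_one)
  refine ⟨fun d => k (d 0, Fin.tail d), hk.comp_measurable ((measurable_pi_apply 0).prodMk
    (measurable_pi_lambda _ fun j => measurable_pi_apply _)), ?_⟩
  filter_upwards [ae_ae_of_ae_integrate S.measurable_mk S.measurable_τ hke, ae_all_iff.2 he, ha]
    with x h1 h2 h3
  have hcount := hM.countable M x
  filter_upwards [h1, ae_all_iff.2 fun k => ae_ae_cons _ (h2 k),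
    ae_all_iff.2 fun g => ae_ae_cons _ (a x g).ae_norm_rep_le] with t h4 h5 h6
  have hηx : η (Total.mk x t) = (S.tupleMeasure q x).map (S.tuple x) := rfl
  have ht : ∀ y, k (S.tuple x (Fin.cons t y) 0, Fin.tail (S.tuple x (Fin.cons t y))) =
      k (Total.mk x t, S.tuple x y) := fun y => rfl
  have h7 : ∀ᵐ y ∂S.tupleMeasure q x, u (Total.mk x t) (S.tuple x y) =
      k (Total.mk x t, S.tuple x y) := ae_of_ae_map (S.measurable_tuple x).aemeasurable h4
  simp_rw [ht]
  have hkt : StronglyMeasurable fun y => k (Total.mk x t, y) :=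
    hk.comp_measurable measurable_prodMk_left
  have h8 : Integrable (fun y => k (Total.mk x t, y)) (η (Total.mk x t)) :=
    (hu (Total.mk x t)).congr h4
  refine ⟨h8.comp_measurable (S.measurable_tuple x), fun B hB => ?_⟩
  rw [← S.comap_tuple x] at hB
  obtain ⟨A, hA, rfl⟩ := hB
  have e1 : ∫ y in S.tuple x ⁻¹' A, k (Total.mk x t, S.tuple x y) ∂S.tupleMeasure q x =
      ∫ y in A, k (Total.mk x t, y) ∂η (Total.mk x t) := by
    rw [hηx, setIntegral_map hA hkt.aestronglyMeasurable (S.measurable_tuple x).aemeasurable]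
  have e2 : ∫ y in A, k (Total.mk x t, y) ∂η (Total.mk x t) =
      ∫ y in A, u (Total.mk x t) y ∂η (Total.mk x t) :=
    integral_congr_ae (ae_restrict_of_ae (h4.mono fun y hy => hy.symm))
  rw [e1, e2, hu' _ A hA]
  change N.N x t _ = _
  congr 1
  refine funext fun (g : ArrowsTo X x) => ?_
  have e3 : Φ A (Total.mk x t, Total.mk x g) = ∫ y in S.tuple x ⁻¹' A,
      H (I (Total.mk x g)) (x, Fin.cons (Total.mk x t) (S.tuple x y)) ∂S.tupleMeasure q x := by
    exact setIntegral_map hA (hHz _ (Total.mk x t)).aestronglyMeasurable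
      (S.measurable_tuple x).aemeasurable
  refine e3.trans (integral_congr_ae (ae_restrict_of_ae ?_))
  filter_upwards [h5 (I (Total.mk x g)), h6 g] with y h9 h10
  rw [hIγ] at h9
  have e4 : S.tuple x (Fin.cons t y) = Fin.cons (Total.mk x t) (S.tuple x y) := by
    funext i
    refine Fin.cases ?_ (fun j => ?_) i <;> rfl
  rw [e4] at h9
  simp only [hH, ← h9]
  refine if_pos ((ContinuousLinearMap.le_opNorm _ _).trans ?_)
  exact (mul_le_mul (h10.trans (h3 g)) (hw x) (norm_nonneg _) hC).trans (mul_one C).le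

/-- A bounded measurable family of classes of functions, indexed by the arrows, has a measurable
field of weak-* means. -/
theorem exists_isMean [StandardBorelSpace X] [IsProbabilityMeasure μ]
    {M : MeasuredGroupoid X μ} (F : SeparableGBundle 𝕜 M) (hM : M.IsTDiscrete)
    (N : InvariantMeans 𝕜 μ S)
    {a : ∀ x, ArrowsTo X x → (tupleBundle μ S F.toGField (q + 1)).fiber x} {C : ℝ}
    (hC : 0 ≤ C) (ha : ∀ᵐ x ∂μ, ∀ g, ‖a x g‖ ≤ C)
    (hmeas : ∀ γ : BorelSection X,
      (fun x => a x (γ x)) ∈ (tupleBundle μ S F.toGField (q + 1)).sections) :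
    ∃ ξ ∈ (tupleBundle μ S F.toGField (q + 1)).sections, ∀ᵐ x ∂μ, ‖ξ x‖ ≤ 4 * C ∧
      IsMean N (F := F.toGField) (a x) (ξ x) := by
  classical
  obtain ⟨σ, hσ, hd⟩ := F.separable
  -- the sections of a dense sequence, rescaled to have norm at most one
  set w : ℕ → ∀ x, F.fiber x := fun j x => (((1 + ‖σ j x‖)⁻¹ : ℝ) : 𝕜) • σ j x with hw
  have hpos : ∀ j x, 0 < 1 + ‖σ j x‖ := fun j x => by positivity
  have hws : ∀ j, w j ∈ F.sections := fun j => by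
    refine F.isMeasurableStructure.smul_mem (fun x => (((1 + ‖σ j x‖)⁻¹ : ℝ) : 𝕜)) ?_ _ (hσ j)
    have h1 := ((F.isMeasurableStructure.norm_measurable _ (hσ j)).const_add 1).inv
    exact (RCLike.measurable_ofReal.comp_aemeasurable h1).aestronglyMeasurable
  have hw1 : ∀ j x, ‖w j x‖ ≤ 1 := fun j x => by
    rw [hw, norm_smul, RCLike.norm_ofReal, abs_of_pos (inv_pos.2 (hpos j x)),
      inv_mul_le_iff₀ (hpos j x)]
    linarith
  have hwσ : ∀ j x, (((1 + ‖σ j x‖ : ℝ)) : 𝕜) • w j x = σ j x := fun j x => by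
    rw [hw, smul_smul, ← RCLike.ofReal_mul, mul_inv_cancel₀ (hpos j x).ne', RCLike.ofReal_one,
      one_smul]
  choose K hK hKe using fun j => exists_mean_values hM N hC ha (hw1 j)
    fun γ => hmeas γ (w j) (hws j)
  have hex : ∀ᵐ x ∂μ, ∃ ξ : (tupleBundle μ S F.toGField (q + 1)).fiber x, ‖ξ‖ ≤ 4 * C ∧
      IsMean N (F := F.toGField) (a x) ξ ∧ ∀ j, ∀ᵐ s ∂S.tupleMeasure (q + 1) x,
        (WLinf.rep ξ).fn s (w j x) = K j (S.tuple x s) := by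
    filter_upwards [ae_all_iff.2 hKe, ha, hd, F.ae_separableSpace] with x h1 h2 h3 h4
    have hcount := hM.countable M x
    refine exists_isMean_of_values N hC h2 (fun j => w j x) (fun j => ((1 + ‖σ j x‖ : ℝ) : 𝕜)) ?_
      (fun j s => K j (S.tuple x s)) (fun j => (hK j).comp_measurable (S.measurable_tuple x))
      (ae_all_iff.2 h1)
    simp_rw [hwσ]
    exact h3
  set ξ : ∀ x, (tupleBundle μ S F.toGField (q + 1)).fiber x := fun x =>
    if h : ∃ ξ : (tupleBundle μ S F.toGField (q + 1)).fiber x, ‖ξ‖ ≤ 4 * C ∧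
      IsMean N (F := F.toGField) (a x) ξ ∧ ∀ j, ∀ᵐ s ∂S.tupleMeasure (q + 1) x,
        (WLinf.rep ξ).fn s (w j x) = K j (S.tuple x s) then h.choose else 0 with hξ
  have hξx : ∀ᵐ x ∂μ, ‖ξ x‖ ≤ 4 * C ∧ IsMean N (F := F.toGField) (a x) (ξ x) ∧
      ∀ j, ∀ᵐ s ∂S.tupleMeasure (q + 1) x,
        (WLinf.rep (ξ x)).fn s (w j x) = K j (S.tuple x s) := by
    filter_upwards [hex] with x hx
    have e : ξ x = hx.choose := dif_pos hx
    rw [e]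
    exact hx.choose_spec
  refine ⟨ξ, ?_, hξx.mono fun x hx => ⟨hx.1, hx.2.1⟩⟩
  refine mem_tupleBundle_sections.2 fun ζ hζ => isJoint_of_dense F hσ hd
    (f := fun x => (WLinf.rep (ξ x)).fn) (fun j => ?_) hζ
  have h1 : IsJoint μ S (q + 1) fun x s => K j (S.tuple x s) :=
    ⟨fun p => K j p.2, (hK j).comp_measurable measurable_snd,
      ae_of_all _ fun x => ae_of_all _ fun s => rfl⟩
  have h2 : AEStronglyMeasurable (fun x => ((1 + ‖σ j x‖ : ℝ) : 𝕜)) μ :=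
    (RCLike.measurable_ofReal.comp_aemeasurable
      ((F.isMeasurableStructure.norm_measurable _ (hσ j)).const_add 1)).aestronglyMeasurable
  refine ((IsJoint.of_base h2).mul h1).congr (hξx.mono fun x hx => ?_)
  filter_upwards [hx.2.2 j] with s hs
  rw [← hs, ← smul_eq_mul, ← map_smul, hwσ]

end ExistsMean

/-! ### Exactness in the groupoid variables -/

section Columns

variable {𝕜 : Type} [RCLike 𝕜] {X : Type u} [MeasurableSpace X] [BorelGroupoid X] {μ : Measure X}
  {M : MeasuredGroupoid X μ} {S : GSpace X} {p q : ℕ}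

theorem norm_neg_one_pow_smul {A : Type*} [NormedAddCommGroup A] [NormedSpace 𝕜 A] (n : ℕ) (v : A) :
    ‖(-1 : 𝕜) ^ n • v‖ = ‖v‖ := by
  rw [norm_smul, norm_pow, norm_neg, norm_one, one_pow, one_mul]

theorem tupleBundle_sections_congr {F : GField 𝕜 X} {ξ ζ : ∀ x, (tupleBundle μ S F q).fiber x}
    (hξ : ξ ∈ (tupleBundle μ S F q).sections) (h : ∀ᵐ x ∂μ, ζ x = ξ x) :
    ζ ∈ (tupleBundle μ S F q).sections := fun σ hσ =>
  (hξ σ hσ).congr (h.mono fun x hx => ae_of_all _ fun s => by rw [hx])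

/-- The weak-* mean of a family bounded by `C`, if it exists, and `0` otherwise. The bound `4 * C` is
the one that `exists_isMean` provides. -/
def weakMean {F : GField 𝕜 X} {x : X} (N : InvariantMeans 𝕜 μ S) (C : ℝ)
    (a : ArrowsTo X x → WLinf 𝕜 (S.tupleMeasure (q + 1) x) (F.fiber x)) :
    WLinf 𝕜 (S.tupleMeasure (q + 1) x) (F.fiber x) :=
  open Classical in
  if h : ∃ ξ : WLinf 𝕜 (S.tupleMeasure (q + 1) x) (F.fiber x), ‖ξ‖ ≤ 4 * C ∧ IsMean N a ξ
  then h.choose else 0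

theorem norm_weakMean_le {F : GField 𝕜 X} {x : X} (N : InvariantMeans 𝕜 μ S) {C : ℝ} (hC : 0 ≤ C)
    (a : ArrowsTo X x → WLinf 𝕜 (S.tupleMeasure (q + 1) x) (F.fiber x)) :
    ‖weakMean N C a‖ ≤ 4 * C := by
  unfold weakMean
  split_ifs with h
  · exact h.choose_spec.1
  · rw [norm_zero]; linarith

theorem isMean_weakMean {F : GField 𝕜 X} {x : X} {N : InvariantMeans 𝕜 μ S} {C : ℝ}
    {a : ArrowsTo X x → WLinf 𝕜 (S.tupleMeasure (q + 1) x) (F.fiber x)}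
    (h : ∃ ξ : WLinf 𝕜 (S.tupleMeasure (q + 1) x) (F.fiber x), ‖ξ‖ ≤ 4 * C ∧ IsMean N a ξ) :
    IsMean N a (weakMean N C a) := by
  unfold weakMean
  rw [dif_pos h]
  exact h.choose_spec.2

/-- The columns `q ≥ 1` are exact: the mean over the first groupoid variable, in the weak-* sense, is
a contracting homotopy. -/
theorem exists_cochain_cochainD [StandardBorelSpace X] [IsProbabilityMeasure μ]
    (F : SeparableGBundle 𝕜 M) (hM : M.IsTDiscrete) (N : InvariantMeans 𝕜 μ S)
    {f : ∀ x, (Fin (p + 1) → ArrowsTo X x) → (tupleBundle μ S F.toGField (q + 1)).fiber x}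
    (hf : f ∈ cochains μ (tupleBundle μ S F.toGField (q + 1)) (p + 1))
    (hd : ∀ᵐ x ∂μ, ∀ h, altSum 𝕜 (p + 1) (f x) h = 0) :
    ∃ b ∈ cochains μ (tupleBundle μ S F.toGField (q + 1)) p,
      ∀ᵐ x ∂μ, ∀ h, altSum 𝕜 p (b x) h = f x h := by
  obtain ⟨γ, hγ⟩ := exists_borelSection_enum M hM
  obtain ⟨C', hC'⟩ := hf.2.1
  set C := max C' 0
  have hC : 0 ≤ C := le_max_right _ _
  have hfC : ∀ᵐ x ∂μ, ∀ h, ‖f x h‖ ≤ C := hC'.mono fun x hx h => (hx h).trans (le_max_left _ _)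
  have hsec : ∀ δ : Fin p → BorelSection X,
      ∃ ξ ∈ (tupleBundle μ S F.toGField (q + 1)).sections, ∀ᵐ x ∂μ, ‖ξ x‖ ≤ 4 * C ∧
        IsMean N (F := F.toGField) (fun g => f x (Fin.cons g fun i => δ i x)) (ξ x) := by
    intro δ
    refine exists_isMean F hM N hC (hfC.mono fun x hx g => hx _) fun ε => ?_
    have h := hf.1 (Fin.cons ε δ : Fin (p + 1) → BorelSection X)
    convert h using 3
    rename_i x
    funext i
    refine Fin.cases ?_ (fun j => ?_) i <;> rfl
  set b : ∀ x, (Fin p → ArrowsTo X x) → (tupleBundle μ S F.toGField (q + 1)).fiber x :=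
    fun x h => weakMean (F := F.toGField) N C fun g => f x (Fin.cons g h)
  have hb : ∀ᵐ x ∂μ, ∀ h, IsMean N (F := F.toGField) (fun g => f x (Fin.cons g h)) (b x h) := by
    have h1 : ∀ᵐ x ∂μ, ∀ k : Fin p → ℕ, ∃ ξ, ‖ξ‖ ≤ 4 * C ∧
        IsMean N (F := F.toGField) (fun g => f x (Fin.cons g fun i => γ (k i) x)) ξ := by
      refine ae_all_iff.2 fun k => ?_
      obtain ⟨ξ, -, hξ⟩ := hsec fun i => γ (k i)
      exact hξ.mono fun x hx => ⟨ξ x, hx⟩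
    filter_upwards [h1] with x hx h
    choose k hk using fun i => hγ x (h i)
    obtain rfl : (fun i => γ (k i) x) = h := funext hk
    exact isMean_weakMean (hx k)
  refine ⟨b, ⟨fun δ => ?_, ⟨4 * C, ae_of_all _ fun x h => norm_weakMean_le N hC _⟩, ?_⟩, ?_⟩
  · obtain ⟨ξ, hξ, hξ'⟩ := hsec δ
    refine tupleBundle_sections_congr hξ ?_
    filter_upwards [hb, hξ', F.ae_separableSpace] with x h1 h2 h3
    exact (h1 _).unique h2.2
  · filter_upwards [hb, hM.ae_source M hb, hfC, hM.ae_source M hfC, hf.2.2, N.invariant,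
      F.ae_separableSpace, hM.ae_source M F.ae_separableSpace] with x h1 h2 h3 h4 h5 h6 h7 h8 g h
    have h9 := h8 g
    refine IsMean.unique (N := N) (IsMean.act (hM.countable M x) h6 g (hM.countable M g.1)
      (fun k => h3 (Fin.cons k fun i => leftMul g.2 (h i))) (fun k => h4 g (Fin.cons k h))
      (fun k => ?_) (h2 g h)) (h1 fun i => leftMul g.2 (h i))
    rw [h5]
    congr 1
    funext i
    refine Fin.cases ?_ (fun j => ?_) i <;> rfl
  · filter_upwards [hb, hfC, hd, F.ae_separableSpace] with x h1 h2 h3 h4 h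
    have hcount := hM.countable M x
    have h5 : IsMean N (F := F.toGField) (fun g => ∑ i : Fin (p + 1), (-1 : 𝕜) ^ (i : ℕ) •
        f x (Fin.cons g fun j => h (i.succAbove j))) (altSum 𝕜 p (b x) h) := by
      refine IsMean.sum (C := C) Finset.univ (fun i g => ?_) fun i =>
        (h1 fun j => h (i.succAbove j)).smul (fun g => h2 _) _
      exact (norm_neg_one_pow_smul (𝕜 := 𝕜) i _).trans_le
          (h2 (Fin.cons g fun j => h (i.succAbove j)))
    refine h5.unique ?_
    have e : (fun g => ∑ i : Fin (p + 1), (-1 : 𝕜) ^ (i : ℕ) •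
        f x (Fin.cons g fun j => h (i.succAbove j))) = fun _ => f x h := by
      funext g
      have h6 := altSum_cons (𝕜 := 𝕜) p (f x) g h
      rw [h3] at h6
      exact (sub_eq_zero.1 h6.symm).symm
    exact (congrArg (fun a => IsMean N (F := F.toGField) a (f x h)) e).mpr (IsMean.const _)

end Columns

/-! ### The morphism of complexes obtained by integrating over translates -/

section PiMeasures

variable {Y : Type u} [MeasurableSpace Y]

theorem pi_absolutelyContinuous {q : ℕ} (m m' : Fin q → Measure Y) [∀ i, IsProbabilityMeasure (m i)]
    [∀ i, IsProbabilityMeasure (m' i)] (h : ∀ i, m i ≪ m' i) : Measure.pi m ≪ Measure.pi m' := by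
  induction q with
  | zero => rw [Measure.pi_of_empty m, Measure.pi_of_empty m']
  | succ q ih =>
    have e1 := (measurePreserving_piFinSuccAbove m 0).symm
    have e2 := (measurePreserving_piFinSuccAbove m' 0).symm
    rw [← e1.map_eq, ← e2.map_eq]
    exact ((h 0).prod (ih _ _ fun i => h _)).map e1.measurable

theorem measurePreserving_omit {q : ℕ} (m : Fin (q + 1) → Measure Y)
    [∀ i, IsProbabilityMeasure (m i)] (i : Fin (q + 1)) :
    MeasurePreserving (fun (s : Fin (q + 1) → Y) j => s (i.succAbove j)) (Measure.pi m)
      (Measure.pi fun j => m (i.succAbove j)) :=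
  measurePreserving_snd.comp (measurePreserving_piFinSuccAbove m i)

end PiMeasures

section Translate

variable {𝕜 : Type} [RCLike 𝕜] {X : Type u} [MeasurableSpace X] [BorelGroupoid X] {μ : Measure X}
  {M : MeasuredGroupoid X μ} {S : GSpace X} {F F' : GField 𝕜 X} {q : ℕ} {x : X}

/-- All tuples of arrows have positive measure. -/
theorem MeasuredGroupoid.IsTDiscrete.ae_tuple_iff (hM : M.IsTDiscrete)
    {P : (Fin q → ArrowsTo X x) → Prop} :
    (∀ᵐ g ∂M.regular.tupleMeasure q x, P g) ↔ ∀ g, P g := by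
  refine ⟨fun h g => ?_, fun h => ae_of_all _ h⟩
  by_contra hc
  have h0 : (Measure.pi fun _ : Fin q => M.ν x) {g} = 0 :=
    measure_mono_null (by rintro _ rfl; exact hc) h
  rw [Measure.pi_singleton, Finset.prod_eq_zero_iff] at h0
  obtain ⟨i, -, hi⟩ := h0
  exact hM.ν_singleton_ne_zero M x (g i) hi

/-- The product of the translates of `τ` by the arrows of a tuple. -/
abbrev GSpace.pushTuple (S : GSpace X) (g : Fin q → ArrowsTo X x) : Measure (Fin q → S.fiber x) :=
  Measure.pi fun i => S.push (g i)

instance (g : Fin q → ArrowsTo X x) : IsProbabilityMeasure (S.pushTuple g) :=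
  Measure.pi.instIsProbabilityMeasure _

theorem GSpace.pushTuple_absolutelyContinuous (g : Fin q → ArrowsTo X x) :
    S.pushTuple g ≪ S.tupleMeasure q x :=
  pi_absolutelyContinuous _ _ fun i => S.push_absolutelyContinuous (g i)

theorem rep_mem_weakStarBounded (u : WLinf 𝕜 (S.tupleMeasure q x) (F.fiber x))
    {m' : Measure (Fin q → S.fiber x)} (h : m' ≪ S.tupleMeasure q x) :
    u.rep.fn ∈ weakStarBounded 𝕜 m' (F.fiber x) :=
  ⟨fun v => (u.rep.meas v).mono_ac h, ‖u‖, h.ae_le u.ae_norm_rep_le⟩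

theorem norm_weakIntegral_rep_le (u : WLinf 𝕜 (S.tupleMeasure q x) (F.fiber x))
    (g : Fin q → ArrowsTo X x) : ‖weakIntegral 𝕜 (S.pushTuple g) u.rep.fn‖ ≤ ‖u‖ :=
  norm_weakIntegral_le (norm_nonneg u) ((S.pushTuple_absolutelyContinuous g).ae_le u.ae_norm_rep_le)

/-- The function `g ↦ ∫ u d(g_1 τ ⊗ ⋯ ⊗ g_q τ)` on tuples of arrows with target `x`. -/
def translatePre (hM : M.IsTDiscrete) (u : WLinf 𝕜 (S.tupleMeasure q x) (F.fiber x)) :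
    WLinfPre 𝕜 (M.regular.tupleMeasure q x) (F.fiber x) :=
  ⟨fun g : Fin q → ArrowsTo X x => weakIntegral 𝕜 (S.pushTuple g) u.rep.fn, fun v => by
    have := hM.countable M x
    have h : Measurable fun g : Fin q → ArrowsTo X x =>
      weakIntegral 𝕜 (S.pushTuple g) u.rep.fn v := measurable_of_countable _
    exact h.aestronglyMeasurable, ‖u‖, ae_of_all _ fun g => norm_weakIntegral_rep_le u g⟩

theorem translatePre_apply (hM : M.IsTDiscrete) (u : WLinf 𝕜 (S.tupleMeasure q x) (F.fiber x))
    (g : Fin q → ArrowsTo X x) (v : F.fiber x) :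
    (translatePre hM u).fn g v = ∫ s, u.rep.fn s v ∂S.pushTuple g :=
  weakIntegral_apply (rep_mem_weakStarBounded u (S.pushTuple_absolutelyContinuous g)) v

theorem integrable_rep_apply (u : WLinf 𝕜 (S.tupleMeasure q x) (F.fiber x))
    (g : Fin q → ArrowsTo X x) (v : F.fiber x) :
    Integrable (fun s => u.rep.fn s v) (S.pushTuple g) :=
  WLinfPre.integrable_apply (⟨u.rep.fn, rep_mem_weakStarBounded u
    (S.pushTuple_absolutelyContinuous g)⟩ : WLinfPre 𝕜 (S.pushTuple g) (F.fiber x)) v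

theorem integral_rep_congr {u : WLinf 𝕜 (S.tupleMeasure q x) (F.fiber x)}
    {f : (Fin q → S.fiber x) → StrongDual 𝕜 (F.fiber x)}
    (h : ∀ᵐ s ∂S.tupleMeasure q x, u.rep.fn s = f s) (g : Fin q → ArrowsTo X x) (v : F.fiber x) :
    ∫ s, u.rep.fn s v ∂S.pushTuple g = ∫ s, f s v ∂S.pushTuple g :=
  integral_congr_ae (Eventually.mono ((S.pushTuple_absolutelyContinuous g).ae_le h)
    fun _ hs => congrArg (fun θ : StrongDual 𝕜 (F.fiber x) => θ v) hs)

theorem translatePre_add (hM : M.IsTDiscrete) (u u' : WLinf 𝕜 (S.tupleMeasure q x) (F.fiber x))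
    (g : Fin q → ArrowsTo X x) (v : F.fiber x) : (translatePre hM (u + u')).fn g v =
      (translatePre hM u).fn g v + (translatePre hM u').fn g v := by
  rw [translatePre_apply, translatePre_apply, translatePre_apply,
    integral_rep_congr (WLinf.rep_add_ae u u')]
  exact integral_add (integrable_rep_apply u g v) (integrable_rep_apply u' g v)

theorem translatePre_smul (hM : M.IsTDiscrete) (c : 𝕜)
    (u : WLinf 𝕜 (S.tupleMeasure q x) (F.fiber x)) (g : Fin q → ArrowsTo X x) (v : F.fiber x) :
    (translatePre hM (c • u)).fn g v = c * (translatePre hM u).fn g v := by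
  rw [translatePre_apply, translatePre_apply, integral_rep_congr (WLinf.rep_smul_ae c u)]
  exact integral_const_mul c _

/-- The operator that integrates functions of `q` points of `S^x` over the translates of `τ` by
tuples of arrows. -/
def translate (hM : M.IsTDiscrete) (S : GSpace X) (F : GField 𝕜 X) (q : ℕ) (x : X) :
    WLinf 𝕜 (S.tupleMeasure q x) (F.fiber x) →L[𝕜]
      WLinf 𝕜 (M.regular.tupleMeasure q x) (F.fiber x) :=
  LinearMap.mkContinuous
    { toFun := fun u => WLinf.mk _ (translatePre hM u)
      map_add' := fun u u' => by
        rw [← map_add]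
        refine (WLinf.mk_eq_mk _ _ _).2 (ae_of_all _ fun g => ContinuousLinearMap.ext fun v => ?_)
        exact translatePre_add hM u u' g v
      map_smul' := fun c u => by
        rw [← map_smul]
        refine (WLinf.mk_eq_mk _ _ _).2 (ae_of_all _ fun g => ContinuousLinearMap.ext fun v => ?_)
        exact translatePre_smul hM c u g v } 1
    fun u => by
      rw [one_mul]
      refine (WLinf.norm_mk _ _).trans_le (WLinfPre.norm_le _ (norm_nonneg u)
        (ae_of_all _ fun g => norm_weakIntegral_rep_le u g))

theorem norm_translate_le (hM : M.IsTDiscrete) : ‖translate hM S F q x‖ ≤ 1 :=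
  LinearMap.mkContinuous_norm_le _ zero_le_one _

theorem rep_translate_apply (hM : M.IsTDiscrete) (u : WLinf 𝕜 (S.tupleMeasure q x) (F.fiber x))
    (g : Fin q → ArrowsTo X x) (v : F.fiber x) :
    (translate hM S F q x u).rep.fn g v = ∫ s, u.rep.fn s v ∂S.pushTuple g := by
  have h := hM.ae_tuple_iff.1 (WLinf.rep_mk_ae (translatePre hM u)) g
  refine (congrArg (fun θ : StrongDual 𝕜 (F.fiber x) => θ v) h).trans ?_
  exact translatePre_apply hM u g v

theorem regular_ext {u u' : WLinf 𝕜 (M.regular.tupleMeasure q x) (F.fiber x)}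
    (h : ∀ (g : Fin q → ArrowsTo X x) v, u.rep.fn g v = u'.rep.fn g v) : u = u' :=
  WLinf.ext_rep (ae_of_all _ fun g => ContinuousLinearMap.ext (h g))

theorem translate_tupleCoboundary (hM : M.IsTDiscrete)
    (u : WLinf 𝕜 (S.tupleMeasure q x) (F.fiber x)) :
    translate hM S F (q + 1) x (tupleCoboundary S F q x u) =
      tupleCoboundary M.regular F q x (translate hM S F q x u) := by
  refine regular_ext fun g v => ?_
  have h := hM.ae_tuple_iff.1 (rep_tupleCoboundary_ae x (translate hM S F q x u)) g
  refine (rep_translate_apply hM _ g v).trans (Eq.trans ?_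
    ((congrArg (fun θ : StrongDual 𝕜 (F.fiber x) => θ v) h).trans (altSum_apply _ _ _ _)).symm)
  refine (integral_rep_congr (rep_tupleCoboundary_ae x u) g v).trans ?_
  simp_rw [altSum_apply]
  have hmp := fun i : Fin (q + 1) => measurePreserving_omit (fun j => S.push (g j)) i
  have hi : ∀ i : Fin (q + 1), Integrable (fun s : Fin (q + 1) → S.fiber x =>
      u.rep.fn (fun j => s (i.succAbove j)) v) (S.pushTuple g) := fun i =>
    (hmp i).integrable_comp_of_integrable (integrable_rep_apply u (fun j => g (i.succAbove j)) v)
  unfold altSum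
  refine (integral_finsetSum (f := fun (i : Fin (q + 1)) (s : Fin (q + 1) → S.fiber x) =>
    (-1 : 𝕜) ^ (i : ℕ) • u.rep.fn (fun j => s (i.succAbove j)) v) Finset.univ
    fun i _ => (hi i).smul ((-1 : 𝕜) ^ (i : ℕ))).trans ?_
  refine Finset.sum_congr rfl fun i _ => ?_
  rw [integral_smul]
  congr 1
  refine Eq.trans ?_ (rep_translate_apply hM u (fun j => g (i.succAbove j)) v).symm
  have h2 := (integrable_rep_apply u (fun j => g (i.succAbove j)) v).1
  have e : S.pushTuple (fun j => g (i.succAbove j)) =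
      (S.pushTuple g).map fun s j => s (i.succAbove j) := (hmp i).map_eq.symm
  rw [e] at h2 ⊢
  exact (integral_map (hmp i).measurable.aemeasurable h2).symm

theorem translate_act (hM : M.IsTDiscrete) {y : X} (g : x ⟶ y)
    (u : (tupleBundle μ S F q).fiber x) :
    translate hM S F q y ((tupleBundle μ S F q).act g u) =
      (tupleBundle μ M.regular F q).act g (translate hM S F q x u) := by
  refine regular_ext fun k v => ?_
  have h := hM.ae_tuple_iff.1 (tupleBundle_rep_act_ae (μ := μ) (S := M.regular) g
    (translate hM S F q x u)) k
  refine (rep_translate_apply hM _ k v).trans (Eq.trans ?_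
    (congrArg (fun θ : StrongDual 𝕜 (F.fiber y) => θ v) h).symm)
  refine (integral_rep_congr (tupleBundle_rep_act_ae (μ := μ) g u) k v).trans ?_
  refine Eq.trans ?_ (rep_translate_apply hM u (fun i => leftMul (Groupoid.inv g) (k i))
    (F.actL (Groupoid.inv g) v)).symm
  have hm : Measurable (S.actTuple q (Groupoid.inv g)) :=
    (S.quasiMeasurePreserving_actTuple q (Groupoid.inv g)).measurable
  have e : S.pushTuple (fun i => leftMul (Groupoid.inv g) (k i)) =
      (S.pushTuple k).map (S.actTuple q (Groupoid.inv g)) := by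
    have h1 := Measure.pi_map_pi (μ := fun i => S.push (k i)) (f := fun _ => S.act (Groupoid.inv g))
      fun i => (S.measurable_act' _).aemeasurable
    refine Eq.trans ?_ h1.symm
    simp only [GSpace.pushTuple, GSpace.push_leftMul]
  have h2 := (integrable_rep_apply u (fun i => leftMul (Groupoid.inv g) (k i))
    (F.actL (Groupoid.inv g) v)).1
  rw [e] at h2 ⊢
  rw [integral_map hm.aemeasurable h2]
  rfl

theorem translate_mem_sections [StandardBorelSpace X] (hM : M.IsTDiscrete)
    {ξ : ∀ x, (tupleBundle μ S F q).fiber x} (hξ : ξ ∈ (tupleBundle μ S F q).sections) :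
    (fun x => translate hM S F q x (ξ x)) ∈ (tupleBundle μ M.regular F q).sections := by
  obtain ⟨γ, hγ⟩ := exists_borelSection_enum M hM
  obtain ⟨I, hI, hIγ⟩ := exists_measurable_index hγ
  refine mem_tupleBundle_sections.2 fun σ hσ => ?_
  have hJ : ∀ k : Fin q → ℕ, AEStronglyMeasurable (fun x =>
      ∫ s, (WLinf.rep (ξ x)).fn s (σ x) ∂S.pushTuple fun i => γ (k i) x) μ := by
    intro k
    have hk := S.measurable_pi_map_tuple (fun i x => S.push (γ (k i) x))
      fun i => S.isMeasurableFamily_push (γ (k i))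
    set κ : ProbabilityTheory.Kernel X (Fin q → Total S.fiber) := ⟨_, hk⟩ with hκ
    have : ProbabilityTheory.IsMarkovKernel κ :=
      ⟨fun x => Measure.isProbabilityMeasure_map (S.measurable_tuple x).aemeasurable⟩
    exact (hξ σ hσ).aestronglyMeasurable_integral κ (fun x => S.pushTuple fun i => γ (k i) x)
      (fun x => rfl) fun x => S.pushTuple_absolutelyContinuous _
  choose J hJm hJe using hJ
  refine ⟨fun p => J (fun i => I (p.2 i)) p.1, ?_, ?_⟩
  · have h : Measurable fun p : (Fin q → ℕ) × X => J p.1 p.2 :=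
      measurable_from_prod_countable_right fun k => (hJm k).measurable
    refine (h.comp (Measurable.prodMk ?_ measurable_fst)).stronglyMeasurable
    exact measurable_pi_lambda _ fun i => hI.comp ((measurable_pi_apply i).comp measurable_snd)
  · filter_upwards [ae_all_iff.2 hJe] with x hx
    refine ae_of_all _ fun g => (rep_translate_apply hM (ξ x) g (σ x)).trans ?_
    have e : (fun i => γ (I (Total.mk x (g i))) x) = g := funext fun i => hIγ x (g i)
    refine Eq.trans ?_ (hx fun i => I (Total.mk x (g i)))
    exact congrArg (fun g : Fin q → ArrowsTo X x =>
      ∫ s, (WLinf.rep (ξ x)).fn s (σ x) ∂S.pushTuple g) e.symm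

/-- Integration over translates is natural in the coefficients. -/
theorem translate_pull (hM : M.IsTDiscrete) (θ : F.fiber x →L[𝕜] F'.fiber x)
    (u : WLinf 𝕜 (S.tupleMeasure q x) (F'.fiber x)) :
    translate hM S F q x (WLinf.pull id (Measure.QuasiMeasurePreserving.id _) θ u) =
      WLinf.pull id (Measure.QuasiMeasurePreserving.id _) θ (translate hM S F' q x u) := by
  refine regular_ext fun g v => ?_
  have h := hM.ae_tuple_iff.1 (WLinf.rep_pull_ae id (Measure.QuasiMeasurePreserving.id _) θ
    (translate hM S F' q x u)) g
  refine (rep_translate_apply hM _ g v).trans (Eq.trans ?_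
    (congrArg (fun θ : StrongDual 𝕜 (F.fiber x) => θ v) h).symm)
  refine (integral_rep_congr (WLinf.rep_pull_ae id (Measure.QuasiMeasurePreserving.id _) θ u)
    g v).trans ?_
  exact (rep_translate_apply hM u g (θ v)).symm

end Translate

/-! ### Functions of no variables -/

section Zero

variable {𝕜 : Type} [RCLike 𝕜] {X : Type u} [MeasurableSpace X] [BorelGroupoid X] {μ : Measure X}
  {M : MeasuredGroupoid X μ} {S T : GSpace X} {F : GField 𝕜 X} {x : X}

theorem ae_tuple_zero_iff {P : (Fin 0 → S.fiber x) → Prop} :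
    (∀ᵐ s ∂S.tupleMeasure 0 x, P s) ↔ P default := by
  refine ⟨fun h => ?_, fun h => ae_of_all _ fun s => Subsingleton.elim default s ▸ h⟩
  obtain ⟨s, hs⟩ := h.exists
  exact Subsingleton.elim s default ▸ hs

theorem rep_zero_ext {u u' : WLinf 𝕜 (S.tupleMeasure 0 x) (F.fiber x)}
    (h : u.rep.fn default = u'.rep.fn default) : u = u' :=
  WLinf.ext_rep (ae_tuple_zero_iff.2 h)

/-- The value of a class of functions of no variables. -/
def zeroEval (S : GSpace X) (F : GField 𝕜 X) (x : X) :
    WLinf 𝕜 (S.tupleMeasure 0 x) (F.fiber x) →L[𝕜] StrongDual 𝕜 (F.fiber x) :=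
  LinearMap.mkContinuous
    { toFun := fun u => u.rep.fn default
      map_add' := fun u u' => ae_tuple_zero_iff.1 (WLinf.rep_add_ae u u')
      map_smul' := fun c u => ae_tuple_zero_iff.1 (WLinf.rep_smul_ae c u) } 1
    fun u => by
      rw [one_mul]
      exact ae_tuple_zero_iff.1 u.ae_norm_rep_le

theorem zeroEval_apply (u : WLinf 𝕜 (S.tupleMeasure 0 x) (F.fiber x)) :
    zeroEval S F x u = u.rep.fn default := rfl

theorem rep_const_ae {q : ℕ} (e : StrongDual 𝕜 (F.fiber x)) :
    ∀ᵐ s ∂S.tupleMeasure q x, (WLinf.const (S.tupleMeasure q x) e).rep.fn s = e :=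
  WLinf.rep_mk_ae _

theorem zeroEval_const (e : StrongDual 𝕜 (F.fiber x)) :
    zeroEval S F x (WLinf.const (S.tupleMeasure 0 x) e) = e :=
  ae_tuple_zero_iff.1 (rep_const_ae (S := S) (q := 0) e)

/-- The inclusion of the constant functions is the coboundary of functions of no variables. -/
theorem tupleCoboundary_zero (u : WLinf 𝕜 (S.tupleMeasure 0 x) (F.fiber x)) :
    tupleCoboundary S F 0 x u = WLinf.const (S.tupleMeasure 1 x) (zeroEval S F x u) := by
  refine WLinf.ext_rep ?_
  filter_upwards [rep_tupleCoboundary_ae x u, rep_const_ae (S := S) (q := 1) (zeroEval S F x u)]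
    with s h1 h2
  rw [h1, h2, altSum, Fin.sum_univ_one, zeroEval_apply]
  simp only [Fin.val_zero, pow_zero, one_smul]
  exact congrArg u.rep.fn (Subsingleton.elim _ _)

/-- The identification of the bundles of functions of no variables for two `G`-spaces. -/
def zeroTransfer (S T : GSpace X) (F : GField 𝕜 X) (x : X) :
    WLinf 𝕜 (S.tupleMeasure 0 x) (F.fiber x) →L[𝕜] WLinf 𝕜 (T.tupleMeasure 0 x) (F.fiber x) :=
  (WLinf.const (T.tupleMeasure 0 x)).comp (zeroEval S F x)

theorem zeroEval_zeroTransfer (u : WLinf 𝕜 (S.tupleMeasure 0 x) (F.fiber x)) :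
    zeroEval T F x (zeroTransfer S T F x u) = zeroEval S F x u :=
  zeroEval_const _

theorem zeroTransfer_zeroTransfer (u : WLinf 𝕜 (S.tupleMeasure 0 x) (F.fiber x)) :
    zeroTransfer T S F x (zeroTransfer S T F x u) = u :=
  rep_zero_ext ((zeroEval_zeroTransfer (S := T) (T := S) _).trans (zeroEval_zeroTransfer u))

theorem zeroEval_act {y : X} (g : x ⟶ y) (u : (tupleBundle μ S F 0).fiber x) :
    zeroEval S F y ((tupleBundle μ S F 0).act g u) =
      (zeroEval S F x u).comp (F.actL (Groupoid.inv g)) := by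
  refine (ae_tuple_zero_iff.1 (tupleBundle_rep_act_ae g u)).trans ?_
  exact congrArg (fun s => ((WLinf.rep u).fn s).comp (F.actL (Groupoid.inv g)))
    (Subsingleton.elim _ _)

theorem zeroTransfer_act {y : X} (g : x ⟶ y) (u : (tupleBundle μ S F 0).fiber x) :
    zeroTransfer S T F y ((tupleBundle μ S F 0).act g u) =
      (tupleBundle μ T F 0).act g (zeroTransfer S T F x u) := by
  refine rep_zero_ext ?_
  refine (zeroEval_zeroTransfer _).trans ((zeroEval_act g u).trans ?_)
  refine Eq.trans ?_ (zeroEval_act (μ := μ) (S := T) g (zeroTransfer S T F x u)).symm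
  exact congrArg (fun θ : StrongDual 𝕜 (F.fiber x) => θ.comp (F.actL (Groupoid.inv g)))
    (zeroEval_zeroTransfer (S := S) (T := T) u).symm

/-- The identification of the bundles of functions of no variables, as a morphism of bundles. -/
def zeroTransferHom (M : MeasuredGroupoid X μ) (S T : GSpace X) (F : GField 𝕜 X) :
    GMorphism M (tupleBundle μ S F 0) (tupleBundle μ T F 0) where
  toFun := zeroTransfer S T F
  measurable ξ hξ := mem_tupleBundle_sections.2 fun σ hσ => by
    have h1 : IsJoint μ S 0 fun x _ => zeroEval S F x (ξ x) (σ x) :=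
      (hξ σ hσ).congr (ae_of_all _ fun x => ae_tuple_zero_iff.2 rfl)
    refine (IsJoint.zero_iff.2 (IsJoint.zero_iff.1 h1)).congr (ae_of_all _ fun x => ?_)
    refine ae_tuple_zero_iff.2 ?_
    exact congrArg (fun θ : StrongDual 𝕜 (F.fiber x) => θ (σ x))
      (zeroEval_zeroTransfer (S := S) (T := T) (ξ x))
  bounded := by
    refine ⟨1, ae_of_all _ fun x => ContinuousLinearMap.opNorm_le_bound _ zero_le_one fun u => ?_⟩
    rw [one_mul]
    refine (WLinf.norm_rep _).symm.trans_le (WLinfPre.norm_le _ (norm_nonneg u) ?_)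
    refine ae_tuple_zero_iff.2 ?_
    refine (congrArg norm (zeroEval_zeroTransfer (S := S) (T := T) u)).trans_le ?_
    exact ae_tuple_zero_iff.1 (WLinf.ae_norm_rep_le u)
  equivariant := ae_of_all _ fun a u => zeroTransfer_act a.2.2 u

end Zero

/-! ### The double complex, and the comparison of the two edge complexes -/

section Double

variable {𝕜 : Type} [RCLike 𝕜] {X : Type u} [MeasurableSpace X] [BorelGroupoid X] {μ : Measure X}
  {M : MeasuredGroupoid X μ} {S T : GSpace X}

theorem altSum_zero {Y A : Type*} [AddCommGroup A] [Module 𝕜 A] (c : (Fin 0 → Y) → A)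
    (s : Fin 1 → Y) : altSum 𝕜 0 c s = c default := by
  rw [altSum, Fin.sum_univ_one, Fin.val_zero, pow_zero, one_smul]
  exact congrArg c (Subsingleton.elim _ _)

/-- The double complex of invariant cochains in the arrows, with values in the functions of tuples of
points of `S`. -/
def cochainDouble [StandardBorelSpace X] [IsProbabilityMeasure μ] (F : SeparableGBundle 𝕜 M)
    (hM : M.IsTDiscrete) (N : InvariantMeans 𝕜 μ S) :
    ExactDouble fun p q => Cochain μ (tupleBundle μ S F.toGField q) p where
  dG p q := (Cochain.d (tupleBundle μ S F.toGField q) p).toAddMonoidHom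
  dS p q := (Cochain.map hM (tupleCoboundaryHom M S F.toGField q) p).toAddMonoidHom
  dG_dG p q c := Cochain.d_d c
  dS_dS p q c := Cochain.map_map_eq_zero hM _ _
    (ae_of_all _ fun x u => tupleCoboundary_tupleCoboundary x u) c
  comm p q c := (Cochain.map_d hM _ c).symm
  row p q c hc := by
    obtain ⟨f, rfl⟩ := Cochain.mk_surjective c
    obtain ⟨f', hf', h⟩ := exists_cochain_tupleCoboundary F hM f.2 (Cochain.mk_eq_zero.1 hc)
    exact ⟨Cochain.mk ⟨f', hf'⟩, Cochain.mk_eq_mk.2 h⟩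
  row_zero p c hc := by
    obtain ⟨f, rfl⟩ := Cochain.mk_surjective c
    exact Cochain.mk_eq_zero.2 ((Cochain.mk_eq_zero.1 hc).mono fun x hx h =>
      tupleCoboundary_injective x (hx h))
  col p q c hc := by
    obtain ⟨f, rfl⟩ := Cochain.mk_surjective c
    obtain ⟨b, hb, h⟩ := exists_cochain_cochainD F hM N f.2 (Cochain.mk_eq_zero.1 hc)
    exact ⟨Cochain.mk ⟨b, hb⟩, Cochain.mk_eq_mk.2 h⟩
  col_zero q c hc := by
    obtain ⟨f, rfl⟩ := Cochain.mk_surjective c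
    refine Cochain.mk_eq_zero.2 ((Cochain.mk_eq_zero.1 hc).mono fun x hx h => ?_)
    refine (congrArg (f.1 x) (Subsingleton.elim h default)).trans ?_
    have h1 : ∀ h : Fin 1 → ArrowsTo X x, altSum 𝕜 0 (f.1 x) h = 0 := hx
    exact (altSum_zero (𝕜 := 𝕜) (f.1 x) _).symm.trans (h1 fun _ => ⟨x, 𝟙 x⟩)

variable {F : GField 𝕜 X} (φ : GComplexHom M (LComplex μ S F) (LComplex μ T F))

/-- A morphism `L(S^{(•+1)}, E) → L(T^{(•+1)}, E)`, completed by the identity of `E` to a morphism of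
the augmented complexes. -/
def tupleHom : ∀ q, GMorphism M (tupleBundle μ S F q) (tupleBundle μ T F q)
  | 0 => zeroTransferHom M S T F
  | n + 1 =>
    { toFun := (φ.hom n).toFun
      measurable := fun σ hσ => by
        rw [tupleBundle_sections_succ] at hσ ⊢
        exact (φ.hom n).measurable σ hσ
      bounded := (φ.hom n).bounded
      equivariant := (φ.hom n).equivariant }

theorem tupleHom_comm (h : ExtendsId φ) : ∀ q, ∀ᵐ x ∂μ, ∀ u,
    (tupleHom φ (q + 1)).toFun x ((tupleCoboundaryHom M S F q).toFun x u) =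
      (tupleCoboundaryHom M T F q).toFun x ((tupleHom φ q).toFun x u)
  | 0 => h.mono fun x hx u => by
    refine (congrArg ((φ.hom 0).toFun x) (tupleCoboundary_zero u)).trans
      ((hx (zeroEval S F x u)).trans ?_)
    refine Eq.trans ?_ (tupleCoboundary_zero (S := T) (zeroTransfer S T F x u)).symm
    exact congrArg (WLinf.const (T.tupleMeasure 1 x)) (zeroEval_zeroTransfer (T := T) u).symm
  | n + 1 => φ.comm n

/-- The morphism of double complexes given by a morphism of complexes that extends the identity. -/
def doubleHom [StandardBorelSpace X] [IsProbabilityMeasure μ] {F : SeparableGBundle 𝕜 M}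
    (hM : M.IsTDiscrete) (N : InvariantMeans 𝕜 μ S) (N' : InvariantMeans 𝕜 μ T)
    (φ : GComplexHom M (LComplex μ S F.toGField) (LComplex μ T F.toGField)) (h : ExtendsId φ) :
    ExactDouble.Hom (cochainDouble F hM N) (cochainDouble F hM N') where
  f p q := (Cochain.map hM (tupleHom φ q) p).toAddMonoidHom
  map_dG _ _ c := Cochain.map_d hM _ c
  map_dS _ q c := Cochain.map_map_eq hM _ _ _ _ (tupleHom_comm φ h q) c

theorem map_zeroTransfer_zeroTransfer (hM : M.IsTDiscrete) {p : ℕ}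
    (c : Cochain μ (tupleBundle μ S F 0) p) :
    Cochain.map hM (zeroTransferHom M T S F) p (Cochain.map hM (zeroTransferHom M S T F) p c) =
      c := by
  obtain ⟨f, rfl⟩ := Cochain.mk_surjective c
  refine Cochain.mk_eq_mk.2 (ae_of_all _ fun x h => ?_)
  exact zeroTransfer_zeroTransfer (f.1 x h)

/-! ### Cochains of degree zero and invariant sections -/

variable (μ S F) in
/-- A cochain of degree zero in the arrows, as a class of vector fields. -/
def toFields (n : ℕ) : Cochain μ (tupleBundle μ S F (n + 1)) 0 →ₗ[𝕜] Fields μ (LField μ S F n) :=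
  Submodule.liftQ _
    { toFun := fun f => (nullFields μ (LField μ S F n)).mkQ fun x => f.1 x default
      map_add' := fun _ _ => rfl
      map_smul' := fun _ _ => rfl }
    fun f hf => (mk_eq_mk_iff (E := LField μ S F n) _ 0).2 <| by
      filter_upwards [show ∀ᵐ x ∂μ, ∀ h, f.1 x h = 0 from hf] with x hx
      exact hx default

theorem toFields_injective (n : ℕ) : Function.Injective (toFields μ S F n) := by
  intro c c' h
  obtain ⟨f, rfl⟩ := Cochain.mk_surjective c
  obtain ⟨f', rfl⟩ := Cochain.mk_surjective c'
  have h1 := (mk_eq_mk_iff (E := LField μ S F n) _ _).1 h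
  refine Cochain.mk_eq_mk.2 (h1.mono fun x hx g => ?_)
  obtain rfl : default = g := Subsingleton.elim _ _
  exact hx

theorem mem_LinfInv_iff (hM : M.IsTDiscrete) {n : ℕ} (c : Fields μ (LField μ S F n)) :
    c ∈ LinfInv M (LField μ S F n) ↔ ∃ a, toFields μ S F n a = c := by
  constructor
  · rintro ⟨σ, ⟨h1, ⟨C, h2⟩, h3⟩, rfl⟩
    refine ⟨Cochain.mk ⟨fun x _ => σ x, fun _ => ?_, ⟨C, h2.mono fun x hx _ => hx⟩, ?_⟩, rfl⟩
    · rw [tupleBundle_sections_succ]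
      exact h1
    · exact ((hM.ae_arrowMeasure_iff M).1 h3).mono fun x hx g _ => hx g
  · rintro ⟨a, rfl⟩
    obtain ⟨f, rfl⟩ := Cochain.mk_surjective a
    refine ⟨fun x => f.1 x default, ⟨?_, ?_, ?_⟩, rfl⟩
    · have e : (fun x => f.1 x fun i => (i.elim0 : BorelSection X) x) = fun x => f.1 x default :=
        funext fun x => congrArg (f.1 x) (Subsingleton.elim _ _)
      have h := f.2.1 fun i => i.elim0
      rw [e, tupleBundle_sections_succ] at h
      exact h
    · obtain ⟨C, hC⟩ := f.2.2.1
      exact ⟨C, hC.mono fun x hx => hx _⟩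
    · refine (hM.ae_arrowMeasure_iff M).2 (f.2.2.2.mono fun x hx g => ?_)
      refine (hx g default).trans ?_
      exact congrArg (f.1 x) (Subsingleton.elim _ _)

theorem mapFields_coboundary_toFields (hM : M.IsTDiscrete) (n : ℕ)
    (a : Cochain μ (tupleBundle μ S F (n + 1)) 0) :
    mapFields μ ((LComplex μ S F).d n) (toFields μ S F n a) =
      toFields μ S F (n + 1) (Cochain.map hM (tupleCoboundaryHom M S F (n + 1)) 0 a) := by
  obtain ⟨f, rfl⟩ := Cochain.mk_surjective a
  rfl

theorem mapFields_toFields (hM : M.IsTDiscrete) (n : ℕ)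
    (a : Cochain μ (tupleBundle μ S F (n + 1)) 0) :
    mapFields μ ((φ.hom n).toFun) (toFields μ S F n a) =
      toFields μ T F n (Cochain.map hM (tupleHom φ (n + 1)) 0 a) := by
  obtain ⟨f, rfl⟩ := Cochain.mk_surjective a
  rfl

variable [StandardBorelSpace X] [IsProbabilityMeasure μ]

theorem mem_cocycles_iff {F : SeparableGBundle 𝕜 M} (hM : M.IsTDiscrete) (N : InvariantMeans 𝕜 μ S)
    {n : ℕ} (c : Fields μ (LField μ S F.toGField n)) :
    c ∈ (LComplex μ S F.toGField).cocycles M n ↔ ∃ a, toFields μ S F.toGField n a = c ∧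
      (cochainDouble F hM N).dS 0 (n + 1) a = 0 := by
  constructor
  · rintro ⟨h1, h2⟩
    obtain ⟨a, rfl⟩ := (mem_LinfInv_iff hM c).1 h1
    refine ⟨a, rfl, toFields_injective (n + 1) ?_⟩
    rw [map_zero]
    exact (mapFields_coboundary_toFields hM n a).symm.trans h2
  · rintro ⟨a, rfl, h⟩
    refine ⟨(mem_LinfInv_iff hM _).2 ⟨a, rfl⟩, ?_⟩
    refine (mapFields_coboundary_toFields hM n a).trans ?_
    exact (congrArg (toFields μ S F.toGField (n + 1)) h).trans (map_zero _)

theorem toFields_mem_coboundaries_iff {F : SeparableGBundle 𝕜 M} (hM : M.IsTDiscrete)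
    (N : InvariantMeans 𝕜 μ S) {n : ℕ} (a : Cochain μ (tupleBundle μ S F.toGField (n + 1)) 0) :
    toFields μ S F.toGField n a ∈ (LComplex μ S F.toGField).coboundaries M n ↔
      (cochainDouble F hM N).IsCobS n a := by
  cases n with
  | zero =>
    constructor
    · intro h
      have h0 : toFields μ S F.toGField 0 a = 0 := h
      refine ⟨0, fun _ => rfl, (map_zero _).trans ?_⟩
      exact (toFields_injective 0 (h0.trans (map_zero _).symm)).symm
    · rintro ⟨a', h0, rfl⟩
      rw [h0 rfl, map_zero, map_zero]
      exact Submodule.zero_mem _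
  | succ n =>
    constructor
    · rintro ⟨-, b, hb, h⟩
      obtain ⟨a', rfl⟩ := (mem_LinfInv_iff hM b).1 hb
      refine ⟨a', fun h => absurd h (Nat.succ_ne_zero n), toFields_injective (n + 1) ?_⟩
      exact (mapFields_coboundary_toFields hM n a').symm.trans h
    · rintro ⟨a', -, rfl⟩
      refine ⟨(mem_LinfInv_iff hM _).2 ⟨_, rfl⟩, toFields μ S F.toGField n a',
        (mem_LinfInv_iff hM _).2 ⟨_, rfl⟩, ?_⟩
      exact mapFields_coboundary_toFields hM n a'

end Double

/-! ### Morphisms that extend the identity induce one isomorphism in cohomology -/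

section Comparison

variable {𝕜 : Type} [RCLike 𝕜] {X : Type u} [MeasurableSpace X] [BorelGroupoid X] {μ : Measure X}
  {M : MeasuredGroupoid X μ} {S T : GSpace X}

theorem mapCohomology_mk {A B : GComplex 𝕜 X} (φ : GComplexHom M A B) {k : ℕ}
    (c : A.cocycles M k) :
    φ.mapCohomology k (Submodule.Quotient.mk c) =
      Submodule.Quotient.mk ⟨mapFields μ ((φ.hom k).toFun) c.1, φ.map_cocycles k c.1 c.2⟩ := rfl

theorem cohomology_mk_eq_zero {A : GComplex 𝕜 X} {k : ℕ} (c : A.cocycles M k) :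
    (Submodule.Quotient.mk c : A.Cohomology M k) = 0 ↔ c.1 ∈ A.coboundaries M k :=
  Submodule.Quotient.mk_eq_zero _

variable [StandardBorelSpace X]

/-- The morphism `L(S^{(•+1)}, E) → L(G^{(•+1)}, E)` given by integration over the translates of the
measures on `S`. -/
def translateHom (hM : M.IsTDiscrete) (S : GSpace X) (F : GField 𝕜 X) :
    GComplexHom M (LComplex μ S F) (LComplex μ M.regular F) where
  hom n :=
    { toFun := translate hM S F (n + 1)
      measurable := fun σ hσ => by
        have h1 : σ ∈ (tupleBundle μ S F (n + 1)).sections := by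
          rw [tupleBundle_sections_succ]
          exact hσ
        have h2 := translate_mem_sections hM h1
        rw [tupleBundle_sections_succ] at h2
        exact h2
      bounded := ⟨1, ae_of_all _ fun _ => norm_translate_le hM⟩
      equivariant := ae_of_all _ fun a u => translate_act (μ := μ) hM a.2.2 u }
  comm n := ae_of_all _ fun x u => translate_tupleCoboundary hM u

theorem extendsId_translateHom (hM : M.IsTDiscrete) (S : GSpace X) (F : GField 𝕜 X) :
    ExtendsId (translateHom hM S F) := by
  refine ae_of_all _ fun x e => regular_ext (q := 1) fun g v => ?_
  have h := hM.ae_tuple_iff.1 (rep_const_ae (S := M.regular) (q := 1) e) g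
  refine Eq.trans ?_ (congrArg (fun θ : StrongDual 𝕜 (F.fiber x) => θ v) h).symm
  refine (rep_translate_apply hM (WLinf.const (S.tupleMeasure 1 x) e) g v).trans ?_
  rw [integral_rep_congr (rep_const_ae (S := S) (q := 1) e) g v]
  simp

theorem coefficientMap_mapCohomology_translateHom (hM : M.IsTDiscrete) (S : GSpace X)
    {F F' : GField 𝕜 X} (ψ : GMorphism M F F') (k : ℕ) (c : CohomologyOf M S F' k) :
    (coefficientMap ψ M.regular).mapCohomology k ((translateHom hM S F').mapCohomology k c) =
      (translateHom hM S F).mapCohomology k ((coefficientMap ψ S).mapCohomology k c) := by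
  obtain ⟨⟨c, hcc⟩, rfl⟩ := Submodule.Quotient.mk_surjective _ c
  obtain ⟨σ, rfl⟩ := (nullFields μ (LField μ S F' k)).mkQ_surjective c
  simp only [mapCohomology_mk]
  refine congrArg Submodule.Quotient.mk (Subtype.ext ?_)
  refine congrArg (nullFields μ (LField μ M.regular F k)).mkQ (funext fun x => ?_)
  exact (translate_pull hM (ψ.toFun x) (σ x)).symm

variable [IsProbabilityMeasure μ] {F : SeparableGBundle 𝕜 M}
  (φ φ' : GComplexHom M (LComplex μ S F.toGField) (LComplex μ T F.toGField))

/-- A morphism that extends the identity of the coefficients is an isomorphism in cohomology, if `G`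
has invariant means on both spaces. -/
theorem mapCohomology_bijective (hM : M.IsTDiscrete) (N : InvariantMeans 𝕜 μ S)
    (N' : InvariantMeans 𝕜 μ T) (h : ExtendsId φ) (k : ℕ) :
    Function.Bijective (φ.mapCohomology k) := by
  have hinj : ∀ p, Function.Injective ((doubleHom hM N N' φ h).f p 0) := fun p =>
    Function.LeftInverse.injective (map_zeroTransfer_zeroTransfer (S := S) (T := T) hM)
  have hsurj : ∀ p, Function.Surjective ((doubleHom hM N N' φ h).f p 0) := fun p =>
    Function.RightInverse.surjective (map_zeroTransfer_zeroTransfer (S := T) (T := S) hM)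
  constructor
  · refine (injective_iff_map_eq_zero (φ.mapCohomology k)).2 fun c hc => ?_
    obtain ⟨⟨c, hcc⟩, rfl⟩ := Submodule.Quotient.mk_surjective _ c
    obtain ⟨a, rfl, ha⟩ := (mem_cocycles_iff hM N c).1 hcc
    rw [mapCohomology_mk, cohomology_mk_eq_zero] at hc
    refine (cohomology_mk_eq_zero _).2 ((toFields_mem_coboundaries_iff hM N a).2 ?_)
    refine ExactDouble.Hom.isCobS_of_map (doubleHom hM N N' φ h) hinj hsurj a ha ?_
    refine (toFields_mem_coboundaries_iff hM N' _).1 ?_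
    have e := mapFields_toFields φ hM k a
    exact e ▸ hc
  · intro c
    obtain ⟨⟨c, hcc⟩, rfl⟩ := Submodule.Quotient.mk_surjective _ c
    obtain ⟨a', rfl, ha'⟩ := (mem_cocycles_iff hM N' c).1 hcc
    obtain ⟨a, ha, hcob⟩ :=
      ExactDouble.Hom.exists_map_sub_isCobS (doubleHom hM N N' φ h) hinj hsurj a' ha'
    refine ⟨Submodule.Quotient.mk ⟨toFields μ S F.toGField k a,
      (mem_cocycles_iff hM N _).2 ⟨a, rfl, ha⟩⟩, ?_⟩
    rw [mapCohomology_mk]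
    refine (Submodule.Quotient.eq _).2 ?_
    have h1 := (toFields_mem_coboundaries_iff hM N' _).2 hcob
    rw [map_sub] at h1
    have e := mapFields_toFields φ hM k a
    exact Eq.mpr (congrArg (fun z : Fields μ (LField μ T F.toGField k) =>
      z - toFields μ T F.toGField k a' ∈ (LComplex μ T F.toGField).coboundaries M k) e) h1

/-- Any two morphisms that extend the identity of the coefficients agree in cohomology. -/
theorem mapCohomology_eq (hM : M.IsTDiscrete) (N : InvariantMeans 𝕜 μ S)
    (N' : InvariantMeans 𝕜 μ T) (h : ExtendsId φ) (h' : ExtendsId φ') (k : ℕ)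
    (c : CohomologyOf M S F.toGField k) : φ.mapCohomology k c = φ'.mapCohomology k c := by
  obtain ⟨⟨c, hcc⟩, rfl⟩ := Submodule.Quotient.mk_surjective _ c
  obtain ⟨a, rfl, ha⟩ := (mem_cocycles_iff hM N c).1 hcc
  rw [mapCohomology_mk, mapCohomology_mk]
  refine (Submodule.Quotient.eq _).2 ?_
  have h1 := (toFields_mem_coboundaries_iff hM N' _).2 (ExactDouble.Hom.sub_isCobS
    (doubleHom hM N N' φ h) (doubleHom hM N N' φ' h') (fun _ _ => rfl) a ha)
  rw [map_sub] at h1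
  exact Eq.mpr (congrArg₂ (fun z z' : Fields μ (LField μ T F.toGField k) =>
    z - z' ∈ (LComplex μ T F.toGField).coboundaries M k)
    (mapFields_toFields φ hM k a) (mapFields_toFields φ' hM k a)) h1

end Comparison

end MBC

end

/-- Bounded cohomology of a `t`-discrete measured groupoid `G`, with coefficients in the duals `E` of
separable measurable `G`-bundles `F`, is canonically computed by any amenable `G`-space `S`. The
isomorphisms `Φ F k` are induced by a morphism of complexes of `G`-bundles that extends the identity
of `E`, and by every such morphism; they are natural in `E`. -/
theorem theoremA {𝕜 : Type} [RCLike 𝕜] {X : Type u} [MeasurableSpace X] [StandardBorelSpace X]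
    [BorelGroupoid X] {μ : Measure X} [IsProbabilityMeasure μ] (M : MeasuredGroupoid X μ)
    (hM : M.IsTDiscrete) (S : GSpace X) (hS : S.IsAmenable M) :
    ∃ Φ : ∀ (F : SeparableGBundle 𝕜 M) (k : ℕ),
        CohomologyOf M S F.toGField k ≃ₗ[𝕜] BoundedCohomology M F.toGField k,
      (∀ F : SeparableGBundle 𝕜 M,
        (∃ φ : GComplexHom M (LComplex μ S F.toGField) (LComplex μ M.regular F.toGField),
          ExtendsId φ) ∧
        ∀ φ : GComplexHom M (LComplex μ S F.toGField) (LComplex μ M.regular F.toGField),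
          ExtendsId φ → ∀ (k : ℕ) (c : CohomologyOf M S F.toGField k),
            φ.mapCohomology k c = Φ F k c) ∧
      ∀ (F F' : SeparableGBundle 𝕜 M) (ψ : GMorphism M F.toGField F'.toGField) (k : ℕ)
        (c : CohomologyOf M S F'.toGField k),
        (coefficientMap ψ M.regular).mapCohomology k (Φ F' k c) =
          Φ F k ((coefficientMap ψ S).mapCohomology k c) := by
  obtain ⟨N⟩ := hS.nonempty_invariantMeans hM 𝕜
  refine ⟨fun F k => LinearEquiv.ofBijective ((translateHom hM S F.toGField).mapCohomology k)
    (mapCohomology_bijective _ hM N (regularMeans 𝕜 M) (extendsId_translateHom hM S F.toGField) k),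
    fun F => ⟨⟨_, extendsId_translateHom hM S F.toGField⟩, fun φ hφ k c => ?_⟩,
    fun F F' ψ k c => ?_⟩
  · exact mapCohomology_eq φ _ hM N (regularMeans 𝕜 M) hφ
      (extendsId_translateHom hM S F.toGField) k c
  · exact coefficientMap_mapCohomology_translateHom hM S ψ k c
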